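/- Let $k$ be an algebraically closed field of characteristic $0$, let $X$ be a smooth connected projective curve over $k$, and let $\mathrm{Aff}$ be the category of affine $k$-schemes of finite type, with its Zariski topology. All products and morphisms are over $k$. **Generic maps.** For a $k$-scheme $S$, an $S$-family of domains in $X$ is an open $U\subseteq S\times X$ such that for every $T\to S$ the preimage of $U$ in $T\times X$ is dense. For a $k$-scheme $Y$, let $\mathrm{GMap}(X,Y):\mathrm{Aff}^{op}\to\mathrm{Set}$ be the presheaf with $\mathrm{GMap}(X,Y)(S)=\mathrm{colim}_U\,\mathrm{Hom}_k(U,Y)$, where $U$ runs over the $S$-families of domains; two maps are identified if they agree on a smaller $S$-family of domains. **Quasi-maps.** Let $\mathrm{QMap}(X,\mathbb P^n)(S)$ be the set of isomorphism classes of pairs $(\mathcal L,\ \mathcal L\hookrightarrow\mathcal O_{S\times X}^{n+1})$ with $\mathcal L$ a line bundle on $S\times X$ and the map an injection of sheaves with $S$-flat cokernel. For a closed subscheme $Z\subseteq\mathbb P^n$ with graded ideal $I_Z\subseteq k[x_0,\dots,x_n]$, let $\mathrm{QMap}(X,Z)\subseteq\mathrm{QMap}(X,\mathbb P^n)$ consist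 of those pairs for which the composite $\mathcal O_{S\times X}\otimes I_Z\to\mathrm{Sym}\,\mathcal O_{S\times X}^{n+1}\to\mathrm{Sym}\,\mathcal L^\vee$ vanishes. For a locally closed subscheme $Y\hookrightarrow\mathbb P^n$ with scheme-theoretic closure $\overline Y$, let $\mathrm{QMap}(X,Y)\subseteq\mathrm{QMap}(X,\overline Y)$ be the complement of the quasi-maps to $\overline Y\setminus Y$: an $S$-point of $\mathrm{QMap}(X,\overline Y)$ belongs to it iff its pullback to every nonempty $T\to S$ in $\mathrm{Aff}$ is not a $T$-point of $\mathrm{QMap}(X,\overline Y\setminus Y)$. The regularity domain of a quasi-map is the open set where $\mathcal L\to\mathcal O^{n+1}$ is a sub-bundle embedding, i.e. injective on fibres. Let $\mathcal E_Y(S)\subseteq \mathrm{QMap}(X,Y)(S)^2$ be the set of pairs of quasi-maps whose subsheaves of $\mathcal O_{S\times X}^{n+1}$ agree over the intersection of their regularity domains, and let $\mathrm{QMap}(X,Y)/\mathcal E_Y$ be the presheaf $S\mapsto \mathrm{QMap}(X,Y)(S)/\mathcal E_Y(S)$. **Proposition.** Let $Y\hookrightarrow\mathbb P^n$ be a locally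 closed subscheme over $k$. 1. $\mathcal E_Y(S)$ is an equivalence relation for every $S$. 2. There is a unique map of presheaves $\eta:\mathrm{QMap}(X,Y)\to\mathrm{GMap}(X,Y)$ that sends each quasi-map $\mathcal L\hookrightarrow\mathcal O_{S\times X}^{n+1}$ to the class of a map $\varphi:U\to Y$, where $U$ is an $S$-family of domains contained in the regularity domain and $\mathcal L|_U$ is the pullback of the tautological sub-bundle $\mathcal O(-1)\subseteq\mathcal O^{n+1}$ along $U\xrightarrow{\varphi}Y\hookrightarrow\mathbb P^n$. 3. $\eta$ induces a map of presheaves $\Phi:\mathrm{QMap}(X,Y)/\mathcal E_Y\to\mathrm{GMap}(X,Y)$, which becomes an isomorphism after Zariski sheafification. 4. Consequently, up to isomorphism compatible with the maps to the sheafification of $\mathrm{GMap}(X,Y)$, the Zariski sheafification of $\mathrm{QMap}(X,Y)/\mathcal E_Y$ does not depend on the embedding of $Y$ as a locally closed subscheme of a projective space. -/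

import Mathlib

open CategoryTheory CategoryTheory.Limits AlgebraicGeometry Opposite TopologicalSpace
universe u
noncomputable section
namespace GenericMaps

variable (k : Type u) [Field k]

/-- Schemes over the field `k`. -/
abbrev Sch := Over (Spec (CommRingCat.of k))

/-- Affine schemes of finite type over `k` (an affine `S` is quasi-compact over `k`, so
"locally of finite type" is "of finite type"). -/
abbrev IsAffFT : ObjectProperty (Sch k) :=
  fun S => IsAffine S.left ∧ LocallyOfFiniteType S.hom

/-- The category of affine schemes of finite type over `k`. -/
abbrev Aff := (IsAffFT k).FullSubcategory

/-- The Zariski topology on `Aff k`: a sieve on `S` is covering if the open immersions belonging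
to it jointly cover `S`. -/
def zariski : GrothendieckTopology (Aff k) where
  sieves S := {R | ∀ s : S.obj.left, ∃ (T : Aff k) (g : T ⟶ S), R g ∧
    IsOpenImmersion g.hom.left ∧ s ∈ Set.range g.hom.left}
  top_mem' S s := ⟨S, 𝟙 S, trivial, by
    change IsOpenImmersion (𝟙 S.obj.left); infer_instance, s, rfl⟩
  pullback_stable' := by
    intro S S' R h hR s
    obtain ⟨T, g, hg, hgo, t, ht⟩ := hR (h.hom.left s)
    have := S.property.1
    have := S'.property.1
    have := T.property.1
    let P : Sch k := Over.mk (pullback.fst h.hom.left g.hom.left ≫ S'.obj.hom)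
    have hP : IsAffFT k P := by
      refine ⟨inferInstanceAs (IsAffine (pullback h.hom.left g.hom.left)), ?_⟩
      have := S'.property.2
      exact inferInstanceAs (LocallyOfFiniteType
        (pullback.fst h.hom.left g.hom.left ≫ S'.obj.hom))
    let a : P ⟶ S'.obj := Over.homMk (pullback.fst h.hom.left g.hom.left) rfl
    let b : P ⟶ T.obj := Over.homMk (pullback.snd h.hom.left g.hom.left) (by
      have h1 := Over.w g.hom
      have h2 := Over.w h.hom
      rw [← h1, ← pullback.condition_assoc, h2]; rfl)
    refine ⟨⟨P, hP⟩, ⟨a⟩, ?_, ?_, ?_⟩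
    · have : (⟨a⟩ : (⟨P, hP⟩ : Aff k) ⟶ S') ≫ h = (⟨b⟩ : (⟨P, hP⟩ : Aff k) ⟶ T) ≫ g := by
        ext : 2
        exact pullback.condition
      change R (_ ≫ h)
      rw [this]
      exact R.downward_closed hg _
    · exact inferInstanceAs (IsOpenImmersion (pullback.fst h.hom.left g.hom.left))
    · change s ∈ Set.range (pullback.fst h.hom.left g.hom.left)
      rw [Scheme.Pullback.range_fst]
      exact ⟨t, ht⟩
  transitive' := by
    intro S R hR R' hR' s
    obtain ⟨T, g, hg, hgo, t, rfl⟩ := hR s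
    obtain ⟨T', g', hg', hgo', t', rfl⟩ := hR' hg t
    refine ⟨T', g' ≫ g, hg', ?_, t', rfl⟩
    exact inferInstanceAs (IsOpenImmersion (g'.hom.left ≫ g.hom.left))

variable {k}

/-- The product `S × X` over `k`. -/
abbrev prodOver (S X : Sch k) : Scheme.{u} := pullback S.hom X.hom

/-- The structure map `S × X ⟶ Spec k`. -/
abbrev prodStr (S X : Sch k) : prodOver S X ⟶ Spec (CommRingCat.of k) :=
  pullback.fst S.hom X.hom ≫ S.hom

/-- The map `g × id : T × X ⟶ S × X`. -/
def prodMap {T S : Sch k} (g : T ⟶ S) (X : Sch k) : prodOver T X ⟶ prodOver S X :=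
  pullback.lift (pullback.fst _ _ ≫ g.left) (pullback.snd _ _) (by
    rw [Category.assoc, Over.w g, pullback.condition])

lemma prodMap_fst {T S : Sch k} (g : T ⟶ S) (X : Sch k) :
    prodMap g X ≫ pullback.fst S.hom X.hom = pullback.fst T.hom X.hom ≫ g.left :=
  pullback.lift_fst _ _ _

lemma prodMap_snd {T S : Sch k} (g : T ⟶ S) (X : Sch k) :
    prodMap g X ≫ pullback.snd S.hom X.hom = pullback.snd T.hom X.hom :=
  pullback.lift_snd _ _ _

lemma prodMap_id (S X : Sch k) : prodMap (𝟙 S) X = 𝟙 _ := by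
  apply pullback.hom_ext
  · rw [prodMap_fst]; simp
  · rw [prodMap_snd]; simp

lemma prodMap_comp {R T S : Sch k} (h : R ⟶ T) (g : T ⟶ S) (X : Sch k) :
    prodMap (h ≫ g) X = prodMap h X ≫ prodMap g X := by
  apply pullback.hom_ext
  · rw [prodMap_fst, Category.assoc, prodMap_fst, ← Category.assoc, prodMap_fst, Category.assoc,
      Over.comp_left]
  · rw [prodMap_snd, Category.assoc, prodMap_snd, prodMap_snd]

lemma prodMap_str {T S : Sch k} (g : T ⟶ S) (X : Sch k) :
    prodMap g X ≫ prodStr S X = prodStr T X := by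
  rw [prodStr, ← Category.assoc, prodMap_fst, Category.assoc, Over.w g]

lemma prodMap_isPullback {T S : Sch k} (g : T ⟶ S) (X : Sch k) :
    IsPullback (prodMap g X) (pullback.fst T.hom X.hom) (pullback.fst S.hom X.hom) g.left := by
  have h1 : IsPullback (pullback.snd T.hom X.hom) (pullback.fst T.hom X.hom) X.hom T.hom :=
    (IsPullback.of_hasPullback _ _).flip
  have h2 : IsPullback (pullback.snd S.hom X.hom) (pullback.fst S.hom X.hom) X.hom S.hom :=
    (IsPullback.of_hasPullback _ _).flip
  refine IsPullback.of_right (h₁₂ := pullback.snd S.hom X.hom) (h₂₂ := S.hom) (v₁₃ := X.hom)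
    ?_ (prodMap_fst g X) h2
  rw [Over.w g, prodMap_snd]
  exact h1

/-- An open `U ⊆ S × X` is an `S`-family of domains in `X` if it is universally dense over `S`: for
every `T ⟶ S`, its preimage in `T × X` is dense. -/
def IsDomainFamily {S X : Sch k} (U : (prodOver S X).Opens) : Prop :=
  ∀ (T : Sch k) (g : T ⟶ S), Dense ((prodMap g X ⁻¹ᵁ U : (prodOver T X).Opens) : Set (prodOver T X))

lemma IsDomainFamily.inf {S X : Sch k} {U V : (prodOver S X).Opens} (hU : IsDomainFamily U)
    (hV : IsDomainFamily V) : IsDomainFamily (U ⊓ V) := fun T g =>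
  (hU T g).inter_of_isOpen_left (hV T g) (prodMap g X ⁻¹ᵁ U).isOpen

lemma IsDomainFamily.preimage {S T X : Sch k} {U : (prodOver S X).Opens} (hU : IsDomainFamily U)
    (g : T ⟶ S) : IsDomainFamily (prodMap g X ⁻¹ᵁ U) := fun R h => by
  have := hU R (h ≫ g)
  rwa [prodMap_comp] at this

/-- A `k`-morphism to `Y` defined on an `S`-family of domains in `X`. -/
structure GenMap (X Y S : Sch k) where
  dom : (prodOver S X).Opens
  isDomainFamily : IsDomainFamily dom
  hom : (dom : Scheme.{u}) ⟶ Y.left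
  w : hom ≫ Y.hom = dom.ι ≫ prodStr S X

/-- Two such morphisms are identified if they agree on a smaller `S`-family of domains. -/
instance GenMap.setoid (X Y S : Sch k) : Setoid (GenMap X Y S) where
  r φ ψ := ∃ (W : (prodOver S X).Opens) (hφ : W ≤ φ.dom) (hψ : W ≤ ψ.dom), IsDomainFamily W ∧
    (prodOver S X).homOfLE hφ ≫ φ.hom = (prodOver S X).homOfLE hψ ≫ ψ.hom
  iseqv :=
    { refl := fun φ => ⟨φ.dom, le_rfl, le_rfl, φ.isDomainFamily, rfl⟩
      symm := fun ⟨W, h, h', hW, e⟩ => ⟨W, h', h, hW, e.symm⟩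
      trans := by
        rintro φ ψ χ ⟨W, h, h', hW, e⟩ ⟨W', j, j', hW', e'⟩
        refine ⟨W ⊓ W', inf_le_left.trans h, inf_le_right.trans j', hW.inf hW', ?_⟩
        have e1 := congrArg (fun t => (prodOver S X).homOfLE (inf_le_left : W ⊓ W' ≤ W) ≫ t) e
        have e2 := congrArg (fun t => (prodOver S X).homOfLE (inf_le_right : W ⊓ W' ≤ W') ≫ t) e'
        simp only [Scheme.homOfLE_homOfLE_assoc] at e1 e2
        exact e1.trans e2 }

/-- Base change of a generically defined map along `g : T ⟶ S`. -/
def GenMap.pullback {X Y S T : Sch k} (g : T ⟶ S) (φ : GenMap X Y S) : GenMap X Y T where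
  dom := prodMap g X ⁻¹ᵁ φ.dom
  isDomainFamily := φ.isDomainFamily.preimage g
  hom := prodMap g X ∣_ φ.dom ≫ φ.hom
  w := by
    rw [Category.assoc, φ.w, morphismRestrict_ι_assoc, prodMap_str]

lemma GenMap.pullback_equiv {X Y S T : Sch k} (g : T ⟶ S) {φ ψ : GenMap X Y S} (h : φ ≈ ψ) :
    φ.pullback g ≈ ψ.pullback g := by
  obtain ⟨W, h, h', hW, e⟩ := h
  have key : ∀ {U : (prodOver S X).Opens} (hU : W ≤ U),
      (prodOver T X).homOfLE (show prodMap g X ⁻¹ᵁ W ≤ prodMap g X ⁻¹ᵁ U from fun _ hx => hU hx) ≫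
        prodMap g X ∣_ U = prodMap g X ∣_ W ≫ (prodOver S X).homOfLE hU := by
    intro U hU
    rw [← cancel_mono U.ι]
    simp
  refine ⟨prodMap g X ⁻¹ᵁ W, fun _ hx => h hx, fun _ hx => h' hx, hW.preimage g, ?_⟩
  dsimp only [GenMap.pullback]
  rw [reassoc_of% (key h), reassoc_of% (key h'), e]

lemma GenMap.pullback_id {X Y S : Sch k} (φ : GenMap X Y S) : φ.pullback (𝟙 S) ≈ φ := by
  have h : prodMap (𝟙 S) X ⁻¹ᵁ φ.dom ≤ φ.dom := by rw [prodMap_id]; exact le_rfl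
  refine ⟨prodMap (𝟙 S) X ⁻¹ᵁ φ.dom, le_rfl, h, φ.isDomainFamily.preimage _, ?_⟩
  have key : prodMap (𝟙 S) X ∣_ φ.dom = (prodOver S X).homOfLE h := by
    rw [← cancel_mono φ.dom.ι, morphismRestrict_ι, Scheme.homOfLE_ι, prodMap_id, Category.comp_id]
  dsimp only [GenMap.pullback]
  rw [key]
  simp

lemma GenMap.pullback_comp {X Y R S T : Sch k} (h : R ⟶ T) (g : T ⟶ S) (φ : GenMap X Y S) :
    φ.pullback (h ≫ g) ≈ (φ.pullback g).pullback h := by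
  have hle : prodMap (h ≫ g) X ⁻¹ᵁ φ.dom ≤ prodMap h X ⁻¹ᵁ (prodMap g X ⁻¹ᵁ φ.dom) := by
    rw [prodMap_comp]; exact le_rfl
  refine ⟨prodMap (h ≫ g) X ⁻¹ᵁ φ.dom, le_rfl, hle, φ.isDomainFamily.preimage _, ?_⟩
  have key : prodMap (h ≫ g) X ∣_ φ.dom = (prodOver R X).homOfLE hle ≫
      prodMap h X ∣_ (prodMap g X ⁻¹ᵁ φ.dom) ≫ prodMap g X ∣_ φ.dom := by
    rw [← cancel_mono φ.dom.ι]
    simp [prodMap_comp]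
  dsimp only [GenMap.pullback]
  rw [key]
  simp

/-- The presheaf of generically defined maps from `X` to `Y`. Its value at `S` is the filtered
colimit, over the poset of `S`-families of domains `U ⊆ S × X` ordered by reverse inclusion, of
`Hom_k(U, Y)`; this is the pointwise formula for the left Kan extension of `(S, U) ↦ Hom_k(U, Y)`
along `(S, U) ↦ S`. -/
def GMap (X Y : Sch k) : (Aff k)ᵒᵖ ⥤ Type u where
  obj S := Quotient (GenMap.setoid X Y S.unop.obj)
  map g := ↾(Quotient.map (GenMap.pullback g.unop.hom) fun _ _ h => GenMap.pullback_equiv _ h)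
  map_id S := by
    ext x
    induction x using Quotient.inductionOn with | _ φ
    exact Quotient.sound φ.pullback_id
  map_comp g h := by
    ext x
    induction x using Quotient.inductionOn with | _ φ
    exact Quotient.sound (φ.pullback_comp h.unop.hom g.unop.hom)

/-- A family of submodules `L_z ⊆ 𝒪_{Z,z}^m`, one for each point `z`. Subsheaves of `𝒪_Z^m` are
recorded by their stalks; that the stalks fit together to a subsheaf is part of
`IsFlatInvertible` below, which asks for local generators. -/
def StalkFamily (Z : Scheme.{u}) (m : ℕ) : Type u :=
  ∀ z : Z, Submodule (Z.presheaf.stalk z) (Fin m → Z.presheaf.stalk z)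

/-- The map `𝒪_{Z,g(w)}^m → 𝒪_{W,w}^m` induced by `g : W ⟶ Z`. -/
def stalkVec {W Z : Scheme.{u}} (m : ℕ) (g : W ⟶ Z) (w : W) :
    (Fin m → Z.presheaf.stalk (g w)) →ₛₗ[(g.stalkMap w).hom] (Fin m → W.presheaf.stalk w) where
  toFun v j := (g.stalkMap w).hom (v j)
  map_add' _ _ := by ext; simp
  map_smul' _ _ := by ext; simp

lemma stalkVec_comp {W V Z : Scheme.{u}} (m : ℕ) (h : W ⟶ V) (g : V ⟶ Z) (w : W)
    (v : Fin m → Z.presheaf.stalk (g (h w))) :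
    stalkVec m (h ≫ g) w v = stalkVec m h w (stalkVec m g (h w) v) := by
  ext j
  change ((h ≫ g).stalkMap w).hom (v j) = (h.stalkMap w).hom ((g.stalkMap (h w)).hom (v j))
  rw [Scheme.Hom.stalkMap_comp]
  rfl

/-- The image of `g^* L` in `𝒪_W^m`: at `w` it is generated by the image of `L_{g(w)}`. (When
`𝒪_Z^m / L` is flat over a base and `g` is a base change, `g^* L ⟶ 𝒪_W^m` is injective, and this
image is `g^* L`.) -/
def StalkFamily.pullback {W Z : Scheme.{u}} {m : ℕ} (g : W ⟶ Z) (L : StalkFamily Z m) :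
    StalkFamily W m := fun w =>
  Submodule.span (W.presheaf.stalk w) (stalkVec m g w '' (L (g w) : Set (Fin m → Z.presheaf.stalk (g w))))

lemma StalkFamily.pullback_id {Z : Scheme.{u}} {m : ℕ} (L : StalkFamily Z m) :
    L.pullback (𝟙 Z) = L := by
  funext z
  have : ∀ v : Fin m → Z.presheaf.stalk z, stalkVec m (𝟙 Z) z v = v := by
    intro v
    ext j
    change ((𝟙 Z : Z ⟶ Z).stalkMap z).hom (v j) = v j
    rw [Scheme.Hom.stalkMap_id]
    rfl
  have h2 : stalkVec m (𝟙 Z) z '' (L z : Set (Fin m → Z.presheaf.stalk z)) = L z := by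
    ext x
    constructor
    · rintro ⟨v, hv, rfl⟩
      exact Set.mem_of_eq_of_mem (this v) hv
    · intro hx
      exact ⟨x, hx, this x⟩
  change Submodule.span _ (stalkVec m (𝟙 Z) z '' (L z : Set (Fin m → Z.presheaf.stalk z))) = L z
  rw [h2, Submodule.span_eq]

lemma StalkFamily.pullback_comp {W V Z : Scheme.{u}} {m : ℕ} (h : W ⟶ V) (g : V ⟶ Z)
    (L : StalkFamily Z m) : L.pullback (h ≫ g) = (L.pullback g).pullback h := by
  funext w
  dsimp only [StalkFamily.pullback]
  apply le_antisymm
  · refine Submodule.span_le.mpr ?_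
    rintro _ ⟨v, hv, rfl⟩
    refine Submodule.subset_span ⟨stalkVec m g (h w) v, Submodule.subset_span ⟨v, hv, rfl⟩, ?_⟩
    exact (stalkVec_comp m h g w v).symm
  · refine Submodule.span_le.mpr ?_
    rintro _ ⟨v, hv, rfl⟩
    simp only [SetLike.mem_coe] at hv ⊢
    induction hv using Submodule.span_induction with
    | mem x hx =>
      obtain ⟨y, hy, rfl⟩ := hx
      exact Submodule.subset_span ⟨y, hy, stalkVec_comp m h g w y⟩
    | zero => rw [map_zero]; exact Submodule.zero_mem _
    | add x y hx hy h1 h2 => rw [map_add]; exact Submodule.add_mem _ h1 h2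
    | smul a x hx h1 => rw [map_smulₛₗ]; exact Submodule.smul_mem _ _ h1

lemma StalkFamily.pullback_span {W Z : Scheme.{u}} {m : ℕ} (g : W ⟶ Z) (L : StalkFamily Z m)
    (w : W) (v : Fin m → Z.presheaf.stalk (g w)) (hv : L (g w) = Submodule.span _ {v}) :
    L.pullback g w = Submodule.span _ {stalkVec m g w v} := by
  dsimp only [StalkFamily.pullback]
  apply le_antisymm
  · refine Submodule.span_le.mpr ?_
    rintro _ ⟨x, hx, rfl⟩
    rw [SetLike.mem_coe, hv, Submodule.mem_span_singleton] at hx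
    obtain ⟨a, rfl⟩ := hx
    rw [map_smulₛₗ]
    exact Submodule.smul_mem _ _ (Submodule.mem_span_singleton_self _)
  · rw [Submodule.span_singleton_le_iff_mem]
    refine Submodule.subset_span ⟨v, ?_, rfl⟩
    rw [hv]
    exact Submodule.mem_span_singleton_self _

/-- The germs at `z` of a vector of sections over `V`. -/
def germVec {Z : Scheme.{u}} {m : ℕ} {V : Z.Opens} (f : Fin m → Γ(Z, V)) (z : Z) (hz : z ∈ V) :
    Fin m → Z.presheaf.stalk z := fun j => Z.presheaf.germ V z hz (f j)

lemma stalkVec_germVec {W Z : Scheme.{u}} {m : ℕ} (g : W ⟶ Z) {V : Z.Opens}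
    (f : Fin m → Γ(Z, V)) (w : W) (hw : g w ∈ V) :
    stalkVec m g w (germVec f (g w) hw) =
      germVec (V := g ⁻¹ᵁ V) (fun j => (g.app V).hom (f j)) w hw := by
  ext j
  exact Scheme.Hom.germ_stalkMap_apply g V w hw (f j)

/-- For `p : Z ⟶ S` with `S` affine: `L` is an invertible subsheaf of `𝒪_Z^m` whose cokernel is
`S`-flat. Around every point there is an affine open `V` and a vector `f` of sections over `V` which
generates `L` on `V`, and freely so (`a f = 0` implies `a = 0`), such that `Γ(V, 𝒪)^m / (f)`, the
module of sections of `𝒪^m / L` over `V`, is flat over `Γ(S, 𝒪)`. Isomorphism classes of pairs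
`(L, L ↪ 𝒪^m)` with `L` a line bundle are the same as invertible subsheaves. -/
def IsFlatInvertible {Z S : Scheme.{u}} (p : Z ⟶ S) {m : ℕ} (L : StalkFamily Z m) : Prop :=
  ∀ z : Z, ∃ (V : Z.Opens) (f : Fin m → Γ(Z, V)), IsAffineOpen V ∧ z ∈ V ∧
    (∀ (w : Z) (hw : w ∈ V), L w = Submodule.span (Z.presheaf.stalk w) {germVec f w hw}) ∧
    (∀ a : Γ(Z, V), (∀ j, a * f j = 0) → a = 0) ∧
    letI : Algebra Γ(S, ⊤) Γ(Z, V) := (p.appLE ⊤ V le_top).hom.toAlgebra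
    Module.Flat Γ(S, ⊤) ((Fin m → Γ(Z, V)) ⧸ Submodule.span Γ(Z, V) {f})

open TensorProduct in
lemma flat_aux₁ {R R' A A' N : Type*} [CommRing R] [CommRing R'] [CommRing A] [CommRing A']
    [Algebra R A] [Algebra R R'] [Algebra R A'] [Algebra A A'] [Algebra R' A']
    [IsScalarTower R A A'] [IsScalarTower R R' A'] [Algebra.IsPushout R R' A A']
    [AddCommGroup N] [Module R N] [Module.Flat R N]
    {m : ℕ} (f : Fin m → A) (hf : ∀ a : A, (∀ j, a * f j = 0) → a = 0)
    (p : (Fin m → A) →ₗ[R] N) (hp : Function.Surjective p)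
    (hpf : ∀ x, p x = 0 ↔ x ∈ Submodule.span A {f}) :
    (∀ a : A', (∀ j, a * algebraMap A A' (f j) = 0) → a = 0) ∧
      Module.Flat R' ((Fin m → A') ⧸ Submodule.span A' {fun j => algebraMap A A' (f j)}) := by
  let h : A →ₗ[R] (Fin m → A) := (LinearMap.toSpanSingleton A (Fin m → A) f).restrictScalars R
  have hex : Function.Exact h p := by
    intro x
    simp [h, hpf, Submodule.mem_span_singleton]
  have hinj : Function.Injective h := by
    rw [injective_iff_map_eq_zero]
    intro a ha
    exact hf a fun j => by simpa [h] using congrFun ha j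
  have hTinj : Function.Injective (h.lTensor R') :=
    LinearMap.lTensor_injective_of_exact_of_flat p hp h hinj hex R'
  have hTex : Function.Exact (h.lTensor R') (p.lTensor R') := lTensor_exact R' hex hp
  let e : R' ⊗[R] A ≃ₗ[R'] A' := (Algebra.IsPushout.equiv R R' A A').toLinearEquiv
  let em : R' ⊗[R] (Fin m → A) ≃ₗ[R'] (Fin m → A') :=
    (TensorProduct.piRight R R' R' (fun _ : Fin m => A)).trans (LinearEquiv.piCongrRight fun _ => e)
  have hsq : ∀ t : R' ⊗[R] A, em (h.lTensor R' t) = e t • fun j => algebraMap A A' (f j) := by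
    intro t
    induction t with
    | zero => simp
    | add x y hx hy => simp only [map_add, hx, hy, add_smul]
    | tmul r a =>
      ext j
      simp [em, e, h, Algebra.IsPushout.equiv_tmul, Algebra.smul_def, mul_assoc]
  constructor
  · intro a ha
    obtain ⟨t, rfl⟩ := e.surjective a
    have : em (h.lTensor R' t) = 0 := by
      rw [hsq]; ext j; simpa using ha j
    have : t = 0 := by
      apply hTinj; rw [map_zero]; simpa using this
    simp [this]
  · let ψ : (Fin m → A') →ₗ[R'] R' ⊗[R] N :=
      (p.baseChange R') ∘ₗ em.symm.toLinearMap
    have hψ : Function.Surjective ψ := by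
      have : Function.Surjective (p.lTensor R') := LinearMap.lTensor_surjective _ hp
      exact this.comp em.symm.surjective
    have hk : LinearMap.ker ψ =
        (Submodule.span A' {fun j => algebraMap A A' (f j)}).restrictScalars R' := by
      ext x
      rw [LinearMap.mem_ker, Submodule.restrictScalars_mem, Submodule.mem_span_singleton]
      change p.lTensor R' (em.symm x) = 0 ↔ _
      rw [hTex]
      constructor
      · rintro ⟨t, ht⟩
        exact ⟨e t, by rw [← hsq, ht]; simp⟩
      · rintro ⟨a, rfl⟩
        obtain ⟨t, rfl⟩ := e.surjective a
        exact ⟨t, by rw [← hsq]; simp⟩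
    let N' : Submodule A' (Fin m → A') := Submodule.span A' {fun j => algebraMap A A' (f j)}
    let e₁ : ((Fin m → A') ⧸ N'.restrictScalars R') ≃ₗ[R'] ((Fin m → A') ⧸ N') :=
      Submodule.Quotient.restrictScalarsEquiv R' N'
    let e₂ : ((Fin m → A') ⧸ LinearMap.ker ψ) ≃ₗ[R'] ((Fin m → A') ⧸ N'.restrictScalars R') :=
      Submodule.quotEquivOfEq _ _ hk
    let e₃ : ((Fin m → A') ⧸ LinearMap.ker ψ) ≃ₗ[R']
        R' ⊗[R] N := ψ.quotKerEquivOfSurjective hψ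
    have h₃ : Module.Flat R' ((Fin m → A') ⧸ LinearMap.ker ψ) := Module.Flat.of_linearEquiv e₃
    have h₂ : Module.Flat R' ((Fin m → A') ⧸ N'.restrictScalars R') :=
      Module.Flat.of_linearEquiv e₂.symm
    exact Module.Flat.of_linearEquiv e₁.symm


lemma flat_aux {R R' A A' : Type*} [CommRing R] [CommRing R'] [CommRing A] [CommRing A']
    [Algebra R A] [Algebra R R'] [Algebra R A'] [Algebra A A'] [Algebra R' A']
    [IsScalarTower R A A'] [IsScalarTower R R' A'] [Algebra.IsPushout R R' A A']
    {m : ℕ} (f : Fin m → A) (hf : ∀ a : A, (∀ j, a * f j = 0) → a = 0)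
    (hflat : Module.Flat R ((Fin m → A) ⧸ Submodule.span A {f})) :
    (∀ a : A', (∀ j, a * algebraMap A A' (f j) = 0) → a = 0) ∧
      Module.Flat R' ((Fin m → A') ⧸ Submodule.span A' {fun j => algebraMap A A' (f j)}) := by
  let p : (Fin m → A) →ₗ[R] ((Fin m → A) ⧸ Submodule.span A {f}) :=
    { toFun := Submodule.Quotient.mk
      map_add' := fun _ _ => rfl
      map_smul' := fun _ _ => rfl }
  exact flat_aux₁ (R := R) f hf p (Submodule.Quotient.mk_surjective _)
    fun x => Submodule.Quotient.mk_eq_zero _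

/-- Invertible subsheaves with `S`-flat cokernel are stable under base change. -/
lemma IsFlatInvertible.pullback {Z Z' S S' : Scheme.{u}} [IsAffine S] [IsAffine S']
    {G : Z' ⟶ Z} {p' : Z' ⟶ S'} {p : Z ⟶ S} {g : S' ⟶ S} (H : IsPullback G p' p g)
    {m : ℕ} {L : StalkFamily Z m} (hL : IsFlatInvertible p L) :
    IsFlatInvertible p' (L.pullback G) := by
  intro z
  obtain ⟨V, f, hV, hz, hspan, hinj, hflat⟩ := hL (G z)
  have : IsAffineHom g := inferInstance
  have : IsAffineHom G := MorphismProperty.of_isPullback H.flip this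
  refine ⟨G ⁻¹ᵁ V, fun j => (G.app V).hom (f j), hV.preimage G, hz, ?_, ?_⟩
  · intro w hw
    rw [StalkFamily.pullback_span G L w _ (hspan (G w) hw)]
    exact congrArg (fun t => Submodule.span _ {t}) (stalkVec_germVec G f w hw)
  · have hpo := (isIso_pushoutSection_iff H (US := ⊤) (UT := ⊤) (UX := V) (UY := G ⁻¹ᵁ V)
      le_top le_top (by simp)).mp
      (isIso_pushoutSection_of_isAffineOpen _ _ _ _ (isAffineOpen_top S) (isAffineOpen_top S') hV)
    let : Algebra Γ(S, ⊤) Γ(Z, V) := (p.appLE ⊤ V le_top).hom.toAlgebra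
    let : Algebra Γ(S, ⊤) Γ(S', ⊤) := (g.appLE ⊤ ⊤ le_top).hom.toAlgebra
    let : Algebra Γ(Z, V) Γ(Z', G ⁻¹ᵁ V) := (G.appLE V (G ⁻¹ᵁ V) le_rfl).hom.toAlgebra
    let : Algebra Γ(S', ⊤) Γ(Z', G ⁻¹ᵁ V) := (p'.appLE ⊤ (G ⁻¹ᵁ V) le_top).hom.toAlgebra
    let : Algebra Γ(S, ⊤) Γ(Z', G ⁻¹ᵁ V) :=
      (p.appLE ⊤ V le_top ≫ G.appLE V (G ⁻¹ᵁ V) le_rfl).hom.toAlgebra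
    have : IsScalarTower Γ(S, ⊤) Γ(Z, V) Γ(Z', G ⁻¹ᵁ V) := .of_algebraMap_eq' rfl
    have : IsScalarTower Γ(S, ⊤) Γ(S', ⊤) Γ(Z', G ⁻¹ᵁ V) :=
      .of_algebraMap_eq' (congrArg CommRingCat.Hom.hom hpo.w)
    have : Algebra.IsPushout Γ(S, ⊤) Γ(S', ⊤) Γ(Z, V) Γ(Z', G ⁻¹ᵁ V) :=
      CommRingCat.isPushout_iff_isPushout.mp hpo.flip
    have := flat_aux (R := Γ(S, ⊤)) (R' := Γ(S', ⊤)) (A := Γ(Z, V)) (A' := Γ(Z', G ⁻¹ᵁ V))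
      f hinj hflat
    have e : (fun j => algebraMap Γ(Z, V) Γ(Z', G ⁻¹ᵁ V) (f j)) =
        fun j => (G.app V).hom (f j) := by
      funext j
      change (G.appLE V (G ⁻¹ᵁ V) le_rfl).hom (f j) = _
      rw [← Scheme.Hom.app_eq_appLE]
    rw [e] at this
    refine ⟨fun a ha => this.1 a fun j => ?_, this.2⟩
    exact (congrArg (a * ·) (congrFun e j)).trans (ha j)

/-- The inclusion `L ⊆ 𝒪_Z^m` is a sub-bundle embedding at `z`: it is injective on the fibre at
`z`, that is, some local section of `L` has a coordinate which does not vanish at `z`. -/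
def IsRegularAt {Z : Scheme.{u}} {m : ℕ} (L : StalkFamily Z m) (z : Z) : Prop :=
  ∃ v ∈ L z, ∃ j, IsUnit (v j)

lemma IsRegularAt.of_pullback {Z' Z S : Scheme.{u}} {m : ℕ} {p : Z ⟶ S} {L : StalkFamily Z m}
    (hL : IsFlatInvertible p L) (G : Z' ⟶ Z) {z : Z'} (h : IsRegularAt (L.pullback G) z) :
    IsRegularAt L (G z) := by
  obtain ⟨V, f, hV, hz, hspan, -⟩ := hL (G z)
  obtain ⟨x, hx, j, hj⟩ := h
  rw [StalkFamily.pullback_span G L z _ (hspan (G z) hz), Submodule.mem_span_singleton] at hx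
  obtain ⟨a, rfl⟩ := hx
  refine ⟨germVec f (G z) hz, ?_, j, ?_⟩
  · rw [hspan (G z) hz]; exact Submodule.mem_span_singleton_self _
  · have : IsUnit ((G.stalkMap z).hom (germVec f (G z) hz j)) := isUnit_of_mul_isUnit_right hj
    exact isUnit_of_map_unit (G.stalkMap z).hom _ this

section Proj
attribute [local instance] MvPolynomial.gradedAlgebra
open MvPolynomial

variable (k) in
/-- Projective space `ℙⁿ` over `k`, the `Proj` of `k[x_0, …, x_n]`. -/
def projSpace (n : ℕ) : Sch k :=
  Over.mk (Proj.toSpecZero (homogeneousSubmodule (Fin (n + 1)) k) ≫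
    Spec.map (CommRingCat.ofHom (algebraMap k (homogeneousSubmodule (Fin (n + 1)) k 0))))

variable (k) in
/-- The standard affine chart `D₊(x_j)` of `ℙⁿ`. -/
def chart (n : ℕ) (j : Fin (n + 1)) : (projSpace k n).left.affineOpens :=
  ⟨Proj.basicOpen (homogeneousSubmodule (Fin (n + 1)) k) (X j),
    Proj.isAffineOpen_basicOpen _ _ (isHomogeneous_X k j) one_pos⟩

/-- The function `F / x_j ^ d` on `D₊(x_j)`, for `F` homogeneous of degree `d`. -/
def ratio {n : ℕ} (j : Fin (n + 1)) {d : ℕ} (F : MvPolynomial (Fin (n + 1)) k)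
    (hF : F.IsHomogeneous d) : Γ((projSpace k n).left, chart k n j) :=
  (Proj.awayToSection (homogeneousSubmodule (Fin (n + 1)) k) (X j)).hom
    (HomogeneousLocalization.Away.mk _ (isHomogeneous_X k j) d F (by simpa using hF))

variable (k) in
/-- The tautological sub-bundle `𝒪(-1) ⊆ 𝒪^{n+1}` of `ℙⁿ`; on `D₊(x_j)` it is generated by
`(x_0 / x_j, …, x_n / x_j)`. -/
def taut (n : ℕ) : StalkFamily (projSpace k n).left (n + 1) := fun p =>
  ⨆ (j : Fin (n + 1)) (hp : p ∈ (chart k n j).1),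
    Submodule.span _ {germVec (fun i => ratio j (X i) (isHomogeneous_X k i)) p hp}

/-- The structure map `k → 𝒪_{Z,z}` of a `k`-scheme. -/
def scalar {Z : Scheme.{u}} (s : Z ⟶ Spec (CommRingCat.of k)) (z : Z) :
    k →+* Z.presheaf.stalk z :=
  ((Scheme.ΓSpecIso (CommRingCat.of k)).inv ≫ s.appTop ≫ Z.presheaf.germ ⊤ z trivial).hom

lemma stalkMap_scalar {W Z : Scheme.{u}} (G : W ⟶ Z) (s : Z ⟶ Spec (CommRingCat.of k)) (w : W) :
    ((G.stalkMap w).hom).comp (scalar s (G w)) = scalar (G ≫ s) w := by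
  rw [scalar, scalar, ← CommRingCat.hom_comp]
  congr 1
  simp only [Category.assoc, Scheme.Hom.comp_appTop]
  congr 2
  exact Scheme.Hom.germ_stalkMap G ⊤ w trivial

lemma eval₂_smul_of_isHomogeneous {σ R S : Type*} [CommRing R] [CommRing S]
    {F : MvPolynomial σ R} {d : ℕ} (hF : F.IsHomogeneous d) (φ : R →+* S) (a : S) (v : σ → S) :
    F.eval₂ φ (a • v) = a ^ d * F.eval₂ φ v := by
  rw [eval₂_eq, eval₂_eq, Finset.mul_sum]
  refine Finset.sum_congr rfl fun e he => ?_
  have hd : ∑ i ∈ e.support, e i = d := by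
    have h := hF (mem_support_iff.mp he)
    simpa [Finsupp.weight_apply, Finsupp.sum] using h
  simp only [Pi.smul_apply, smul_eq_mul, mul_pow, Finset.prod_mul_distrib,
    Finset.prod_pow_eq_pow_sum, hd]
  ring

/-- For the closed subscheme of `ℙⁿ` with ideal sheaf `I`, a homogeneous `F` of degree `d` belongs
to its graded ideal iff all `F / x_j ^ d` belong to `I`. The condition says that for all such `F` the
induced section of `Sym^d L^∨`, i.e. the function `v ↦ F(v)` of degree `d` on `L`, vanishes. -/
def LandsInClosed {n : ℕ} (I : (projSpace k n).left.IdealSheafData) {Z : Scheme.{u}}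
    (s : Z ⟶ Spec (CommRingCat.of k)) (L : StalkFamily Z (n + 1)) : Prop :=
  ∀ (d : ℕ) (F : MvPolynomial (Fin (n + 1)) k) (hF : F.IsHomogeneous d),
    (∀ j, ratio j F hF ∈ I.ideal (chart k n j)) →
      ∀ (z : Z), ∀ v ∈ L z, F.eval₂ (scalar s z) v = 0

lemma LandsInClosed.pullback {n : ℕ} {I : (projSpace k n).left.IdealSheafData} {Z Z' S : Scheme.{u}}
    {s : Z ⟶ Spec (CommRingCat.of k)} {p : Z ⟶ S} {L : StalkFamily Z (n + 1)}
    (hL : IsFlatInvertible p L) (h : LandsInClosed I s L) (G : Z' ⟶ Z) :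
    LandsInClosed I (G ≫ s) (L.pullback G) := by
  intro d F hF hI z x hx
  obtain ⟨V, f, hV, hz, hspan, -⟩ := hL (G z)
  rw [StalkFamily.pullback_span G L z _ (hspan (G z) hz), Submodule.mem_span_singleton] at hx
  obtain ⟨a, rfl⟩ := hx
  have h0 : F.eval₂ (scalar s (G z)) (germVec f (G z) hz) = 0 :=
    h d F hF hI (G z) _ (by rw [hspan (G z) hz]; exact Submodule.mem_span_singleton_self _)
  have h1 : F.eval₂ (scalar (G ≫ s) z) (stalkVec (n + 1) G z (germVec f (G z) hz)) = 0 := by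
    rw [← stalkMap_scalar]
    have := congrArg (G.stalkMap z).hom h0
    rw [map_zero, MvPolynomial.hom_eval₂] at this
    exact this
  rw [eval₂_smul_of_isHomogeneous hF, h1, mul_zero]

end Proj

/-- The closed subset `closure(Y) ∖ Y` of `ℙⁿ` (Mathlib's `coborder` is its complement). -/
def boundary {n : ℕ} {Y : Sch k} (i : Y ⟶ projSpace k n) [IsImmersion i.left] :
    Closeds (projSpace k n).left :=
  i.left.coborderRange.compl

/-- An `S`-family of quasi-maps from `X` to the locally closed subscheme `i : Y ⟶ ℙⁿ`: an invertible
subsheaf of `𝒪_{S × X}^{n+1}` with `S`-flat cokernel, which is a family of quasi-maps to the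
scheme-theoretic closure of `Y` (with ideal sheaf `i.left.ker`), and lies in the open complement of
the quasi-maps to `closure(Y) ∖ Y`, i.e. no base change of it to a nonempty `T` is a family of
quasi-maps to `closure(Y) ∖ Y`. -/
structure IsQuasiMap (X : Sch k) {n : ℕ} {Y : Sch k} (i : Y ⟶ projSpace k n) [IsImmersion i.left]
    (S : Aff k) (L : StalkFamily (prodOver S.obj X) (n + 1)) : Prop where
  flatInvertible : IsFlatInvertible (pullback.fst S.obj.hom X.hom) L
  landsInClosure : LandsInClosed i.left.ker (prodStr S.obj X) L
  avoidsBoundary : ∀ (T : Aff k) (g : T ⟶ S), Nonempty T.obj.left →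
    ¬ LandsInClosed (Scheme.IdealSheafData.vanishingIdeal (boundary i)) (prodStr T.obj X)
      (L.pullback (prodMap g.hom X))

lemma IsQuasiMap.pullback {X : Sch k} {n : ℕ} {Y : Sch k} {i : Y ⟶ projSpace k n}
    [IsImmersion i.left] {S T : Aff k} {L : StalkFamily (prodOver S.obj X) (n + 1)}
    (hL : IsQuasiMap X i S L) (g : T ⟶ S) : IsQuasiMap X i T (L.pullback (prodMap g.hom X)) where
  flatInvertible := by
    have := S.property.1
    have := T.property.1
    exact hL.flatInvertible.pullback (prodMap_isPullback g.hom X)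
  landsInClosure := by
    have := hL.landsInClosure.pullback hL.flatInvertible (prodMap g.hom X)
    rwa [prodMap_str] at this
  avoidsBoundary R h hR := by
    rw [← StalkFamily.pullback_comp, ← prodMap_comp]
    exact hL.avoidsBoundary R (h ≫ g) hR

/-- The presheaf of quasi-maps from `X` to `Y`, relative to the embedding `i : Y ⟶ ℙⁿ`. -/
def QMap (X : Sch k) {n : ℕ} {Y : Sch k} (i : Y ⟶ projSpace k n) [IsImmersion i.left] :
    (Aff k)ᵒᵖ ⥤ Type u where
  obj S := {L : StalkFamily (prodOver S.unop.obj X) (n + 1) // IsQuasiMap X i S.unop L}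
  map g := ↾(fun L => ⟨L.1.pullback (prodMap g.unop.hom X), L.2.pullback g.unop⟩)
  map_id S := by
    ext L
    change L.1.pullback (prodMap (𝟙 S.unop.obj) X) = L.1
    rw [prodMap_id, StalkFamily.pullback_id]
  map_comp g h := by
    ext L
    change L.1.pullback (prodMap (h.unop.hom ≫ g.unop.hom) X) =
      (L.1.pullback (prodMap g.unop.hom X)).pullback (prodMap h.unop.hom X)
    rw [prodMap_comp, StalkFamily.pullback_comp]

/-- The two subsheaves agree over the intersection of their regularity domains. -/
def GenericallyAgree {Z : Scheme.{u}} {m : ℕ} (L L' : StalkFamily Z m) : Prop :=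
  ∀ z, IsRegularAt L z → IsRegularAt L' z → L z = L' z

lemma GenericallyAgree.pullback {Z Z' S : Scheme.{u}} {m : ℕ} {p : Z ⟶ S} {L L' : StalkFamily Z m}
    (hL : IsFlatInvertible p L) (hL' : IsFlatInvertible p L') (h : GenericallyAgree L L')
    (G : Z' ⟶ Z) : GenericallyAgree (L.pullback G) (L'.pullback G) := by
  intro z hz hz'
  dsimp only [StalkFamily.pullback]
  rw [h (G z) (hz.of_pullback hL G) (hz'.of_pullback hL' G)]

/-- The relation `ℰ_Y` on `QMap(X, Y)(S)`. -/
def relE (X : Sch k) {n : ℕ} {Y : Sch k} (i : Y ⟶ projSpace k n) [IsImmersion i.left]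
    (S : (Aff k)ᵒᵖ) (q q' : (QMap X i).obj S) : Prop :=
  GenericallyAgree q.1 q'.1

lemma relE_map {X : Sch k} {n : ℕ} {Y : Sch k} (i : Y ⟶ projSpace k n) [IsImmersion i.left]
    {S T : (Aff k)ᵒᵖ} (g : S ⟶ T) (q q' : (QMap X i).obj S) (h : relE X i S q q') :
    relE X i T ((QMap X i).map g q) ((QMap X i).map g q') :=
  GenericallyAgree.pullback q.2.flatInvertible q'.2.flatInvertible h (prodMap g.unop.hom X)

/-- The presheaf quotient `S ↦ QMap(X, Y)(S) / ℰ_Y(S)`. -/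
def QMapModE (X : Sch k) {n : ℕ} {Y : Sch k} (i : Y ⟶ projSpace k n) [IsImmersion i.left] :
    (Aff k)ᵒᵖ ⥤ Type u where
  obj S := Quot (relE X i S)
  map {S T} g := ↾(Quot.map (ra := relE X i S) (rb := relE X i T) (fun q => (QMap X i).map g q)
    (relE_map i g))
  map_id S := by
    ext q
    induction q using Quot.inductionOn with | _ q
    change Quot.mk _ ((QMap X i).map (𝟙 S) q) = Quot.mk _ q
    rw [(QMap X i).map_id]
    rfl
  map_comp g h := by
    ext q
    induction q using Quot.inductionOn with | _ q
    change Quot.mk _ ((QMap X i).map (g ≫ h) q) = Quot.mk _ ((QMap X i).map h ((QMap X i).map g q))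
    rw [(QMap X i).map_comp]
    rfl

/-- The projection `QMap(X, Y) ⟶ QMap(X, Y) / ℰ_Y`. -/
def toQuotient (X : Sch k) {n : ℕ} {Y : Sch k} (i : Y ⟶ projSpace k n) [IsImmersion i.left] :
    QMap X i ⟶ QMapModE X i where
  app S := ↾(Quot.mk (relE X i S))

/-- The quasi-map `L` presents the generically defined map `φ : U ⟶ Y`: over `U`, the subsheaf `L`
is a sub-bundle, and it is the pullback of the tautological sub-bundle along `U ⟶ Y ⟶ ℙⁿ`. That is,
`φ` is the regular map defined by the sub-bundle `L` over `U`. -/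
def Presents {X : Sch k} {n : ℕ} {Y : Sch k} (i : Y ⟶ projSpace k n) {S : Sch k}
    (L : StalkFamily (prodOver S X) (n + 1)) (φ : GenMap X Y S) : Prop :=
  (∀ z ∈ φ.dom, IsRegularAt L z) ∧
    (taut k n).pullback (φ.hom ≫ i.left) = L.pullback φ.dom.ι

/-- `η` sends every quasi-map to the class of a generically defined map that it presents. -/
def IsAssociatedMap {X : Sch k} {n : ℕ} {Y : Sch k} (i : Y ⟶ projSpace k n) [IsImmersion i.left]
    (η : QMap X i ⟶ GMap X Y) : Prop :=
  ∀ (S : (Aff k)ᵒᵖ) (q : (QMap X i).obj S), ∃ φ : GenMap X Y S.unop.obj,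
    Presents i q.1 φ ∧ η.app S q = Quotient.mk _ φ

variable (k) in
/-- Zariski sheafification of presheaves of sets on `Aff k`. The values are lifted to the next
universe, where Mathlib provides sheafification on the (large) category `Aff k`. -/
def zariskiSheafification : ((Aff k)ᵒᵖ ⥤ Type u) ⥤ Sheaf (zariski k) (Type (u + 1)) :=
  (Functor.whiskeringRight _ _ _).obj uliftFunctor.{u + 1, u} ⋙
    presheafToSheaf (zariski k) (Type (u + 1))

/-- Projective schemes over `k`. -/
def IsProjective (X : Sch k) : Prop :=
  ∃ (N : ℕ) (j : X ⟶ projSpace k N), IsClosedImmersion j.left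

end GenericMaps
end
open GenericMaps

/-! A smooth connected `X` over an algebraically closed field is geometrically integral, so the
projection `p : S × X ⟶ S` is flat and open with irreducible fibres. Hence an open `U ⊆ S × X` is an
`S`-family of domains iff it meets every fibre (`isDomainFamily_iff`).

The technical core is that such a `U` is schematically dense when `S` is affine Noetherian
(`section_eq_zero_of_surjective`). Dévissage over `R = Γ(S, 𝒪)` reduces this to the quotients `R/P`,
and `Spec (R/P) × X` is integral. The same argument shows that a vector of functions with an entry
invertible on `U` generates a free submodule with `S`-flat cokernel (`free_and_flat_of_surjective`).

From a quasi-map to a generic map (`IsQuasiMap.exists_presents`): over its regularity domain `L`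
defines a morphism to `ℙⁿ`, and the part of that domain not sent to the boundary maps to `Y`. This
part meets every fibre. Otherwise, over the reduced closure of some `s : S`, the map would go to the
boundary wherever it is defined, which the definition of quasi-map excludes. By density, two
quasi-maps agree generically iff the generic maps they present are equal. So `ℰ_Y` is the kernel
relation of `η`: it is an equivalence relation and `Φ` is injective.

Local surjectivity (`locallyPresented`): given a generic map and a point of its domain over `s`,
shrink the domain to a basic open `D(h)` of an affine piece of `S × X` coming from `X ⊆ ℙᴺ`, with
image in one chart of `ℙⁿ`, and shrink `S` so that `D(h)` meets every fibre. The map is now a vector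
of functions on `D(h)`. Clearing denominators, with powers of `h` inside the affine piece and of
ratios of coordinates of `ℙᴺ` outside it, turns the vector into an embedding of the pullback of some
`𝒪(-M)` into `𝒪^{n+1}`, with flat cokernel by the core result. A locally bijective map of presheaves
becomes an isomorphism of sheaves, and the target `GMap(X, Y)` does not involve the embedding of
`Y`. -/

noncomputable section
namespace GenericMaps

/-! ### Commutative algebra: dévissage, flatness, tensor products of domains, étale algebras. -/

section Algebra

open TensorProduct

/-- Dévissage: if no nonzero element of `A ⊗ R/p` is killed by `J`, for any prime `p`, then no nonzero
element of `A ⊗ M` is, for any finite `M`. -/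
lemma eq_zero_of_smul_eq_zero_of_prime {R A : Type*} [CommRing R] [IsNoetherianRing R] [CommRing A]
    [Algebra R A] [Module.Flat R A] (J : Set A)
    (H : ∀ p : Ideal R, p.IsPrime → ∀ x : A ⊗[R] (R ⧸ p), (∀ h ∈ J, h • x = 0) → x = 0)
    (M : Type*) [AddCommGroup M] [Module R M] [hM : Module.Finite R M] (x : A ⊗[R] M)
    (hx : ∀ h ∈ J, h • x = 0) : x = 0 := by
  revert x
  induction hM using IsNoetherianRing.induction_on_isQuotientEquivQuotientPrime R with
  | subsingleton N => exact fun x _ => Subsingleton.elim _ _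
  | quotient N p e =>
    intro x hx
    let E : A ⊗[R] N ≃ₗ[A] A ⊗[R] (R ⧸ p.1) := e.baseChange R A N _
    rw [← E.map_eq_zero_iff]
    refine H p.1 p.2 _ fun h hh => ?_
    rw [← map_smul, hx h hh, map_zero]
  -- By flatness `A ⊗ -` is exact: `x` dies in `A ⊗ N₃`, hence lifts to `A ⊗ N₁`, and injectivity
  -- shows that the lift is again killed by `J`.
  | exact N₁ N₂ N₃ f g hf hg hfg h₁ h₃ =>
    intro x hx
    have hx3 : g.baseChange A x = 0 := h₃ _ fun h hh => by rw [← map_smul, hx h hh, map_zero]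
    have hex : Function.Exact (f.baseChange A) (g.baseChange A) := lTensor_exact A hfg hg
    obtain ⟨y, rfl⟩ := (hex x).mp hx3
    have hinj : Function.Injective (f.baseChange A) :=
      Module.Flat.lTensor_preserves_injective_linearMap (M := A) f hf
    rw [h₁ y fun h hh => hinj (by rw [map_smul, hx h hh, map_zero]), map_zero]

lemma eq_zero_of_mul_eq_zero_of_prime {R A : Type*} [CommRing R] [IsNoetherianRing R] [CommRing A]
    [Algebra R A] [Module.Flat R A] (J : Set A)
    (H : ∀ p : Ideal R, p.IsPrime → ∀ x : A ⊗[R] (R ⧸ p), (∀ h ∈ J, h • x = 0) → x = 0)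
    (a : A) (ha : ∀ h ∈ J, h * a = 0) : a = 0 := by
  have := eq_zero_of_smul_eq_zero_of_prime J H R (a ⊗ₜ 1) fun h hh => by
    rw [smul_tmul', smul_eq_mul, ha h hh, zero_tmul]
  simpa using congrArg (AlgebraTensorModule.rid R A A) this

/-- The quotient of a flat module by the image of an injective map which stays injective modulo all
ideals is flat. -/
lemma flat_of_lTensor_quotient_injective {R : Type*} {N F Q : Type u} [CommRing R] [AddCommGroup N]
    [AddCommGroup F] [AddCommGroup Q] [Module R N] [Module R F] [Module R Q] [Module.Flat R F]
    (f : N →ₗ[R] F) (g : F →ₗ[R] Q) (hfg : Function.Exact f g) (hg : Function.Surjective g)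
    (H : ∀ I : Ideal R, Function.Injective (f.lTensor (R ⧸ I))) : Module.Flat R Q := by
  -- This is `Tor₁(R/I, Q) = ker (R/I ⊗ N → R/I ⊗ F)`, chased by elements. A lift `y ∈ I ⊗ F` of `x`
  -- becomes the image of some `b ∈ R ⊗ N`; `b` vanishes modulo `I`, so it comes from `c ∈ I ⊗ N`,
  -- and `c` maps to `y`.
  rw [Module.Flat.iff_rTensor_injective']
  intro I
  rw [injective_iff_map_eq_zero]
  intro x hx
  obtain ⟨y, rfl⟩ := LinearMap.lTensor_surjective I hg x
  have h1 : g.lTensor R (I.subtype.rTensor F y) = 0 := by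
    rw [← hx, ← LinearMap.comp_apply, ← LinearMap.comp_apply, LinearMap.lTensor_comp_rTensor,
      LinearMap.rTensor_comp_lTensor]
  obtain ⟨b, hb⟩ := (lTensor_exact R hfg hg _).mp h1
  have hex : ∀ (P : Type u) [AddCommGroup P] [Module R P],
      Function.Exact (I.subtype.rTensor P) ((Submodule.mkQ I).rTensor P) := fun P _ _ =>
    rTensor_exact P (by
      rw [LinearMap.exact_iff, Submodule.ker_mkQ, Submodule.range_subtype]) (Submodule.mkQ_surjective _)
  have h2 : (Submodule.mkQ I).rTensor N b = 0 := by
    apply H I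
    rw [map_zero, ← LinearMap.comp_apply, LinearMap.lTensor_comp_rTensor,
      ← LinearMap.rTensor_comp_lTensor, LinearMap.comp_apply, hb]
    exact (hex F).apply_apply_eq_zero y
  obtain ⟨c, rfl⟩ := (hex N b).mp h2
  have h3 : f.lTensor I c = y := by
    apply Module.Flat.rTensor_preserves_injective_linearMap (M := F) I.subtype
      (Submodule.subtype_injective I)
    rw [← hb, ← LinearMap.comp_apply, ← LinearMap.comp_apply, LinearMap.lTensor_comp_rTensor,
      LinearMap.rTensor_comp_lTensor]
  rw [← h3, ← LinearMap.comp_apply, ← LinearMap.lTensor_comp, hfg.linearMap_comp_eq_zero,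
    LinearMap.lTensor_zero, LinearMap.zero_apply]

/-- By dévissage, multiplication by `f j` is injective on `A ⊗ M` for every finite `M`. It is the
`j`-th coordinate of `a ↦ a f`, so that map is injective, and stays so modulo every ideal of `R`. -/
lemma free_and_flat_of_prime {R A : Type u} [CommRing R] [IsNoetherianRing R] [CommRing A]
    [Algebra R A] [Module.Flat R A] {m : ℕ} (f : Fin m → A) (j : Fin m)
    (H : ∀ p : Ideal R, p.IsPrime → ∀ x : A ⊗[R] (R ⧸ p), f j • x = 0 → x = 0) :
    (∀ a : A, (∀ l, a * f l = 0) → a = 0) ∧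
      Module.Flat R ((Fin m → A) ⧸ Submodule.span A {f}) := by
  have H' : ∀ p : Ideal R, p.IsPrime → ∀ x : A ⊗[R] (R ⧸ p), (∀ h ∈ ({f j} : Set A), h • x = 0) →
      x = 0 := fun p hp x hx => H p hp x (hx _ rfl)
  refine ⟨fun a ha => eq_zero_of_mul_eq_zero_of_prime {f j} H' a ?_, ?_⟩
  · rintro _ rfl
    rw [mul_comm, ha]
  · let F : A →ₗ[R] (Fin m → A) := (LinearMap.toSpanSingleton A (Fin m → A) f).restrictScalars R
    let G : (Fin m → A) →ₗ[R] ((Fin m → A) ⧸ Submodule.span A {f}) :=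
      { toFun := Submodule.Quotient.mk
        map_add' := fun _ _ => rfl
        map_smul' := fun _ _ => rfl }
    have : Module.Flat R (Fin m → A) :=
      Module.Flat.of_linearEquiv ((Finsupp.linearEquivFunOnFinite R A (Fin m)).symm.trans
        (finsuppLEquivDirectSum R A (Fin m)))
    refine flat_of_lTensor_quotient_injective F G ?_ (Submodule.Quotient.mk_surjective _) fun I => ?_
    · intro v
      change Submodule.Quotient.mk v = 0 ↔ _
      rw [Submodule.Quotient.mk_eq_zero, Submodule.mem_span_singleton]
      rfl
    · rw [injective_iff_map_eq_zero]
      intro x hx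
      have h1 : ((LinearMap.proj j : (Fin m → A) →ₗ[R] A) ∘ₗ F).lTensor (R ⧸ I) x = 0 := by
        rw [LinearMap.lTensor_comp, LinearMap.comp_apply, hx, map_zero]
      have h2 : ∀ y : (R ⧸ I) ⊗[R] A,
          TensorProduct.comm R _ _ (((LinearMap.proj j : (Fin m → A) →ₗ[R] A) ∘ₗ F).lTensor (R ⧸ I) y)
            = f j • TensorProduct.comm R _ _ y := by
        intro y
        induction y with
        | zero => simp
        | add a b ha hb => simp only [map_add, ha, hb, smul_add]
        | tmul a b =>
          simp only [LinearMap.lTensor_tmul, comm_tmul, smul_tmul']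
          congr 1
          change b * f j = f j * b
          exact mul_comm _ _
      have h3 := h2 x
      rw [h1, map_zero] at h3
      have := eq_zero_of_smul_eq_zero_of_prime {f j} H' (R ⧸ I) (TensorProduct.comm R _ _ x) (by
        rintro _ rfl; exact h3.symm)
      exact (LinearEquiv.map_eq_zero_iff _).mp this

/-- Over an algebraically closed field, the tensor product of a domain with a finite type domain is a
domain. -/
lemma isDomain_tensorProduct {k K B : Type*} [Field k] [IsAlgClosed k] [CommRing K] [IsDomain K]
    [Algebra k K] [CommRing B] [IsDomain B] [Algebra k B] [Algebra.FiniteType k B] :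
    IsDomain (B ⊗[k] K) := by
  have : Nontrivial (B ⊗[k] K) :=
    Algebra.TensorProduct.nontrivial_of_algebraMap_injective_of_flat_left k B K
      (FaithfulSMul.algebraMap_injective k K)
  have : NoZeroDivisors (B ⊗[k] K) := by
    constructor
    intro x y hxy
    let b := Module.Free.chooseBasis k K
    let bB := b.baseChange B
    -- At a maximal ideal `m` of `B` the residue field is `k`, so evaluation gives a homomorphism `B
    -- ⊗ K → K` to a domain, which kills `x` or `y`. Thus each product of coefficients lies in every
    -- `m`, and `B` is a Jacobson domain.
    have key : ∀ i j, bB.repr x i * bB.repr y j = 0 := by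
      intro i j
      have : IsJacobsonRing B := isJacobsonRing_of_finiteType (A := k)
      rw [← Ideal.mem_bot, ← isJacobsonRing_iff.mp this ⊥ Ideal.isPrime_bot.isRadical,
        Ideal.jacobson, Ideal.mem_sInf]
      rintro m ⟨-, hm⟩
      let : Field (B ⧸ m) := Ideal.Quotient.field m
      have : Module.Finite k (B ⧸ m) := finite_of_finite_type_of_isJacobsonRing k (B ⧸ m)
      let e : k ≃ₐ[k] B ⧸ m := AlgEquiv.ofBijective (Algebra.ofId k (B ⧸ m))
        IsAlgClosed.algebraMap_bijective_of_isIntegral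
      let χ : B →ₐ[k] k := e.symm.toAlgHom.comp (Ideal.Quotient.mkₐ k m)
      have hχ : ∀ c, χ c = 0 → c ∈ m := fun c hc => by
        rw [← Ideal.Quotient.eq_zero_iff_mem]
        exact (map_eq_zero_iff e.symm e.symm.injective).mp hc
      let Θ : B ⊗[k] K →ₐ[k] K := Algebra.TensorProduct.lift ((Algebra.ofId k K).comp χ)
        (AlgHom.id k K) fun _ _ => Commute.all _ _
      have hΘ : ∀ (z : B ⊗[k] K) l, b.repr (Θ z) l = χ (bB.repr z l) := by
        intro z l
        induction z with
        | zero => simp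
        | add z w hz hw => simp only [map_add, Finsupp.add_apply, hz, hw]
        | tmul s t =>
          have : Θ (s ⊗ₜ t) = χ s • t := by
            simp [Θ, Algebra.smul_def, Algebra.ofId_apply]
          rw [this, Module.Basis.baseChange_repr_tmul, map_smul, map_smul]
          simp [mul_comm]
      have h0 : Θ x * Θ y = 0 := by rw [← map_mul, hxy, map_zero]
      rcases mul_eq_zero.mp h0 with h | h
      · exact m.mul_mem_right _ (hχ _ (by rw [← hΘ, h]; simp))
      · exact m.mul_mem_left _ (hχ _ (by rw [← hΘ, h]; simp))
    by_contra! hne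
    obtain ⟨i, hi⟩ : ∃ i, bB.repr x i ≠ 0 := by
      by_contra! h
      exact hne.1 ((LinearEquiv.map_eq_zero_iff bB.repr).mp (Finsupp.ext h))
    obtain ⟨j, hj⟩ : ∃ j, bB.repr y j ≠ 0 := by
      by_contra! h
      exact hne.2 ((LinearEquiv.map_eq_zero_iff bB.repr).mp (Finsupp.ext h))
    exact (mul_ne_zero hi hj) (key i j)
  exact NoZeroDivisors.to_isDomain _

/-- An étale algebra over an integrally closed domain is reduced, and its spectrum is locally
irreducible. -/
lemma isReduced_and_irreducible_of_etale {P S : Type u} [CommRing P] [IsDomain P]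
    [IsIntegrallyClosed P] [CommRing S] [Algebra P S] [Algebra.Etale P S] :
    IsReduced S ∧ ∀ q : PrimeSpectrum S, ∃ e : S, e ∉ q.asIdeal ∧
      IsIrreducible (PrimeSpectrum.basicOpen e : Set (PrimeSpectrum S)) := by
  classical
  -- `K ⊗ S` is étale over a field, hence a finite product of fields; flatness embeds `S` into it.
  let K := FractionRing P
  obtain ⟨I, _, Ai, _, _, E₀, -⟩ := (Algebra.Etale.iff_exists_algEquiv_prod K (K ⊗[P] S)).mp
    inferInstance
  let E : S ⊗[P] K ≃+* Π i, Ai i := (Algebra.TensorProduct.comm P S K).toRingEquiv.trans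
    E₀.toRingEquiv
  let ι : S →+* Π i, Ai i := E.toRingHom.comp (algebraMap S (S ⊗[P] K))
  have hι : Function.Injective ι := by
    refine E.injective.comp ?_
    exact Algebra.TensorProduct.includeLeft_injective (S := P) (IsFractionRing.injective P K)
  -- An idempotent is integral over `S`. Integral closure commutes with smooth base change and `P`
  -- is integrally closed in `K`, so everything in `S ⊗ K` integral over `S` comes from `S`.
  have hidem : ∀ t : S ⊗[P] K, t * t = t → ∃ s : S, algebraMap S (S ⊗[P] K) s = t := by
    intro t ht
    have htint : IsIntegral S t := by
      refine ⟨Polynomial.X ^ 2 - Polynomial.X, ?_, ?_⟩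
      · monicity!
      · simp [pow_two, ht]
    obtain ⟨x, hx⟩ := (TensorProduct.toIntegralClosure_bijective_of_smooth (R := P) (S := S)
      (B := K)).2 ⟨t, htint⟩
    have hx' : ((TensorProduct.toIntegralClosure P S K x : _) : S ⊗[P] K) = t := by rw [hx]
    rw [← hx']
    clear hx hx'
    induction x with
    | zero => exact ⟨0, by simp⟩
    | add x y hx hy =>
      obtain ⟨a, ha⟩ := hx
      obtain ⟨b, hb⟩ := hy
      exact ⟨a + b, by rw [map_add, ha, hb, map_add]; rfl⟩
    | tmul s c =>
      obtain ⟨c, hc⟩ := c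
      obtain ⟨r, rfl⟩ := IsIntegrallyClosed.isIntegral_iff.mp hc
      refine ⟨r • s, ?_⟩
      change (r • s) ⊗ₜ[P] (1 : K) = s ⊗ₜ[P] algebraMap P K r
      rw [smul_tmul, Algebra.smul_def, mul_one]
  refine ⟨isReduced_of_injective ι hι, fun q => ?_⟩
  have hs : ∀ i, ∃ s : S, ι s = Pi.single i 1 := by
    intro i
    obtain ⟨s, hs⟩ := hidem (E.symm (Pi.single i 1)) (by
      rw [← map_mul]
      congr 1
      ext j
      rcases eq_or_ne j i with rfl | h <;> simp [*])
    exact ⟨s, by simp [ι, hs]⟩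
  choose e he using hs
  have := Fintype.ofFinite I
  have hsum : ∑ i, e i = 1 := by
    apply hι
    rw [map_sum, map_one]
    simp only [he]
    exact Finset.univ_sum_single (1 : Π i, Ai i)
  obtain ⟨i, hi⟩ : ∃ i, e i ∉ q.asIdeal := by
    by_contra! h
    exact q.2.ne_top ((Ideal.eq_top_iff_one _).mpr (hsum ▸ Ideal.sum_mem _ fun i _ => h i))
  refine ⟨e i, hi, ?_⟩
  -- `Q` is the generic point of `D(e i)`: an `a` that dies in the `i`-th factor satisfies `e i * a
  -- = 0`, so it lies in every prime not containing `e i`.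
  let Q : PrimeSpectrum S := ⟨RingHom.ker ((Pi.evalRingHom Ai i).comp ι), RingHom.ker_isPrime _⟩
  have hQ : e i ∉ Q.asIdeal := by
    simp [Q, RingHom.mem_ker, he]
  have hle : ∀ p : PrimeSpectrum S, e i ∉ p.asIdeal → Q.asIdeal ≤ p.asIdeal := by
    intro p hp a ha
    have h0 : e i * a = 0 := by
      apply hι
      rw [map_mul, he, map_zero]
      ext j
      by_cases h : j = i
      · subst h
        have : ι a j = 0 := ha
        simp [this]
      · simp [h]
    exact (p.2.mem_or_mem (h0 ▸ p.asIdeal.zero_mem)).resolve_left hp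
  refine ⟨⟨Q, hQ⟩, ?_⟩
  rintro U V hU hV ⟨x, hx, hxU⟩ ⟨y, hy, hyV⟩
  exact ⟨Q, hQ, ((PrimeSpectrum.le_iff_specializes Q x).mp (hle x hx)).mem_open hU hxU,
    ((PrimeSpectrum.le_iff_specializes Q y).mp (hle y hy)).mem_open hV hyV⟩

end Algebra
end GenericMaps

/-! ### Integrality and geometric integrality of `X`. -/

namespace GenericMaps

/-- The closure of an irreducible open `W` is open: an irreducible neighbourhood `N` of a point of
the closure meets `W`, and `N ∩ W` is dense in `N`. By connectedness `W` is dense. -/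
lemma irreducibleSpace_of_connectedSpace {T : Type*} [TopologicalSpace T] [ConnectedSpace T]
    (h : ∀ x : T, ∃ W : Set T, IsOpen W ∧ x ∈ W ∧ IsIrreducible W) : IrreducibleSpace T := by
  obtain ⟨x⟩ : Nonempty T := inferInstance
  obtain ⟨W, hW, hx, hirr⟩ := h x
  have hopen : IsOpen (closure W) := by
    rw [isOpen_iff_mem_nhds]
    intro z hz
    obtain ⟨N, hN, hzN, hNirr⟩ := h z
    refine Filter.mem_of_superset (hN.mem_nhds hzN) ?_
    have hne : (N ∩ W).Nonempty := mem_closure_iff.mp hz N hN hzN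
    refine (subset_closure_inter_of_isPreirreducible_of_isOpen hNirr.2 hW hne).trans ?_
    exact closure_mono Set.inter_subset_right
  have huniv : closure W = Set.univ := IsClopen.eq_univ ⟨isClosed_closure, hopen⟩ ⟨x, subset_closure hx⟩
  rw [irreducibleSpace_def, Set.top_eq_univ, ← huniv]
  exact hirr.closure

/-- A connected smooth scheme over a field is integral. -/
lemma isIntegral_of_smooth_of_connectedSpace {k : Type u} [Field k] {X : Scheme.{u}}
    (f : X ⟶ Spec (.of k)) [Smooth f] [ConnectedSpace X] : IsIntegral X := by
  have key : ∀ x : X, ∃ (V : X.Opens), IsAffineOpen V ∧ x ∈ V ∧ _root_.IsReduced Γ(X, V) ∧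
      ∃ e : Γ(X, V), x ∈ X.basicOpen e ∧ IsIrreducible (X.basicOpen e : Set X) := by
    intro x
    obtain ⟨U, hU, V, hV, hxV, hle, hstd⟩ := Smooth.exists_isStandardSmooth f x
    obtain rfl : U = ⊤ := by
      rw [eq_top_iff]
      intro y _
      rw [Subsingleton.elim y (f x)]
      exact hle hxV
    let : Field Γ(Spec (.of k), ⊤) :=
      ((Scheme.ΓSpecIso (.of k)).commRingCatIsoToRingEquiv.toMulEquiv.isField
        (Field.toIsField k)).toField
    -- Locally `X` is étale over an affine space, whose ring of functions is an integrally closed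
    -- domain.
    obtain ⟨n, g, -, hg⟩ := hstd.exists_etale_mvPolynomial
    algebraize [g]
    obtain ⟨hred, hirr⟩ := isReduced_and_irreducible_of_etale
      (P := MvPolynomial (Fin n) Γ(Spec (.of k), ⊤)) (S := Γ(X, V))
    obtain ⟨e, he, hei⟩ := hirr (hV.primeIdealOf ⟨x, hxV⟩)
    have himg : hV.fromSpec '' (PrimeSpectrum.basicOpen e : Set (PrimeSpectrum Γ(X, V))) =
        X.basicOpen e := by
      have := hV.fromSpec_image_basicOpen e
      rw [← this]; rfl
    refine ⟨V, hV, hxV, hred, e, ?_, ?_⟩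
    · rw [← SetLike.mem_coe, ← himg]
      exact ⟨_, he, hV.fromSpec_primeIdealOf ⟨x, hxV⟩⟩
    · rw [← himg]
      exact hei.image _ hV.fromSpec.continuous.continuousOn
  have : IrreducibleSpace X := irreducibleSpace_of_connectedSpace fun x => by
    obtain ⟨V, hV, hxV, -, e, hxe, he⟩ := key x
    exact ⟨_, (X.basicOpen e).2, hxe, he⟩
  have : IsReduced X := by
    apply +allowSynthFailures isReduced_of_isReduced_stalk
    intro x
    obtain ⟨V, hV, hxV, hred, -⟩ := key x
    let := TopCat.Presheaf.algebra_section_stalk X.presheaf (⟨x, hxV⟩ : V)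
    have := hV.isLocalization_stalk ⟨x, hxV⟩
    exact isReduced_localizationPreserves (hV.primeIdealOf ⟨x, hxV⟩).asIdeal.primeCompl _ hred
  exact isIntegral_of_irreducibleSpace_of_isReduced X

open TensorProduct in
/-- Sections over the preimage of an affine open under a base change of affine schemes. -/
lemma exists_tensorProduct_equiv {Z Z' S S' : Scheme.{u}} [IsAffine S] [IsAffine S']
    {G : Z' ⟶ Z} {p' : Z' ⟶ S'} {p : Z ⟶ S} {g : S' ⟶ S} (H : IsPullback G p' p g)
    {V : Z.Opens} (hV : IsAffineOpen V) :
    letI : Algebra Γ(S, ⊤) Γ(Z, V) := (p.appLE ⊤ V le_top).hom.toAlgebra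
    letI : Algebra Γ(S, ⊤) Γ(S', ⊤) := (g.appLE ⊤ ⊤ le_top).hom.toAlgebra
    ∃ e : Γ(Z, V) ⊗[Γ(S, ⊤)] Γ(S', ⊤) ≃+* Γ(Z', G ⁻¹ᵁ V), ∀ a, e (a ⊗ₜ 1) = G.app V a := by
  have hpo := (isIso_pushoutSection_iff H (US := ⊤) (UT := ⊤) (UX := V) (UY := G ⁻¹ᵁ V)
    le_top le_top (by simp)).mp
    (isIso_pushoutSection_of_isAffineOpen _ _ _ _ (isAffineOpen_top S) (isAffineOpen_top S') hV)
  let : Algebra Γ(S, ⊤) Γ(Z, V) := (p.appLE ⊤ V le_top).hom.toAlgebra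
  let : Algebra Γ(S, ⊤) Γ(S', ⊤) := (g.appLE ⊤ ⊤ le_top).hom.toAlgebra
  let : Algebra Γ(Z, V) Γ(Z', G ⁻¹ᵁ V) := (G.appLE V (G ⁻¹ᵁ V) le_rfl).hom.toAlgebra
  let : Algebra Γ(S', ⊤) Γ(Z', G ⁻¹ᵁ V) := (p'.appLE ⊤ (G ⁻¹ᵁ V) le_top).hom.toAlgebra
  let : Algebra Γ(S, ⊤) Γ(Z', G ⁻¹ᵁ V) :=
    (p.appLE ⊤ V le_top ≫ G.appLE V (G ⁻¹ᵁ V) le_rfl).hom.toAlgebra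
  have : IsScalarTower Γ(S, ⊤) Γ(Z, V) Γ(Z', G ⁻¹ᵁ V) := .of_algebraMap_eq' rfl
  have : IsScalarTower Γ(S, ⊤) Γ(S', ⊤) Γ(Z', G ⁻¹ᵁ V) :=
    .of_algebraMap_eq' (congrArg CommRingCat.Hom.hom hpo.w)
  have : Algebra.IsPushout Γ(S, ⊤) Γ(Z, V) Γ(S', ⊤) Γ(Z', G ⁻¹ᵁ V) :=
    CommRingCat.isPushout_iff_isPushout.mp hpo
  let e := Algebra.IsPushout.equiv Γ(S, ⊤) Γ(Z, V) Γ(S', ⊤) Γ(Z', G ⁻¹ᵁ V)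
  refine ⟨e.toRingEquiv, fun a => ?_⟩
  have h1 : e (a ⊗ₜ 1) = algebraMap Γ(Z, V) Γ(Z', G ⁻¹ᵁ V) a := e.commutes a
  refine Eq.trans h1 ?_
  change (G.appLE V (G ⁻¹ᵁ V) le_rfl).hom a = _
  rw [← Scheme.Hom.app_eq_appLE]

/-- An integral scheme locally of finite type over an algebraically closed field is geometrically
integral. -/
lemma geometricallyIntegral_of_isAlgClosed {k : Type u} [Field k] [IsAlgClosed k] {X : Scheme.{u}}
    (f : X ⟶ Spec (.of k)) [LocallyOfFiniteType f] [IsIntegral X] : GeometricallyIntegral f := by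
  constructor
  rw [geometrically_iff_of_commRing]
  intro K _ _ Z π snd hpb
  let q : Spec (.of K) ⟶ Spec (.of k) := Spec.map (CommRingCat.ofHom (algebraMap k K))
  have : Surjective q := ⟨fun y => ⟨Nonempty.some inferInstance, Subsingleton.elim _ _⟩⟩
  have : Surjective π := MorphismProperty.of_isPullback hpb.flip this
  have hq : IsAffineHom q := inferInstance
  have : IsAffineHom π := MorphismProperty.of_isPullback hpb.flip hq
  have hdom : ∀ V : X.Opens, IsAffineOpen V → (V : Set X).Nonempty →
      IsDomain Γ(Z, π ⁻¹ᵁ V) := by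
    intro V hV hne
    have : Nonempty V := hne.to_subtype
    let ek := (Scheme.ΓSpecIso (.of k)).commRingCatIsoToRingEquiv
    let : Field Γ(Spec (.of k), ⊤) := (ek.toMulEquiv.isField (Field.toIsField k)).toField
    have : IsAlgClosed Γ(Spec (.of k), ⊤) := IsAlgClosed.of_ringEquiv k _ ek.symm
    have : IsDomain Γ(Spec (.of K), ⊤) := inferInstance
    let : Algebra Γ(Spec (.of k), ⊤) Γ(X, V) := (f.appLE ⊤ V le_top).hom.toAlgebra
    let : Algebra Γ(Spec (.of k), ⊤) Γ(Spec (.of K), ⊤) := (q.appLE ⊤ ⊤ le_top).hom.toAlgebra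
    have : Algebra.FiniteType Γ(Spec (.of k), ⊤) Γ(X, V) :=
      f.finiteType_appLE (isAffineOpen_top _) hV le_top
    obtain ⟨e, -⟩ := exists_tensorProduct_equiv hpb hV
    have := isDomain_tensorProduct (k := Γ(Spec (.of k), ⊤)) (B := Γ(X, V))
      (K := Γ(Spec (.of K), ⊤))
    exact e.symm.toMulEquiv.isDomain
  have hirr : ∀ V : X.Opens, IsAffineOpen V → (V : Set X).Nonempty →
      IsIrreducible ((π ⁻¹ᵁ V : Z.Opens) : Set Z) := by
    intro V hV hne
    have := hdom V hV hne
    have haff := hV.preimage π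
    rw [← haff.range_fromSpec, ← Set.image_univ]
    exact (IrreducibleSpace.isIrreducible_univ (PrimeSpectrum Γ(Z, π ⁻¹ᵁ V))).image _
      haff.fromSpec.continuous.continuousOn
  have hcov : ∀ x : X, ∃ V : X.Opens, IsAffineOpen V ∧ x ∈ V := fun x => by
    obtain ⟨V, hV, hx, -⟩ := exists_isAffineOpen_mem_and_subset (U := (⊤ : X.Opens)) (x := x) trivial
    exact ⟨V, hV, hx⟩
  obtain ⟨x₀⟩ : Nonempty X := inferInstance
  obtain ⟨V₀, hV₀, hx₀⟩ := hcov x₀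
  have : IrreducibleSpace Z := by
    have h0 := hirr V₀ hV₀ ⟨x₀, hx₀⟩
    -- Preimages of nonempty affine opens are irreducible, and any two of them meet because `X` is
    -- irreducible and `π` is surjective.
    have huniv : closure ((π ⁻¹ᵁ V₀ : Z.Opens) : Set Z) = Set.univ := by
      refine Set.eq_univ_of_forall fun z => ?_
      obtain ⟨V, hV, hz⟩ := hcov (π z)
      obtain ⟨x, hxV, hx0⟩ := nonempty_preirreducible_inter V.2 V₀.2 ⟨_, hz⟩ ⟨_, hx₀⟩
      obtain ⟨y, rfl⟩ := π.surjective x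
      refine closure_mono Set.inter_subset_right (subset_closure_inter_of_isPreirreducible_of_isOpen
        (hirr V hV ⟨_, hz⟩).2 (π ⁻¹ᵁ V₀).2 ⟨y, hxV, hx0⟩ hz)
    rw [irreducibleSpace_def, Set.top_eq_univ, ← huniv]
    exact h0.closure
  have : IsReduced Z := by
    apply +allowSynthFailures isReduced_of_isReduced_stalk
    intro z
    obtain ⟨V, hV, hz⟩ := hcov (π z)
    have := hdom V hV ⟨_, hz⟩
    let := TopCat.Presheaf.algebra_section_stalk Z.presheaf (⟨z, hz⟩ : π ⁻¹ᵁ V)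
    have := (hV.preimage π).isLocalization_stalk ⟨z, hz⟩
    exact isReduced_localizationPreserves ((hV.preimage π).primeIdealOf ⟨z, hz⟩).asIdeal.primeCompl _
      (inferInstance : _root_.IsReduced Γ(Z, π ⁻¹ᵁ V))
  exact isIntegral_of_irreducibleSpace_of_isReduced _

end GenericMaps

/-! ### Schematic density of opens meeting every fibre. -/

namespace GenericMaps

lemma section_ext_germ {Z : Scheme.{u}} {V : Z.Opens} {a b : Γ(Z, V)}
    (h : ∀ (z : Z) (hz : z ∈ V), Z.presheaf.germ V z hz a = Z.presheaf.germ V z hz b) : a = b :=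
  TopCat.Presheaf.section_ext Z.sheaf V a b h

section Density

variable {Z S : Scheme.{u}} (p : Z ⟶ S)

lemma exists_mem_inter_of_irreducible_fibre [GeometricallyIntegral p] [UniversallyOpen p]
    {U V : Z.Opens} {u v : Z} (hu : u ∈ U) (hv : v ∈ V) (h : p u = p v) :
    ∃ z ∈ U, z ∈ V ∧ p z = p u := by
  have hirr := p.isIrreducible_preimage p.isOpenMap (isIrreducible_singleton (x := p u))
  obtain ⟨z, hz, hzU, hzV⟩ := hirr.2 U V U.2 V.2 ⟨u, rfl, hu⟩ ⟨v, h.symm, hv⟩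
  exact ⟨z, hzU, hzV, hz⟩

open TensorProduct in
-- The tensor product is the ring of functions on the preimage of `V` in `Z ×_S Spec (R/P)`, where
-- `R = Γ(S, 𝒪)`; this fibre product is integral. The point `v` is taken over the generic point of
-- `Spec (R/P)`. An `h` that is invertible somewhere on the fibre through `v` pulls back to a
-- nonzero element of a domain, so it cannot kill `x`.
lemma exists_fibre_of_ne_zero [IsAffine S] [IsLocallyNoetherian S] [GeometricallyIntegral p]
    [Flat p] [UniversallyOpen p] {V : Z.Opens} (hV : IsAffineOpen V)
    (P : Ideal Γ(S, ⊤)) (hP : P.IsPrime) :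
    letI : Algebra Γ(S, ⊤) Γ(Z, V) := (p.appLE ⊤ V le_top).hom.toAlgebra
    ∀ x : Γ(Z, V) ⊗[Γ(S, ⊤)] (Γ(S, ⊤) ⧸ P), x ≠ 0 → ∃ v ∈ V,
      ∀ (h : Γ(Z, V)), ∀ z ∈ Z.basicOpen h, p z = p v → h • x ≠ 0 := by
  let R' : CommRingCat := .of (Γ(S, ⊤) ⧸ P)
  let φ : Γ(S, ⊤) ⟶ R' := CommRingCat.ofHom (Ideal.Quotient.mk P)
  let g : Spec R' ⟶ S := Spec.map φ ≫ S.isoSpec.inv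
  let G := pullback.fst p g
  have hpb : IsPullback G (pullback.snd p g) p g := IsPullback.of_hasPullback p g
  have : IsNoetherianRing Γ(S, ⊤) :=
    IsLocallyNoetherian.component_noetherian ⟨⊤, isAffineOpen_top S⟩
  have : IsNoetherianRing R' := inferInstanceAs (IsNoetherianRing (Γ(S, ⊤) ⧸ P))
  have : IsDomain R' := inferInstanceAs (IsDomain (Γ(S, ⊤) ⧸ P))
  have : IsIntegral (pullback p g) := inferInstance
  let : Algebra Γ(S, ⊤) Γ(Z, V) := (p.appLE ⊤ V le_top).hom.toAlgebra
  let : Algebra Γ(S, ⊤) Γ(Spec R', ⊤) := (g.appLE ⊤ ⊤ le_top).hom.toAlgebra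
  obtain ⟨e, he⟩ := exists_tensorProduct_equiv hpb hV
  let ε : (Γ(S, ⊤) ⧸ P) ≃ₐ[Γ(S, ⊤)] Γ(Spec R', ⊤) :=
    AlgEquiv.ofRingEquiv (f := (Scheme.ΓSpecIso R').commRingCatIsoToRingEquiv.symm) (by
      intro a
      change (Scheme.ΓSpecIso R').inv (φ a) = g.appLE ⊤ ⊤ le_top a
      rw [← CommRingCat.comp_apply]
      congr 2
      change _ = g.appLE ⊤ (g ⁻¹ᵁ ⊤) le_rfl
      have h2 : S.isoSpec.inv.appTop = (Scheme.ΓSpecIso Γ(S, ⊤)).inv := by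
        have h3 : S.isoSpec.inv.appTop ≫ S.isoSpec.hom.appTop = 𝟙 _ := by
          rw [← Scheme.Hom.comp_appTop, Iso.hom_inv_id, Scheme.Hom.id_appTop]
        have h4 : S.isoSpec.hom.appTop = (Scheme.ΓSpecIso Γ(S, ⊤)).hom := by
          simp [Scheme.isoSpec]
        rw [h4] at h3
        exact ((Iso.comp_inv_eq_id (Scheme.ΓSpecIso Γ(S, ⊤)).symm).mp h3)
      rw [Scheme.ΓSpecIso_inv_naturality, ← h2, ← Scheme.Hom.comp_appTop, ← Scheme.Hom.app_eq_appLE])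
  let ψ : Γ(Z, V) ⊗[Γ(S, ⊤)] (Γ(S, ⊤) ⧸ P) ≃+* Γ(pullback p g, G ⁻¹ᵁ V) :=
    (Algebra.TensorProduct.congr (AlgEquiv.refl (R := Γ(S, ⊤)) (A₁ := Γ(Z, V))) ε).toRingEquiv.trans e
  have hψ : ∀ a x, ψ (a • x) = G.app V a * ψ x := by
    intro a x
    have h1 : a • x = (a ⊗ₜ 1) * x := by
      induction x with
      | zero => simp
      | add x y hx hy => rw [smul_add, hx, hy, mul_add]
      | tmul b c => simp [smul_tmul']
    rw [h1, map_mul]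
    congr 1
    simp [ψ, he]
  intro x hx
  have hne : Nonempty (G ⁻¹ᵁ V : (pullback p g).Opens) := by
    by_contra hemp
    have hbot : G ⁻¹ᵁ V = ⊥ := by
      ext z
      exact ⟨fun hz => (hemp ⟨z, hz⟩).elim, fun hz => hz.elim⟩
    have : Subsingleton Γ(pullback p g, G ⁻¹ᵁ V) := by
      rw [hbot]
      infer_instance
    exact hx (ψ.injective (Subsingleton.elim _ _))
  have : IsDomain Γ(pullback p g, G ⁻¹ᵁ V) := inferInstance
  let η := genericPoint (Spec R')
  obtain ⟨v', hv', hv'η⟩ : ∃ v' ∈ G ⁻¹ᵁ V, pullback.snd p g v' = η := by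
    obtain ⟨w, hw⟩ := hne
    have hopen := (pullback.snd p g).isOpenMap _ (G ⁻¹ᵁ V).2
    exact (genericPoint_specializes (pullback.snd p g w)).mem_open hopen ⟨w, hw, rfl⟩
  refine ⟨G v', hv', fun h z hz hzv h0 => ?_⟩
  have hg : p (G v') = g η := by
    rw [← hv'η, ← Scheme.Hom.comp_apply, ← Scheme.Hom.comp_apply, pullback.condition]
  obtain ⟨z', hz', -⟩ := Scheme.Pullback.exists_preimage_pullback z η (hzv.trans hg)
  have h1 : G.app V h * ψ x = 0 := by rw [← hψ, h0, map_zero]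
  rcases mul_eq_zero.mp h1 with h2 | h2
  · have h3 : z' ∈ G ⁻¹ᵁ Z.basicOpen h := by
      change G z' ∈ Z.basicOpen h
      rw [show G z' = z from hz']; exact hz
    rw [Scheme.preimage_basicOpen, h2, Scheme.basicOpen_zero] at h3
    exact h3
  · exact hx ((map_eq_zero_iff ψ ψ.injective).mp h2)

/-- For `p : Z ⟶ S` flat with geometrically integral fibres, an open subset meeting every fibre is
schematically dense. -/
lemma section_eq_zero_of_surjective [IsAffine S] [IsLocallyNoetherian S] [GeometricallyIntegral p]
    [Flat p] [UniversallyOpen p] {U : Z.Opens} (hU : ∀ s, ∃ z ∈ U, p z = s) {V : Z.Opens}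
    (a : Γ(Z, V)) (ha : ∀ (z : Z) (hz : z ∈ V), z ∈ U → Z.presheaf.germ V z hz a = 0) : a = 0 := by
  wlog hV : IsAffineOpen V generalizing V
  · refine Z.IsSheaf.section_ext fun x hx ↦ ?_
    obtain ⟨W, hW, hxW, hWV⟩ := exists_isAffineOpen_mem_and_subset hx
    refine ⟨W, hWV, hxW, ?_⟩
    rw [map_zero]
    refine this _ (fun z hz hzU => ?_) hW
    have := ha z (hWV hz) hzU
    rwa [← Z.presheaf.germ_res_apply (homOfLE hWV) z hz] at this
  have : IsNoetherianRing Γ(S, ⊤) :=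
    IsLocallyNoetherian.component_noetherian ⟨⊤, isAffineOpen_top S⟩
  let : Algebra Γ(S, ⊤) Γ(Z, V) := (p.appLE ⊤ V le_top).hom.toAlgebra
  have : Module.Flat Γ(S, ⊤) Γ(Z, V) := p.flat_appLE (isAffineOpen_top S) hV le_top
  -- Dévissage with `J` the annihilator of `a`. It contains a power of every `h` with `D(h) ⊆ U`,
  -- and since fibres are irreducible such an `h` is invertible somewhere on the fibre through `v`.
  refine eq_zero_of_mul_eq_zero_of_prime (R := Γ(S, ⊤)) {h : Γ(Z, V) | h * a = 0} (fun P hP x hx => ?_) a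
    fun h hh => hh
  by_contra hne
  obtain ⟨v, hv, H⟩ := exists_fibre_of_ne_zero p hV P hP x hne
  obtain ⟨w, hw, hwv⟩ := hU (p v)
  obtain ⟨z, hzU, hzV, hz⟩ := exists_mem_inter_of_irreducible_fibre p hw hv hwv
  obtain ⟨h, hle, hzh⟩ := hV.exists_basicOpen_le ⟨z, hzU⟩ hzV
  have h0 : TopCat.Presheaf.restrictOpen a (Z.basicOpen h) (Z.basicOpen_le h) = 0 := by
    refine section_ext_germ fun y hy => ?_
    rw [map_zero]
    exact (Z.presheaf.germ_res_apply (homOfLE (Z.basicOpen_le h)) y hy a).trans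
      (ha y (Z.basicOpen_le h hy) (hle hy))
  obtain ⟨n, hn⟩ := exists_pow_mul_eq_zero_of_res_basicOpen_eq_zero_of_isCompact Z hV.isCompact a h h0
  -- The exponent is `n + 1` because `D(h ^ m) = D(h)` needs `m > 0`.
  refine H (h ^ (n + 1)) z ?_ (hz.trans hwv) (hx _ ?_)
  · rw [Scheme.basicOpen_pow _ _ n.succ_pos]
    exact hzh
  · change _ = _
    rw [pow_succ', mul_assoc, hn, mul_zero]

/-- A vector of sections with an entry that is invertible on an open subset meeting every fibre
generates freely, with flat cokernel. -/
lemma free_and_flat_of_surjective [IsAffine S] [IsLocallyNoetherian S] [GeometricallyIntegral p]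
    [Flat p] [UniversallyOpen p] {U : Z.Opens} (hU : ∀ s, ∃ z ∈ U, p z = s) {V : Z.Opens}
    (hV : IsAffineOpen V) {m : ℕ} (f : Fin m → Γ(Z, V)) (j : Fin m)
    (hf : ∀ z ∈ V, z ∈ U → z ∈ Z.basicOpen (f j)) :
    (∀ a : Γ(Z, V), (∀ l, a * f l = 0) → a = 0) ∧
    letI : Algebra Γ(S, ⊤) Γ(Z, V) := (p.appLE ⊤ V le_top).hom.toAlgebra
    Module.Flat Γ(S, ⊤) ((Fin m → Γ(Z, V)) ⧸ Submodule.span Γ(Z, V) {f}) := by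
  have : IsNoetherianRing Γ(S, ⊤) :=
    IsLocallyNoetherian.component_noetherian ⟨⊤, isAffineOpen_top S⟩
  let : Algebra Γ(S, ⊤) Γ(Z, V) := (p.appLE ⊤ V le_top).hom.toAlgebra
  have : Module.Flat Γ(S, ⊤) Γ(Z, V) := p.flat_appLE (isAffineOpen_top S) hV le_top
  refine free_and_flat_of_prime (R := Γ(S, ⊤)) f j fun P hP x hx => ?_
  by_contra hne
  obtain ⟨v, hv, H⟩ := exists_fibre_of_ne_zero p hV P hP x hne
  obtain ⟨w, hw, hwv⟩ := hU (p v)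
  obtain ⟨z, hzU, hzV, hz⟩ := exists_mem_inter_of_irreducible_fibre p hw hv hwv
  exact H (f j) z (hf z hzV hzU) (hz.trans hwv) hx

end Density

section DomainFamily

variable {k : Type u} [Field k] {S X : Sch k} [UniversallyOpen X.hom] [GeometricallyIntegral X.hom]

/-- An open subset of `S × X` is a family of domains iff it meets every fibre over `S`. -/
lemma isDomainFamily_iff {U : (prodOver S X).Opens} :
    IsDomainFamily U ↔ ∀ s : S.left, ∃ z ∈ U, pullback.fst S.hom X.hom z = s := by
  constructor
  · intro hU s
    -- Density is tested on the fibre over `s`, which is nonempty.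
    let T : Sch k := Over.mk (S.left.fromSpecResidueField s ≫ S.hom)
    let g : T ⟶ S := Over.homMk (S.left.fromSpecResidueField s)
    obtain ⟨t⟩ : Nonempty T.left := inferInstanceAs (Nonempty (Spec _))
    obtain ⟨y, -⟩ := (pullback.fst T.hom X.hom).surjective t
    obtain ⟨z, -, hz⟩ := (hU T g).inter_open_nonempty _ isOpen_univ ⟨y, trivial⟩
    refine ⟨prodMap g X z, hz, ?_⟩
    rw [← Scheme.Hom.comp_apply, prodMap_fst, Scheme.Hom.comp_apply]
    exact S.left.fromSpecResidueField_apply s _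
  · intro hU T g
    rw [dense_iff_inter_open]
    rintro W hW ⟨w, hw⟩
    -- A point of `U` over the image of `t` in `S` lifts to the fibre of `T × X` over `t`, where `t`
    -- is the image of `w`. By irreducibility of that fibre the preimage of `U` meets `W` in it.
    obtain ⟨z, hz, hzs⟩ := hU (g.left (pullback.fst T.hom X.hom w))
    obtain ⟨y, hy, hyt⟩ : ∃ y, prodMap g X y = z ∧
        pullback.fst T.hom X.hom y = pullback.fst T.hom X.hom w := by
      obtain ⟨y, hy, hyt⟩ := Scheme.Pullback.exists_preimage_pullback z _ hzs
      let e := (prodMap_isPullback g X).isoPullback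
      refine ⟨e.inv y, ?_, ?_⟩
      · rw [← Scheme.Hom.comp_apply, IsPullback.isoPullback_inv_fst, hy]
      · rw [← Scheme.Hom.comp_apply, IsPullback.isoPullback_inv_snd, hyt]
    obtain ⟨x, hxW, hx, -⟩ := exists_mem_inter_of_irreducible_fibre (pullback.fst T.hom X.hom)
      (U := ⟨W, hW⟩) (V := prodMap g X ⁻¹ᵁ U) hw (by change prodMap g X y ∈ U; rwa [hy]) hyt.symm
    exact ⟨x, hxW, hx⟩

end DomainFamily

end GenericMaps

/-! ### Functions on the standard charts of `ℙⁿ`. -/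

namespace GenericMaps

variable {k : Type u} [Field k]

section Scalars

/-- The structure map `k → Γ(V, 𝒪_Z)` of a `k`-scheme. -/
def sectionScalar {Z : Scheme.{u}} (s : Z ⟶ Spec (CommRingCat.of k)) (V : Z.Opens) :
    k →+* Γ(Z, V) :=
  ((Scheme.ΓSpecIso (CommRingCat.of k)).inv ≫ s.appLE ⊤ V le_top).hom

lemma germ_sectionScalar {Z : Scheme.{u}} (s : Z ⟶ Spec (CommRingCat.of k)) (V : Z.Opens) (z : Z)
    (hz : z ∈ V) : (Z.presheaf.germ V z hz).hom.comp (sectionScalar s V) = scalar s z := by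
  rw [sectionScalar, scalar, ← CommRingCat.hom_comp, Category.assoc]
  congr 2
  exact (Category.assoc _ _ _).trans
    (congrArg (s.app ⊤ ≫ ·) (Z.presheaf.germ_res (homOfLE le_top) z hz))

lemma appLE_sectionScalar {W Z : Scheme.{u}} (G : W ⟶ Z) (s : Z ⟶ Spec (CommRingCat.of k))
    (V : Z.Opens) (U : W.Opens) (h : U ≤ G ⁻¹ᵁ V) :
    (G.appLE V U h).hom.comp (sectionScalar s V) = sectionScalar (G ≫ s) U := by
  rw [sectionScalar, sectionScalar, ← CommRingCat.hom_comp, Category.assoc]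
  congr 2
  exact Scheme.Hom.appLE_comp_appLE _ _ _ _ _ _ _

lemma hom_ext_sectionScalar {Z : Scheme.{u}} {s t : Z ⟶ Spec (CommRingCat.of k)}
    (h : sectionScalar s ⊤ = sectionScalar t ⊤) : s = t := by
  refine ext_of_isAffine ?_
  have h1 := CommRingCat.hom_ext h
  rw [cancel_epi] at h1
  have h2 : ∀ r : Z ⟶ Spec (CommRingCat.of k), r.appLE ⊤ ⊤ le_top = r.appTop := fun r =>
    (Scheme.Hom.app_eq_appLE (f := r) (U := ⊤)).symm
  exact (h2 s).symm.trans (h1.trans (h2 t))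

/-- Reads off the scalars on a chart of `ℙⁿ`, where the structure morphism is known only through a
factorization over `Spec` of the sections. -/
lemma sectionScalar_of_toSpecΓ {Z : Scheme.{u}} {s : Z ⟶ Spec (CommRingCat.of k)} {V : Z.Opens}
    (χ : CommRingCat.of k ⟶ Γ(Z, V)) (h : V.ι ≫ s = V.toSpecΓ ≫ Spec.map χ) :
    sectionScalar s V = χ.hom := by
  have h1 := congrArg Scheme.Hom.appTop h
  rw [Scheme.Hom.comp_appTop, Scheme.Hom.comp_appTop, Scheme.Opens.toSpecΓ_appTop,
    ← Category.assoc, Scheme.ΓSpecIso_naturality, Category.assoc, ← Iso.inv_comp_eq,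
    Iso.eq_comp_inv] at h1
  rw [← h1, sectionScalar]
  congr 1
  simp only [Category.assoc]
  congr 1
  change s.app ⊤ ≫ _ = s.app ⊤ ≫ _
  congr 1
  exact Z.presheaf.map_comp (X := op ⊤) (Y := op (V.ι ''ᵁ ⊤)) (Z := op V)
    (homOfLE le_top).op (eqToHom (by simp)).op

end Scalars

section AffineTarget

variable {W Z : Scheme.{u}} {V : Z.Opens} (hV : IsAffineOpen V)

/-- The morphism to an affine open subscheme given by a homomorphism on sections. -/
def homOfAffineOpen (ψ : Γ(Z, V) ⟶ Γ(W, ⊤)) : W ⟶ Z := W.toSpecΓ ≫ Spec.map ψ ≫ hV.fromSpec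

lemma top_le_preimage_homOfAffineOpen (ψ : Γ(Z, V) ⟶ Γ(W, ⊤)) :
    ⊤ ≤ homOfAffineOpen hV ψ ⁻¹ᵁ V := by
  rintro w -
  change hV.fromSpec _ ∈ (V : Set Z)
  rw [← hV.range_fromSpec]
  exact ⟨_, rfl⟩

lemma eq_homOfAffineOpen (α : W ⟶ Z) (h : ⊤ ≤ α ⁻¹ᵁ V) :
    α = homOfAffineOpen hV (α.appLE V ⊤ h) := by
  rw [← cancel_epi W.topIso.hom, homOfAffineOpen]
  change (⊤ : W.Opens).ι ≫ α = (⊤ : W.Opens).ι ≫ W.toSpecΓ ≫ _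
  rw [← Category.assoc (Scheme.Opens.ι _) W.toSpecΓ, ← Scheme.Opens.toSpecΓ_top,
    Scheme.Opens.toSpecΓ_SpecMap_appLE_assoc, hV.toSpecΓ_fromSpec, Scheme.Hom.resLE_comp_ι]

lemma homOfAffineOpen_appLE (ψ : Γ(Z, V) ⟶ Γ(W, ⊤)) :
    (homOfAffineOpen hV ψ).appLE V ⊤ (top_le_preimage_homOfAffineOpen hV ψ) = ψ := by
  have h1 := eq_homOfAffineOpen hV _ (top_le_preimage_homOfAffineOpen hV ψ)
  generalize (homOfAffineOpen hV ψ).appLE V ⊤ (top_le_preimage_homOfAffineOpen hV ψ) = φ at h1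
  rw [homOfAffineOpen, homOfAffineOpen, ← Category.assoc, ← Category.assoc, cancel_mono] at h1
  have h2 := congrArg Scheme.Hom.appTop h1
  simp only [Scheme.Hom.comp_appTop, Scheme.toSpecΓ_appTop, Scheme.ΓSpecIso_naturality] at h2
  exact ((cancel_epi _).mp h2).symm

lemma hom_ext_of_affineOpen (hV : IsAffineOpen V) {α β : W ⟶ Z} (h : ⊤ ≤ α ⁻¹ᵁ V) (h' : ⊤ ≤ β ⁻¹ᵁ V)
    (e : α.appLE V ⊤ h = β.appLE V ⊤ h') : α = β := by
  rw [eq_homOfAffineOpen hV α h, eq_homOfAffineOpen hV β h', e]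

end AffineTarget

section GradedRing

variable {A : Type u} [CommRing A] {σ : Type*} [SetLike σ A] [AddSubgroupClass σ A] (𝒜 : ℕ → σ)
  [GradedRing 𝒜]

open HomogeneousLocalization

lemma basicOpen_ι_toSpecZero (f : A) {m : ℕ} (hf : f ∈ 𝒜 m) (hm : 0 < m) :
    (Proj.basicOpen 𝒜 f).ι ≫ Proj.toSpecZero 𝒜 = (Proj.basicOpen 𝒜 f).toSpecΓ ≫
      Spec.map (CommRingCat.ofHom (fromZeroRingHom 𝒜 (.powers f)) ≫ Proj.awayToSection 𝒜 f) := by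
  rw [Spec.map_comp, ← Proj.awayι_toSpecZero _ _ hf hm, ← Proj.basicOpenIsoSpec_inv_ι]
  simp only [← Category.assoc]
  rw [← Proj.basicOpenToSpec, ← Proj.basicOpenIsoSpec_hom _ _ hf hm, Iso.hom_inv_id,
    Category.id_comp]

/-- A form of `F / f ^ d` free of denominators: identities in the localization at `x` can be checked
after multiplying by powers of the unit `f`. -/
lemma val_awayMap_mk {f g : A} (hf : f ∈ 𝒜 1) (hg : g ∈ 𝒜 1) {x : A} (hx : x = f * g) {d : ℕ}
    (F : A) (hF : F ∈ 𝒜 (d • 1)) :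
    (awayMap 𝒜 hg hx (Away.mk 𝒜 hf d F hF)).val * algebraMap A (Localization.Away x) f ^ d =
      algebraMap A (Localization.Away x) F := by
  rw [val_awayMap, Away.val_mk, Localization.mk_eq_mk'_apply, ← map_pow]
  have h1 := IsLocalization.mk'_spec (Localization.Away f) F
    (⟨f ^ d, d, rfl⟩ : Submonoid.powers f)
  have h2 := congrArg (Localization.awayLift (algebraMap A (Localization.Away x)) f
    (isUnit_of_dvd_unit (map_dvd _ ⟨_, hx⟩) (IsLocalization.Away.algebraMap_isUnit x))) h1
  rw [map_mul] at h2
  simpa only [Localization.awayLift, IsLocalization.Away.lift_eq] using h2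

/-- The change of charts `F / f ^ d = (g / f) ^ d * (F / g ^ d)`, verified on `D₊(f g)` after
multiplication by the unit `f ^ d`. -/
lemma germ_awayToSection {f g : A} (hf : f ∈ 𝒜 1) (hg : g ∈ 𝒜 1) {d : ℕ}
    (F : A) (hF : F ∈ 𝒜 (d • 1)) (p : Proj 𝒜) (hpf : p ∈ Proj.basicOpen 𝒜 f)
    (hpg : p ∈ Proj.basicOpen 𝒜 g) :
    (Proj 𝒜).presheaf.germ _ p hpf (Proj.awayToSection 𝒜 f (Away.mk 𝒜 hf d F hF)) =
      (Proj 𝒜).presheaf.germ _ p hpf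
        (Proj.awayToSection 𝒜 f (Away.mk 𝒜 hf 1 g (by simpa using hg))) ^ d *
      (Proj 𝒜).presheaf.germ _ p hpg (Proj.awayToSection 𝒜 g (Away.mk 𝒜 hg d F hF)) := by
  have hp : p ∈ Proj.basicOpen 𝒜 (f * g) := by rw [Proj.basicOpen_mul]; exact ⟨hpf, hpg⟩
  have h1 := Proj.awayMap_awayToSection 𝒜 (f := f) hg (x := f * g) rfl
  have h2 := Proj.awayMap_awayToSection 𝒜 (f := g) hf (x := f * g) (mul_comm _ _)
  have key : ∀ a, (Proj 𝒜).presheaf.germ _ p hpf (Proj.awayToSection 𝒜 f a) =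
      (Proj 𝒜).presheaf.germ _ p hp (Proj.awayToSection 𝒜 (f * g) (awayMap 𝒜 hg rfl a)) := by
    intro a
    rw [← (Proj 𝒜).presheaf.germ_res_apply (homOfLE (Proj.basicOpen_mono 𝒜 _ _ ⟨g, rfl⟩)) p hp]
    exact congrArg _ (ConcreteCategory.congr_hom h1 a).symm
  have key' : ∀ a, (Proj 𝒜).presheaf.germ _ p hpg (Proj.awayToSection 𝒜 g a) =
      (Proj 𝒜).presheaf.germ _ p hp (Proj.awayToSection 𝒜 (f * g)
        (awayMap 𝒜 hf (mul_comm _ _) a)) := by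
    intro a
    rw [← (Proj 𝒜).presheaf.germ_res_apply
      (homOfLE (Proj.basicOpen_mono 𝒜 _ _ ⟨f, mul_comm _ _⟩)) p hp]
    exact congrArg _ (ConcreteCategory.congr_hom h2 a).symm
  rw [key, key, key', ← map_pow, ← map_mul, ← map_pow, ← map_mul]
  congr 2
  apply HomogeneousLocalization.val_injective
  rw [val_mul, val_pow]
  have hu : IsUnit (algebraMap A (Localization.Away (f * g)) f) :=
    isUnit_of_dvd_unit (map_dvd _ ⟨_, rfl⟩) (IsLocalization.Away.algebraMap_isUnit (f * g))
  have e1 := val_awayMap_mk 𝒜 hf hg (x := f * g) rfl F hF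
  have e2 := val_awayMap_mk 𝒜 hf hg (x := f * g) rfl (d := 1) g (by simpa using hg)
  have e3 := val_awayMap_mk 𝒜 hg hf (x := f * g) (mul_comm _ _) F hF
  apply (hu.pow d).mul_left_injective
  dsimp only
  rw [e1, ← e3, ← e2]
  ring

lemma basicOpen_awayToSection {f g : A} (hf : f ∈ 𝒜 1) (hg : g ∈ 𝒜 1) :
    (Proj 𝒜).basicOpen (Proj.awayToSection 𝒜 f (Away.mk 𝒜 hf 1 g (by simpa using hg))) =
      Proj.basicOpen 𝒜 f ⊓ Proj.basicOpen 𝒜 g := by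
  apply le_antisymm
  · refine le_inf ((Proj 𝒜).basicOpen_le _) ?_
    intro p hp
    have hpf : p ∈ Proj.basicOpen 𝒜 f := (Proj 𝒜).basicOpen_le _ hp
    have h1 := Proj.awayι_preimage_basicOpen 𝒜 hf one_pos hg one_pos
    have h2 : (Proj.basicOpen 𝒜 f).ι = Proj.basicOpenToSpec 𝒜 f ≫ Proj.awayι 𝒜 f hf one_pos := by
      rw [← Proj.basicOpenIsoSpec_hom _ _ hf one_pos, ← Proj.basicOpenIsoSpec_inv_ι,
        Iso.hom_inv_id_assoc]
    have h3 : (Proj.basicOpen 𝒜 f).ι ⁻¹ᵁ Proj.basicOpen 𝒜 g = Proj.basicOpenToSpec 𝒜 f ⁻¹ᵁ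
        PrimeSpectrum.basicOpen (Away.isLocalizationElem hf hg) := by
      rw [h2, ← h1]; rfl
    have h4 : (⟨p, hpf⟩ : Proj.basicOpen 𝒜 f) ∈ (Proj.basicOpen 𝒜 f).toSpecΓ ⁻¹ᵁ
        PrimeSpectrum.basicOpen (Proj.awayToSection 𝒜 f (Away.isLocalizationElem hf hg)) := by
      have h6 : Away.isLocalizationElem hf hg = Away.mk 𝒜 hf 1 g (by simpa using hg) := by
        apply HomogeneousLocalization.val_injective
        simp [Away.isLocalizationElem]
      rw [Scheme.Opens.toSpecΓ_preimage_basicOpen, h6]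
      exact hp
    have h5 : (⟨p, hpf⟩ : Proj.basicOpen 𝒜 f) ∈ (Proj.basicOpen 𝒜 f).ι ⁻¹ᵁ Proj.basicOpen 𝒜 g := by
      rw [h3]
      exact h4
    exact h5
  · rintro p ⟨hpf, hpg⟩
    -- Changing charts for the element `g` itself gives `1 = (f / g) * (g / f)`.
    have h1 := germ_awayToSection 𝒜 hg hf g (d := 1) (by simpa using hg) p hpg hpf
    have h2 : Away.mk 𝒜 hg 1 g (by simpa using hg) = 1 := by
      apply HomogeneousLocalization.val_injective
      rw [Away.val_mk, Localization.mk_eq_mk'_apply, val_one, IsLocalization.mk'_eq_iff_eq_mul]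
      simp
    rw [h2, map_one, map_one, pow_one, mul_comm] at h1
    rw [Scheme.mem_basicOpen _ _ _ hpf]
    exact .of_mul_eq_one _ h1.symm

end GradedRing

section Proj
attribute [local instance] MvPolynomial.gradedAlgebra
open MvPolynomial

variable {n : ℕ}

/-- The inclusion of the ring of functions on `D₊(x_j)` into the localization at `x_j`. -/
def toLocalization (j : Fin (n + 1)) : Γ((projSpace k n).left, chart k n j) →+*
    Localization.Away (X j : MvPolynomial (Fin (n + 1)) k) :=
  (algebraMap (HomogeneousLocalization.Away (homogeneousSubmodule (Fin (n + 1)) k) (X j))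
    (Localization.Away (X j : MvPolynomial (Fin (n + 1)) k))).comp
    (Proj.basicOpenIsoAway (homogeneousSubmodule (Fin (n + 1)) k) (X j) (isHomogeneous_X k j)
      one_pos).inv.hom

lemma toLocalization_injective (j : Fin (n + 1)) :
    Function.Injective (toLocalization (k := k) j) := by
  have h1 := (ConcreteCategory.bijective_of_isIso (Proj.basicOpenIsoAway
    (homogeneousSubmodule (Fin (n + 1)) k) (X j) (isHomogeneous_X k j) one_pos).inv).1
  exact (HomogeneousLocalization.val_injective _).comp h1

lemma toLocalization_awayToSection (j : Fin (n + 1)) (a) :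
    toLocalization (k := k) j ((Proj.awayToSection (homogeneousSubmodule (Fin (n + 1)) k) (X j)).hom a)
      = a.val := by
  change HomogeneousLocalization.val _ = _
  congr 1
  exact ConcreteCategory.congr_hom (Proj.basicOpenIsoAway
    (homogeneousSubmodule (Fin (n + 1)) k) (X j) (isHomogeneous_X k j) one_pos).hom_inv_id a

lemma toLocalization_ratio (j : Fin (n + 1)) {d : ℕ} (F : MvPolynomial (Fin (n + 1)) k)
    (hF : F.IsHomogeneous d) :
    toLocalization j (ratio j F hF) * algebraMap _ _ (X j : MvPolynomial (Fin (n + 1)) k) ^ d =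
      algebraMap _ _ F := by
  have h1 : toLocalization j (ratio j F hF) =
      IsLocalization.mk' (Localization.Away (X j : MvPolynomial (Fin (n + 1)) k)) F
        (⟨X j ^ d, d, rfl⟩ : Submonoid.powers (X j : MvPolynomial (Fin (n + 1)) k)) :=
    (toLocalization_awayToSection j _).trans (Localization.mk_eq_mk'_apply _ _)
  rw [h1, ← map_pow]
  exact IsLocalization.mk'_spec _ _ _

/-- Identities between ratios are proved through this criterion: functions on `D₊(x_j)` inject into
the localization at `x_j`, where the denominator can be cleared. -/
lemma ratio_eq_of_toLocalization (j : Fin (n + 1)) {d : ℕ} {F : MvPolynomial (Fin (n + 1)) k}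
    (hF : F.IsHomogeneous d) {a : Γ((projSpace k n).left, chart k n j)}
    (h : toLocalization j a * algebraMap _ _ (X j : MvPolynomial (Fin (n + 1)) k) ^ d =
      algebraMap _ _ F) : ratio j F hF = a := by
  apply toLocalization_injective
  have hu : IsUnit (algebraMap (MvPolynomial (Fin (n + 1)) k)
      (Localization.Away (X j : MvPolynomial (Fin (n + 1)) k)) (X j)) :=
    IsLocalization.Away.algebraMap_isUnit _
  exact (hu.pow d).mul_left_injective ((toLocalization_ratio j F hF).trans h.symm)

lemma ratio_surjective (j : Fin (n + 1)) (a : Γ((projSpace k n).left, chart k n j)) :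
    ∃ (d : ℕ) (F : MvPolynomial (Fin (n + 1)) k) (hF : F.IsHomogeneous d), ratio j F hF = a := by
  obtain ⟨b, rfl⟩ := (ConcreteCategory.bijective_of_isIso (Proj.basicOpenIsoAway
    (homogeneousSubmodule (Fin (n + 1)) k) (X j) (isHomogeneous_X k j) one_pos).hom).2 a
  obtain ⟨d, F, hF, rfl⟩ := HomogeneousLocalization.Away.mk_surjective
    (homogeneousSubmodule (Fin (n + 1)) k) (isHomogeneous_X k j) b
  exact ⟨d, F, by simpa using hF, rfl⟩

lemma ratio_self (j : Fin (n + 1)) : ratio (k := k) j (X j) (isHomogeneous_X k j) = 1 :=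
  ratio_eq_of_toLocalization _ _ (by simp)

lemma ratio_mul (j : Fin (n + 1)) {d e : ℕ} {F G : MvPolynomial (Fin (n + 1)) k}
    (hF : F.IsHomogeneous d) (hG : G.IsHomogeneous e) :
    ratio j (F * G) (hF.mul hG) = ratio j F hF * ratio j G hG := by
  refine ratio_eq_of_toLocalization _ _ ?_
  rw [map_mul, map_mul, ← toLocalization_ratio j F hF, ← toLocalization_ratio j G hG]
  ring

lemma ratio_X_pow (j l : Fin (n + 1)) (N : ℕ) :
    ratio (k := k) l (X j ^ N) (isHomogeneous_X_pow j N) =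
      ratio l (X j) (isHomogeneous_X k j) ^ N := by
  refine ratio_eq_of_toLocalization _ _ ?_
  rw [map_pow, map_pow, ← toLocalization_ratio l (X j) (isHomogeneous_X k j)]
  ring

lemma sectionScalar_projSpace (j : Fin (n + 1)) (c : k) :
    sectionScalar (projSpace k n).hom (chart k n j) c = ratio j (C c) (isHomogeneous_C _ c) := by
  have h2 := sectionScalar_of_toSpecΓ (s := (projSpace k n).hom) (V := (chart k n j).1)
    (CommRingCat.ofHom (algebraMap k (homogeneousSubmodule (Fin (n + 1)) k 0)) ≫
      CommRingCat.ofHom (HomogeneousLocalization.fromZeroRingHom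
          (homogeneousSubmodule (Fin (n + 1)) k) _) ≫
      Proj.awayToSection (homogeneousSubmodule (Fin (n + 1)) k) (X j)) (by
      refine (Category.assoc _ _ _).symm.trans ((congrArg (· ≫ Spec.map _)
        (basicOpen_ι_toSpecZero _ _ (isHomogeneous_X k j) one_pos)).trans ?_)
      exact (Category.assoc _ _ _).trans (congrArg (_ ≫ ·) (Spec.map_comp _ _).symm))
  symm
  refine ratio_eq_of_toLocalization _ _ ?_
  rw [h2, pow_zero, mul_one]
  refine (toLocalization_awayToSection j _).trans ?_
  rfl

/-- By homogeneity `F(x) = x_j ^ d * F(x / x_j)`. This reduces all functions on the chart to scalars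
and the coordinates `x_i / x_j`. -/
lemma ratio_eq_eval₂ (j : Fin (n + 1)) {d : ℕ} (F : MvPolynomial (Fin (n + 1)) k)
    (hF : F.IsHomogeneous d) :
    ratio j F hF = F.eval₂ (sectionScalar (projSpace k n).hom (chart k n j))
      (fun i => ratio j (X i) (isHomogeneous_X k i)) := by
  refine ratio_eq_of_toLocalization _ _ ?_
  rw [hom_eval₂, mul_comm, ← eval₂_smul_of_isHomogeneous hF]
  have h1 : (toLocalization j).comp (sectionScalar (projSpace k n).hom (chart k n j)) =
      (algebraMap (MvPolynomial (Fin (n + 1)) k) _).comp C := by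
    ext c
    rw [RingHom.comp_apply, sectionScalar_projSpace]
    simpa using toLocalization_ratio j (C c) (isHomogeneous_C _ c)
  have h2 : (algebraMap (MvPolynomial (Fin (n + 1)) k)
      (Localization.Away (X j : MvPolynomial (Fin (n + 1)) k)) (X j)) •
      ((toLocalization j) ∘ (fun i => ratio j (X i) (isHomogeneous_X k i))) =
      (algebraMap (MvPolynomial (Fin (n + 1)) k) _) ∘ X := by
    funext i
    have := toLocalization_ratio j (X i) (isHomogeneous_X k i)
    rw [pow_one, mul_comm] at this
    exact this
  rw [h1]
  refine (congrArg (fun v => eval₂ _ v F) h2).trans ?_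
  exact (hom_eval₂ F C (algebraMap _ _) X).symm.trans (by rw [eval₂_eta])

lemma chart_cover (p : (projSpace k n).left) : ∃ j, p ∈ (chart k n j).1 := by
  have h := Proj.iSup_basicOpen_eq_top' (homogeneousSubmodule (Fin (n + 1)) k)
    (X : Fin (n + 1) → MvPolynomial (Fin (n + 1)) k) (fun i => ⟨1, isHomogeneous_X k i⟩) (by
      refine top_le_iff.mp fun F _ => ?_
      have h1 : F ∈ Algebra.adjoin k (Set.range (X : Fin (n + 1) → MvPolynomial (Fin (n + 1)) k)) :=
        by rw [adjoin_range_X]; trivial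
      induction h1 using Algebra.adjoin_induction with
      | mem x hx => exact Algebra.subset_adjoin hx
      | algebraMap r =>
        exact Subalgebra.algebraMap_mem _
          (algebraMap k (homogeneousSubmodule (Fin (n + 1)) k 0) r)
      | add x y _ _ hx hy => exact add_mem (hx trivial) (hy trivial)
      | mul x y _ _ hx hy => exact mul_mem (hx trivial) (hy trivial))
  have hp : p ∈ (⨆ i, Proj.basicOpen (homogeneousSubmodule (Fin (n + 1)) k) (X i)) := by
    rw [h]; trivial
  exact Opens.mem_iSup.mp hp

/-- Change of charts. -/
lemma germ_ratio (l j : Fin (n + 1)) {d : ℕ} (F : MvPolynomial (Fin (n + 1)) k)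
    (hF : F.IsHomogeneous d) (p : (projSpace k n).left) (hl : p ∈ (chart k n l).1)
    (hj : p ∈ (chart k n j).1) :
    (projSpace k n).left.presheaf.germ _ p hl (ratio l F hF) =
      (projSpace k n).left.presheaf.germ _ p hl (ratio l (X j) (isHomogeneous_X k j)) ^ d *
        (projSpace k n).left.presheaf.germ _ p hj (ratio j F hF) := by
  exact germ_awayToSection (homogeneousSubmodule (Fin (n + 1)) k) (isHomogeneous_X k l)
    (isHomogeneous_X k j) F (by simpa using hF) p hl hj

lemma basicOpen_ratio (l j : Fin (n + 1)) :
    (projSpace k n).left.basicOpen (ratio l (X j) (isHomogeneous_X k j)) =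
      (chart k n l).1 ⊓ (chart k n j).1 :=
  basicOpen_awayToSection (homogeneousSubmodule (Fin (n + 1)) k) (isHomogeneous_X k l)
    (isHomogeneous_X k j)

end Proj

end GenericMaps

/-! ### Morphisms to `ℙⁿ` and the tautological sub-bundle. -/

namespace GenericMaps

variable {k : Type u} [Field k]

lemma stalkMap_germ_appLE {W Z : Scheme.{u}} (g : W ⟶ Z) {V : Z.Opens} {U : W.Opens}
    (h : U ≤ g ⁻¹ᵁ V) (w : W) (hw : w ∈ U) (a : Γ(Z, V)) :
    (g.stalkMap w).hom (Z.presheaf.germ V (g w) (h hw) a) =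
      W.presheaf.germ U w hw (g.appLE V U h a) := by
  refine (Scheme.Hom.germ_stalkMap_apply g V w (h hw) a).trans ?_
  exact (W.presheaf.germ_res_apply (homOfLE h) w hw (g.app V a)).symm

lemma hom_ext_of_isOpenCover {W Y : Scheme.{u}} {ι : Type*} {V : ι → W.Opens} (hV : IsOpenCover V)
    {α β : W ⟶ Y} (h : ∀ i, (V i).ι ≫ α = (V i).ι ≫ β) : α = β :=
  (W.openCoverOfIsOpenCover V hV).hom_ext _ _ h

/-- Compatibility is phrased with arbitrary test schemes `T`, so that the uniqueness statement
`projSpace_hom_ext` applies to it directly. -/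
lemma exists_hom_of_isOpenCover {W Y : Scheme.{u}} {ι : Type u} {V : ι → W.Opens}
    (hV : IsOpenCover V) (α : ∀ i, (V i : Scheme.{u}) ⟶ Y)
    (h : ∀ (i j : ι) (T : Scheme.{u}) (a : T ⟶ V i) (b : T ⟶ V j),
      a ≫ (V i).ι = b ≫ (V j).ι → a ≫ α i = b ≫ α j) :
    ∃ β : W ⟶ Y, ∀ i, (V i).ι ≫ β = α i :=
  ⟨(W.openCoverOfIsOpenCover V hV).glueMorphisms α fun i j => h i j _ _ _ pullback.condition,
    fun i => (W.openCoverOfIsOpenCover V hV).ι_glueMorphisms α _ i⟩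

section StalkFamilies

variable {W Z : Scheme.{u}} {m : ℕ}

lemma StalkFamily.pullback_mono_at (g : W ⟶ Z) (w : W) {L M : StalkFamily Z m}
    (h : L (g w) ≤ M (g w)) : L.pullback g w ≤ M.pullback g w :=
  Submodule.span_mono (Set.image_mono h)

lemma StalkFamily.le_of_pullback_le (g : W ⟶ Z) (w : W) [IsIso (g.stalkMap w)]
    {L M : StalkFamily Z m} (h : L.pullback g w ≤ M.pullback g w) : L (g w) ≤ M (g w) := by
  have hb := ConcreteCategory.bijective_of_isIso (g.stalkMap w)
  have hinj : Function.Injective (stalkVec m g w) := fun x y hxy =>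
    funext fun j => hb.1 (congrFun hxy j)
  have key : ∀ y ∈ M.pullback g w, ∃ x ∈ M (g w), stalkVec m g w x = y := by
    intro y hy
    induction hy using Submodule.span_induction with
    | mem x hx => exact hx
    | zero => exact ⟨0, zero_mem _, map_zero _⟩
    | add x y _ _ h1 h2 =>
      obtain ⟨x, hx, rfl⟩ := h1
      obtain ⟨y, hy, rfl⟩ := h2
      exact ⟨x + y, add_mem hx hy, map_add _ _ _⟩
    | smul a x _ h1 =>
      obtain ⟨x, hx, rfl⟩ := h1
      obtain ⟨b, rfl⟩ := hb.2 a
      exact ⟨b • x, Submodule.smul_mem _ _ hx, map_smulₛₗ _ _ _⟩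
  intro x hx
  obtain ⟨y, hy, hxy⟩ := key _ (h (Submodule.subset_span ⟨x, hx, rfl⟩))
  rwa [← hinj hxy]

lemma StalkFamily.eq_of_pullback_eq (g : W ⟶ Z) (w : W) [IsIso (g.stalkMap w)]
    {L M : StalkFamily Z m} (h : L.pullback g w = M.pullback g w) : L (g w) = M (g w) :=
  le_antisymm (le_of_pullback_le g w h.le) (le_of_pullback_le g w h.ge)

lemma StalkFamily.eq_of_pullback_ι_eq (V : Z.Opens) {L M : StalkFamily Z m}
    (h : L.pullback V.ι = M.pullback V.ι) (z : Z) (hz : z ∈ V) : L z = M z := by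
  let w : (V : Scheme.{u}) := ⟨z, hz⟩
  have : IsIso (V.ι.stalkMap w) := inferInstance
  exact eq_of_pullback_eq V.ι w (congrFun h w)

end StalkFamilies

section Proj
attribute [local instance] MvPolynomial.gradedAlgebra
open MvPolynomial

variable {n : ℕ}

variable (k) in
/-- The vector `(x_0 / x_j, …, x_n / x_j)` of functions on `D₊(x_j)`. -/
abbrev chartVec (j : Fin (n + 1)) : Fin (n + 1) → Γ((projSpace k n).left, chart k n j) :=
  fun i => ratio j (X i) (isHomogeneous_X k i)

lemma germVec_chartVec (l j : Fin (n + 1)) (p : (projSpace k n).left) (hl : p ∈ (chart k n l).1)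
    (hj : p ∈ (chart k n j).1) :
    germVec (chartVec k l) p hl = germVec (chartVec k l) p hl j • germVec (chartVec k j) p hj := by
  ext i
  refine (germ_ratio l j (X i) (isHomogeneous_X k i) p hl hj).trans ?_
  rw [pow_one]
  rfl

/-- The chart vectors for `l` and `j` differ by the factor `x_j / x_l`, so one of them already
generates the supremum. -/
lemma taut_eq_span (j : Fin (n + 1)) (p : (projSpace k n).left) (hp : p ∈ (chart k n j).1) :
    taut k n p = Submodule.span _ {germVec (chartVec k j) p hp} := by
  apply le_antisymm
  · refine iSup₂_le fun l hl => ?_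
    rw [Submodule.span_singleton_le_iff_mem, Submodule.mem_span_singleton]
    exact ⟨_, (germVec_chartVec l j p hl hp).symm⟩
  · exact le_iSup₂ (f := fun (l : Fin (n + 1)) (hl : p ∈ (chart k n l).1) =>
      Submodule.span _ {germVec (chartVec k l) p hl}) j hp

section
variable {W : Scheme.{u}} (α : W ⟶ (projSpace k n).left) (w : W)

/-- The pullback along `α` of the vector `(x_0 / x_j, …, x_n / x_j)`, as a vector of germs. -/
abbrev pullbackVec {j : Fin (n + 1)} (hw : α w ∈ (chart k n j).1) :
    Fin (n + 1) → W.presheaf.stalk w :=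
  stalkVec (n + 1) α w (germVec (chartVec k j) (α w) hw)

lemma taut_pullback_eq_span {j : Fin (n + 1)} (hw : α w ∈ (chart k n j).1) :
    (taut k n).pullback α w = Submodule.span _ {pullbackVec α w hw} :=
  StalkFamily.pullback_span α _ w _ (taut_eq_span j (α w) hw)

lemma pullbackVec_self {j : Fin (n + 1)} (hw : α w ∈ (chart k n j).1) :
    pullbackVec α w hw j = 1 := by
  change (α.stalkMap w).hom ((projSpace k n).left.presheaf.germ _ _ hw (ratio j (X j) _)) = 1
  rw [ratio_self, map_one, map_one]

variable {α w}

/-- The line detects the chart: `v` is a multiple of the vector of some chart `l`, so `x_j / x_l` is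
a unit at `α w`, and it is a unit only on `D₊(x_l) ∩ D₊(x_j)`. -/
lemma mem_chart_of_isUnit {v : Fin (n + 1) → W.presheaf.stalk w} {j : Fin (n + 1)}
    (hv : v ∈ (taut k n).pullback α w) (hj : IsUnit (v j)) : α w ∈ (chart k n j).1 := by
  obtain ⟨l, hl⟩ := chart_cover (α w)
  rw [taut_pullback_eq_span α w hl, Submodule.mem_span_singleton] at hv
  obtain ⟨a, rfl⟩ := hv
  have h1 : IsUnit (pullbackVec α w hl j) := isUnit_of_mul_isUnit_right hj
  have h2 : IsUnit (germVec (chartVec k l) (α w) hl j) := isUnit_of_map_unit (α.stalkMap w).hom _ h1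
  have h3 : α w ∈ (projSpace k n).left.basicOpen (ratio l (X j) (isHomogeneous_X k j)) :=
    (Scheme.mem_basicOpen _ _ _ hl).mpr h2
  rw [basicOpen_ratio] at h3
  exact h3.2

lemma eq_smul_pullbackVec {v : Fin (n + 1) → W.presheaf.stalk w} {j : Fin (n + 1)}
    (hv : v ∈ (taut k n).pullback α w) (hw : α w ∈ (chart k n j).1) :
    v = v j • pullbackVec α w hw := by
  rw [taut_pullback_eq_span α w hw, Submodule.mem_span_singleton] at hv
  obtain ⟨a, rfl⟩ := hv
  rw [Pi.smul_apply, pullbackVec_self, smul_eq_mul, mul_one]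

lemma stalkMap_germ_ratio {j : Fin (n + 1)} (hw : α w ∈ (chart k n j).1) {d : ℕ}
    (F : MvPolynomial (Fin (n + 1)) k) (hF : F.IsHomogeneous d) :
    (α.stalkMap w).hom ((projSpace k n).left.presheaf.germ _ (α w) hw (ratio j F hF)) =
      F.eval₂ (scalar (α ≫ (projSpace k n).hom) w) (pullbackVec α w hw) := by
  rw [ratio_eq_eval₂]
  have h1 := hom_eval₂ F (sectionScalar (projSpace k n).hom (chart k n j))
    ((projSpace k n).left.presheaf.germ _ (α w) hw).hom (chartVec k j)
  rw [germ_sectionScalar] at h1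
  refine (congrArg (α.stalkMap w).hom h1).trans ?_
  rw [hom_eval₂, stalkMap_scalar]
  rfl

end

/-- The generator of the line with `j`-th entry `1` is unique, so `α` and `β` pull back each `x_i /
x_j` to the same function; with the scalars these generate the functions on the chart. -/
lemma projSpace_hom_ext_of_chart {W : Scheme.{u}} {α β : W ⟶ (projSpace k n).left}
    (h : α ≫ (projSpace k n).hom = β ≫ (projSpace k n).hom)
    (e : (taut k n).pullback α = (taut k n).pullback β) (j : Fin (n + 1))
    (hα : ⊤ ≤ α ⁻¹ᵁ (chart k n j).1) (hβ : ⊤ ≤ β ⁻¹ᵁ (chart k n j).1) : α = β := by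
  refine hom_ext_of_affineOpen (chart k n j).2 hα hβ ?_
  ext a
  obtain ⟨d, F, hF, rfl⟩ := ratio_surjective j a
  have h1 : ∀ i, α.appLE (chart k n j) ⊤ hα (chartVec k j i) =
      β.appLE (chart k n j) ⊤ hβ (chartVec k j i) := by
    intro i
    refine section_ext_germ fun w hw => ?_
    rw [← stalkMap_germ_appLE, ← stalkMap_germ_appLE]
    have hwα : α w ∈ (chart k n j).1 := hα hw
    have hwβ : β w ∈ (chart k n j).1 := hβ hw
    have h2 : pullbackVec α w hwα ∈ (taut k n).pullback β w := by
      rw [← e, taut_pullback_eq_span α w hwα]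
      exact Submodule.mem_span_singleton_self _
    have h3 := eq_smul_pullbackVec h2 hwβ
    rw [pullbackVec_self, one_smul] at h3
    exact congrFun h3 i
  rw [ratio_eq_eval₂]
  refine (hom_eval₂ F (sectionScalar (projSpace k n).hom (chart k n j))
    (α.appLE (chart k n j) ⊤ hα).hom (chartVec k j)).trans ?_
  refine Eq.trans ?_ (hom_eval₂ F (sectionScalar (projSpace k n).hom (chart k n j))
    (β.appLE (chart k n j) ⊤ hβ).hom (chartVec k j)).symm
  rw [appLE_sectionScalar, appLE_sectionScalar, h]
  congr 1
  exact funext h1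

/-- A morphism to `ℙⁿ` is determined by the pullback of the tautological sub-bundle. -/
lemma projSpace_hom_ext {W : Scheme.{u}} {α β : W ⟶ (projSpace k n).left}
    (h : α ≫ (projSpace k n).hom = β ≫ (projSpace k n).hom)
    (e : (taut k n).pullback α = (taut k n).pullback β) : α = β := by
  let U : Fin (n + 1) → W.Opens := fun j => α ⁻¹ᵁ (chart k n j).1
  have hU : IsOpenCover U := by
    refine IsOpenCover.mk (top_le_iff.mp fun w _ => ?_)
    obtain ⟨j, hj⟩ := chart_cover (α w)
    exact Opens.mem_iSup.mpr ⟨j, hj⟩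
  refine hom_ext_of_isOpenCover hU fun j => ?_
  refine projSpace_hom_ext_of_chart (by simp [h]) ?_ j (fun w _ => w.2) fun w _ => ?_
  · rw [StalkFamily.pullback_comp, e, ← StalkFamily.pullback_comp]
  -- `β` goes to the same chart, since the common line contains a vector with `j`-th entry `1`.
  · have hw : α ((U j).ι w) ∈ (chart k n j).1 := w.2
    have h2 : pullbackVec α ((U j).ι w) hw ∈ (taut k n).pullback β ((U j).ι w) := by
      rw [← e, taut_pullback_eq_span α _ hw]
      exact Submodule.mem_span_singleton_self _
    refine mem_chart_of_isUnit (α := β) h2 (j := j) ?_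
    rw [pullbackVec_self]
    exact isUnit_one

/-- Sending `F / x_j ^ d` to `F(f) / f_j ^ d` is a homomorphism on the functions of `D₊(x_j)`, that
is, a morphism to this chart. -/
lemma exists_hom_of_isUnit {W : Scheme.{u}} (s : W ⟶ Spec (CommRingCat.of k))
    (f : Fin (n + 1) → Γ(W, ⊤)) (j : Fin (n + 1)) (hj : IsUnit (f j)) :
    ∃ α : W ⟶ (projSpace k n).left, α ≫ (projSpace k n).hom = s ∧
      ∀ w, (taut k n).pullback α w = Submodule.span _ {germVec f w (Opens.mem_top w)} := by
  let ε : MvPolynomial (Fin (n + 1)) k →+* Γ(W, ⊤) := eval₂Hom (sectionScalar s ⊤) f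
  have hε : IsUnit (ε (X j)) := by simpa [ε] using hj
  obtain ⟨ψ, hψ⟩ : ∃ ψ : Γ((projSpace k n).left, chart k n j) ⟶ Γ(W, ⊤),
      ∀ {d : ℕ} (F : MvPolynomial (Fin (n + 1)) k) (hF : F.IsHomogeneous d),
        ψ (ratio j F hF) * f j ^ d = F.eval₂ (sectionScalar s ⊤) f := by
    refine ⟨CommRingCat.ofHom (R := Γ((projSpace k n).left, chart k n j)) (S := Γ(W, ⊤))
      ((IsLocalization.Away.lift
      (S := Localization.Away (X j : MvPolynomial (Fin (n + 1)) k)) (X j) hε).comp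
        (toLocalization j)), fun {d} F hF => ?_⟩
    have h1 := congrArg (IsLocalization.Away.lift
      (S := Localization.Away (X j : MvPolynomial (Fin (n + 1)) k)) (X j) hε)
      (toLocalization_ratio j F hF)
    rw [map_mul, map_pow, IsLocalization.Away.lift_eq, IsLocalization.Away.lift_eq] at h1
    simp only [ε, coe_eval₂Hom, eval₂_X] at h1
    exact h1
  let α := homOfAffineOpen (chart k n j).2 ψ
  have hα : ⊤ ≤ α ⁻¹ᵁ (chart k n j).1 := top_le_preimage_homOfAffineOpen _ _
  have hαψ : α.appLE (chart k n j) ⊤ hα = ψ := homOfAffineOpen_appLE _ _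
  refine ⟨α, hom_ext_sectionScalar ?_, fun w => ?_⟩
  · rw [← appLE_sectionScalar α _ _ _ hα, hαψ]
    ext c
    change ψ (sectionScalar _ _ c) = _
    rw [sectionScalar_projSpace]
    simpa using hψ (C c) (isHomogeneous_C _ c)
  · rw [taut_pullback_eq_span α w (hα trivial)]
    have h1 : germVec f w (Opens.mem_top w) =
        germVec f w (Opens.mem_top w) j • pullbackVec α w (hα (Opens.mem_top w)) := by
      ext i
      have h2 := hψ (X i) (isHomogeneous_X k i)
      rw [pow_one, eval₂_X] at h2
      have h3 : pullbackVec α w (hα (Opens.mem_top w)) i =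
          W.presheaf.germ ⊤ w (Opens.mem_top w) (ψ (ratio j (X i) (isHomogeneous_X k i))) := by
        refine (stalkMap_germ_appLE α hα w (Opens.mem_top w) _).trans ?_
        rw [hαψ]
      rw [Pi.smul_apply, h3, smul_eq_mul, mul_comm]
      exact (congrArg _ h2.symm).trans (map_mul _ _ _)
    rw [h1]
    have hu : IsUnit (germVec f w (Opens.mem_top w) j) := hj.map _
    exact (Submodule.span_singleton_smul_eq hu _).symm

/-- A family of stalks which locally is generated by a vector of sections with an invertible entry
defines a morphism to `ℙⁿ`. -/
lemma exists_hom_of_local_generators {W : Scheme.{u}} (s : W ⟶ Spec (CommRingCat.of k))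
    (M : StalkFamily W (n + 1))
    (hM : ∀ w, ∃ (V : W.Opens) (f : Fin (n + 1) → Γ(W, V)) (j : Fin (n + 1)), w ∈ V ∧
      IsUnit (f j) ∧ ∀ (z : W) (hz : z ∈ V), M z = Submodule.span _ {germVec f z hz}) :
    ∃ α : W ⟶ (projSpace k n).left, α ≫ (projSpace k n).hom = s ∧ (taut k n).pullback α = M := by
  choose V f j hwV hu hspan using hM
  have hV : IsOpenCover V :=
    IsOpenCover.mk (top_le_iff.mp fun w _ => Opens.mem_iSup.mpr ⟨w, hwV w⟩)
  have hloc : ∀ w, ∃ α : (V w : Scheme.{u}) ⟶ (projSpace k n).left,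
      α ≫ (projSpace k n).hom = (V w).ι ≫ s ∧ (taut k n).pullback α = M.pullback (V w).ι := by
    intro w
    obtain ⟨α, h1, h2⟩ := exists_hom_of_isUnit ((V w).ι ≫ s)
      (fun i => (V w).ι.appLE (V w) ⊤ (fun z _ => z.2) (f w i)) (j w) ((hu w).map _)
    refine ⟨α, h1, funext fun z => ?_⟩
    rw [h2, StalkFamily.pullback_span _ _ _ _ (hspan w ((V w).ι z) z.2)]
    congr 2
    ext i
    exact (stalkMap_germ_appLE (V w).ι (fun z _ => z.2) z (Opens.mem_top z) (f w i)).symm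
  choose α h1 h2 using hloc
  obtain ⟨β, hβ⟩ := exists_hom_of_isOpenCover hV α fun x y T a b hc => by
    refine projSpace_hom_ext ?_ ?_
    · rw [Category.assoc, Category.assoc, h1, h1, ← Category.assoc, ← Category.assoc, hc]
    · rw [StalkFamily.pullback_comp, StalkFamily.pullback_comp, h2, h2,
        ← StalkFamily.pullback_comp, ← StalkFamily.pullback_comp, hc]
  refine ⟨β, hom_ext_of_isOpenCover hV fun x => ?_, funext fun w => ?_⟩
  · rw [← Category.assoc, hβ, h1]
  · refine StalkFamily.eq_of_pullback_ι_eq (V w) ?_ w (hwV w)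
    rw [← StalkFamily.pullback_comp, hβ, h2]

end Proj

end GenericMaps

/-! ### Closed and locally closed subschemes of `ℙⁿ`. -/

namespace GenericMaps

variable {k : Type u} [Field k]

section IdealSheaves

variable {Z : Scheme.{u}} (I : Z.IdealSheafData)

lemma exists_pow_mul_mem_ideal (V : Z.affineOpens) (t a : Γ(Z, V))
    (h : Z.presheaf.map (homOfLE (Z.basicOpen_le t)).op a ∈ I.ideal (Z.affineBasicOpen t)) :
    ∃ N : ℕ, t ^ N * a ∈ I.ideal V := by
  rw [← I.map_ideal_basicOpen] at h
  let : Algebra Γ(Z, V) Γ(Z, Z.basicOpen t) :=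
    (Z.presheaf.map (homOfLE (Z.basicOpen_le t)).op).hom.toAlgebra
  have : IsLocalization.Away t Γ(Z, Z.basicOpen t) := V.2.isLocalization_of_eq_basicOpen _ _ rfl
  obtain ⟨_, ⟨N, rfl⟩, hN⟩ :=
    (IsLocalization.algebraMap_mem_map_algebraMap_iff (.powers t) Γ(Z, Z.basicOpen t) (I.ideal V) a).mp h
  exact ⟨N, hN⟩

/-- Vanishing of an ideal sheaf under `θ` does not depend on the affine neighbourhood of `p`: on a
smaller affine `D` the ideal is generated by that of `U` and contains the restriction of that of
`V`. -/
lemma ideal_le_ker_of_le {U V : Z.affineOpens} {R : Type*} [CommRing R] (p : Z) (hU : p ∈ U.1)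
    (hV : p ∈ V.1) (θ : Z.presheaf.stalk p →+* R)
    (h : ∀ a ∈ I.ideal U, θ (Z.presheaf.germ U.1 p hU a) = 0) :
    ∀ a ∈ I.ideal V, θ (Z.presheaf.germ V.1 p hV a) = 0 := by
  intro a ha
  obtain ⟨D, hD, hpD, hDle⟩ := exists_isAffineOpen_mem_and_subset (x := p) (U := U.1 ⊓ V.1) ⟨hU, hV⟩
  have hDU : D ≤ U.1 := fun z hz => (hDle hz).1
  have hDV : D ≤ V.1 := fun z hz => (hDle hz).2
  have h1 : I.ideal ⟨D, hD⟩ ≤ RingHom.ker (θ.comp (Z.presheaf.germ D p hpD).hom) := by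
    rw [← I.map_ideal (U := ⟨D, hD⟩) (V := U) hDU, Ideal.map_le_iff_le_comap]
    intro b hb
    have := h b hb
    rw [← Z.presheaf.germ_res_apply (homOfLE hDU) p hpD] at this
    exact this
  have h2 := h1 (I.ideal_le_comap_ideal (U := ⟨D, hD⟩) (V := V) hDV ha)
  rw [← Z.presheaf.germ_res_apply (homOfLE hDV) p hpD]
  exact h2

lemma mem_iff_vanishingIdeal (B : Closeds Z) (V : Z.affineOpens) (p : Z) (hp : p ∈ V.1) :
    p ∈ B ↔ ∀ a ∈ (Scheme.IdealSheafData.vanishingIdeal B).ideal V, p ∉ Z.basicOpen a := by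
  have h1 := Scheme.IdealSheafData.mem_support_iff_of_mem
    (I := Scheme.IdealSheafData.vanishingIdeal B) hp
  rw [Scheme.mem_zeroLocus_iff] at h1
  refine Iff.trans ?_ h1
  exact (Set.ext_iff.mp (Scheme.IdealSheafData.coe_support_vanishingIdeal B) p).symm

end IdealSheaves

section Proj
attribute [local instance] MvPolynomial.gradedAlgebra
open MvPolynomial

variable {n : ℕ}

/-- Every section over `D₊(x_j)` of an ideal sheaf on `ℙⁿ` is given by a homogeneous polynomial in
the graded ideal. -/
lemma exists_ratio_mem_ideal (I : (projSpace k n).left.IdealSheafData) (j : Fin (n + 1))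
    (a : Γ((projSpace k n).left, chart k n j)) (ha : a ∈ I.ideal (chart k n j)) :
    ∃ (d : ℕ) (F : MvPolynomial (Fin (n + 1)) k) (hF : F.IsHomogeneous d), ratio j F hF = a ∧
      ∀ l, ratio l F hF ∈ I.ideal (chart k n l) := by
  obtain ⟨e, G, hG, rfl⟩ := ratio_surjective j a
  -- On `D₊(x_l) ∩ D₊(x_j)` one has `G / x_l ^ e = (x_j / x_l) ^ e * (G / x_j ^ e)`, which is in the
  -- ideal; a power of `x_j / x_l` carries this over to the whole chart `l`.
  have h1 : ∀ l, ∃ N : ℕ, ratio l (X j) (isHomogeneous_X k j) ^ N * ratio l G hG ∈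
      I.ideal (chart k n l) := by
    intro l
    apply exists_pow_mul_mem_ideal
    set t := ratio l (X j) (isHomogeneous_X k j) with ht
    have hle : (projSpace k n).left.basicOpen t ≤ (chart k n j).1 := by
      rw [ht, basicOpen_ratio]; exact inf_le_right
    have h2 : (projSpace k n).left.presheaf.map
          (homOfLE ((projSpace k n).left.basicOpen_le t)).op (ratio l G hG) =
        (projSpace k n).left.presheaf.map
          (homOfLE ((projSpace k n).left.basicOpen_le t)).op t ^ e *
        (projSpace k n).left.presheaf.map (homOfLE hle).op (ratio j G hG) := by
      refine section_ext_germ fun p hp => ?_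
      rw [map_mul, map_pow]
      have h4 := (projSpace k n).left.presheaf.germ_res_apply
        (homOfLE ((projSpace k n).left.basicOpen_le t)) p hp
      have h5 := (projSpace k n).left.presheaf.germ_res_apply (homOfLE hle) p hp
      exact (h4 _).trans ((germ_ratio l j G hG p _ _).trans
        (congrArg₂ (fun x y => x ^ e * y) (h4 _) (h5 _)).symm)
    rw [h2]
    refine Ideal.mul_mem_left _ _ ?_
    exact I.ideal_le_comap_ideal
      (U := (projSpace k n).left.affineBasicOpen t) (V := chart k n j) hle ha
  choose N hN using h1
  -- `M` serves all charts at once. Replacing `G` by `x_j ^ M * G` does not change the ratio on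
  -- `D₊(x_j)`, as `x_j / x_j = 1`.
  let M := ∑ l, N l
  have hM : ∀ l, N l ≤ M := fun l => Finset.single_le_sum (fun _ _ => Nat.zero_le _) (Finset.mem_univ l)
  refine ⟨_, _, (isHomogeneous_X_pow j M).mul hG, ?_, fun l => ?_⟩
  · rw [ratio_mul _ (isHomogeneous_X_pow j M) hG, ratio_X_pow, ratio_self, one_pow, one_mul]
  · rw [ratio_mul _ (isHomogeneous_X_pow j M) hG, ratio_X_pow, ← Nat.sub_add_cancel (hM l), pow_add, mul_assoc]
    exact Ideal.mul_mem_left _ _ (hN l)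

/-- A morphism `α` to `ℙⁿ` factors through a closed subscheme if and only if the pullback of the
tautological sub-bundle does so. -/
lemma landsInClosed_taut_pullback_iff (I : (projSpace k n).left.IdealSheafData) {W : Scheme.{u}}
    (α : W ⟶ (projSpace k n).left) :
    LandsInClosed I (α ≫ (projSpace k n).hom) ((taut k n).pullback α) ↔
      ∀ (w : W) (j : Fin (n + 1)) (hw : α w ∈ (chart k n j).1), ∀ a ∈ I.ideal (chart k n j),
        (α.stalkMap w).hom ((projSpace k n).left.presheaf.germ _ (α w) hw a) = 0 := by
  constructor
  · intro h w j hw a ha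
    obtain ⟨d, F, hF, rfl, hFI⟩ := exists_ratio_mem_ideal I j a ha
    rw [stalkMap_germ_ratio]
    refine h d F hF hFI w _ ?_
    rw [taut_pullback_eq_span α w hw]
    exact Submodule.mem_span_singleton_self _
  · intro h d F hF hFI w v hv
    obtain ⟨j, hw⟩ := chart_cover (α w)
    rw [eq_smul_pullbackVec hv hw, eval₂_smul_of_isHomogeneous hF, ← stalkMap_germ_ratio hw F hF,
      h w j hw _ (hFI j), mul_zero]

instance isLocallyNoetherian_projSpace : IsLocallyNoetherian (projSpace k n).left := by
  refine isLocallyNoetherian_of_affine_cover (S := chart k n)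
    (top_le_iff.mp fun p _ => Opens.mem_iSup.mpr (chart_cover p)) fun j => ?_
  refine isNoetherianRing_of_surjective (MvPolynomial (Fin (n + 1)) k) _
    (eval₂Hom (sectionScalar (projSpace k n).hom (chart k n j)) (chartVec k j)) fun a => ?_
  obtain ⟨d, F, hF, rfl⟩ := ratio_surjective j a
  exact ⟨F, (ratio_eq_eval₂ j F hF).symm⟩

/-- An immersion is closed in an open subscheme, and an open immersion into a locally Noetherian
scheme is quasi-compact. With this, `Y` is identified with the part of its scheme-theoretic image
off the boundary. -/
lemma quasiCompact_of_isImmersion {Y P : Scheme.{u}} [IsLocallyNoetherian P] (i : Y ⟶ P)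
    [IsImmersion i] : QuasiCompact i := by
  rw [← i.liftCoborder_ι]
  infer_instance

/-- A morphism to `ℙⁿ` factors through a locally closed subscheme `Y` if it factors through its
scheme-theoretic closure and avoids the boundary of `Y`. -/
lemma exists_lift_of_landsInClosed {Y : Sch k} (i : Y ⟶ projSpace k n) [IsImmersion i.left]
    {W : Scheme.{u}} (α : W ⟶ (projSpace k n).left)
    (h : LandsInClosed i.left.ker (α ≫ (projSpace k n).hom) ((taut k n).pullback α))
    (hα : ∀ w, α w ∈ i.left.coborderRange) : ∃ φ : W ⟶ Y.left, φ ≫ i.left = α := by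
  have := quasiCompact_of_isImmersion i.left
  rw [landsInClosed_taut_pullback_iff] at h
  have hker : i.left.imageι.ker ≤ α.ker := by
    rw [Scheme.Hom.imageι, Scheme.IdealSheafData.ker_subschemeι]
    refine Scheme.IdealSheafData.le_ofIdeals_iff.mpr fun V a ha => ?_
    refine section_ext_germ fun w hw => ?_
    rw [map_zero]
    refine (Scheme.Hom.germ_stalkMap_apply α V.1 w hw a).symm.trans ?_
    obtain ⟨j, hj⟩ := chart_cover (α w)
    exact ideal_le_ker_of_le i.left.ker (α w) hj hw (α.stalkMap w).hom (h w j hj) a ha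
  -- `Y` is the fibre product of its scheme-theoretic image and the complement of its boundary, so
  -- the two factorizations of `α` combine.
  have hpb := IsImmersion.isPullback_toImage_liftCoborder i.left
  have hrange : Set.range α ⊆ Set.range i.left.coborderRange.ι := by
    rw [Scheme.Opens.range_ι]
    exact Set.range_subset_iff.mpr hα
  obtain ⟨φ, hφ, -⟩ := hpb.exists_lift (IsClosedImmersion.lift i.left.imageι α hker)
    (IsOpenImmersion.lift i.left.coborderRange.ι α hrange)
    (by rw [IsClosedImmersion.lift_fac, IsOpenImmersion.lift_fac])
  refine ⟨φ, ?_⟩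
  have h1 := congrArg (φ ≫ ·) i.left.toImage_imageι
  rw [← h1, ← Category.assoc, hφ, IsClosedImmersion.lift_fac]

end Proj

end GenericMaps

/-! ### Regularity domains, and propagation from a fibrewise dense open. -/

namespace GenericMaps

variable {k : Type u} [Field k]

lemma stalkMap_eval₂ {W Z : Scheme.{u}} (G : W ⟶ Z) (s : Z ⟶ Spec (CommRingCat.of k)) (w : W)
    {m : ℕ} (v : Fin m → Z.presheaf.stalk (G w)) (F : MvPolynomial (Fin m) k) :
    (G.stalkMap w).hom (F.eval₂ (scalar s (G w)) v) =
      F.eval₂ (scalar (G ≫ s) w) (stalkVec m G w v) := by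
  rw [MvPolynomial.hom_eval₂, stalkMap_scalar]
  rfl

section Regular

variable {Z S : Scheme.{u}} {m : ℕ} {p : Z ⟶ S} {L : StalkFamily Z m}

lemma IsRegularAt.pullback {Z' : Scheme.{u}} (G : Z' ⟶ Z) {z : Z'} (h : IsRegularAt L (G z)) :
    IsRegularAt (L.pullback G) z := by
  obtain ⟨v, hv, j, hj⟩ := h
  exact ⟨stalkVec m G z v, Submodule.subset_span ⟨v, hv, rfl⟩, j, hj.map (G.stalkMap z).hom⟩

lemma isRegularAt_iff_of_span {V : Z.Opens} {f : Fin m → Γ(Z, V)} {z : Z} (hz : z ∈ V)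
    (h : L z = Submodule.span _ {germVec f z hz}) :
    IsRegularAt L z ↔ ∃ j, z ∈ Z.basicOpen (f j) := by
  constructor
  · rintro ⟨v, hv, j, hj⟩
    rw [h, Submodule.mem_span_singleton] at hv
    obtain ⟨a, rfl⟩ := hv
    exact ⟨j, (Scheme.mem_basicOpen _ _ _ hz).mpr (isUnit_of_mul_isUnit_right hj)⟩
  · rintro ⟨j, hj⟩
    refine ⟨germVec f z hz, ?_, j, (Scheme.mem_basicOpen _ _ _ hz).mp hj⟩
    rw [h]
    exact Submodule.mem_span_singleton_self _

lemma IsFlatInvertible.exists_generator (hL : IsFlatInvertible p L) (z : Z) :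
    ∃ (V : Z.Opens) (f : Fin m → Γ(Z, V)), z ∈ V ∧
      ∀ (w : Z) (hw : w ∈ V), L w = Submodule.span _ {germVec f w hw} := by
  obtain ⟨V, f, -, hz, h, -⟩ := hL z
  exact ⟨V, f, hz, h⟩

/-- The regularity domain of an invertible subsheaf. -/
def IsFlatInvertible.regularLocus (hL : IsFlatInvertible p L) : Z.Opens where
  carrier := {z | IsRegularAt L z}
  is_open' := by
    refine isOpen_iff_mem_nhds.mpr fun z hz => ?_
    obtain ⟨V, f, hzV, h⟩ := hL.exists_generator z
    obtain ⟨j, hj⟩ := (isRegularAt_iff_of_span hzV (h z hzV)).mp hz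
    refine Filter.mem_of_superset ((Z.basicOpen (f j)).2.mem_nhds hj) fun w hw => ?_
    have hwV : w ∈ V := Z.basicOpen_le _ hw
    exact (isRegularAt_iff_of_span hwV (h w hwV)).mpr ⟨j, hw⟩

/-- Freeness of the generator forces some coordinate to be nonzero, and a nonzero function on an
integral scheme is invertible somewhere. -/
lemma IsFlatInvertible.exists_isRegularAt [IsIntegral Z] (hL : IsFlatInvertible p L) :
    ∃ z, IsRegularAt L z := by
  obtain ⟨V, f, hV, hz, h, hfree, -⟩ := hL (genericPoint Z)
  have : Nonempty V := ⟨⟨_, hz⟩⟩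
  have hj : ∃ j, f j ≠ 0 := by
    by_contra! hf
    exact one_ne_zero (hfree 1 fun j => by rw [hf j, mul_zero])
  obtain ⟨j, hj⟩ := hj
  have hne : Z.basicOpen (f j) ≠ ⊥ := fun h0 => hj ((basicOpen_eq_bot_iff _).mp h0)
  obtain ⟨w, hw⟩ := (Opens.ne_bot_iff_nonempty _).mp hne
  have hwV : w ∈ V := Z.basicOpen_le _ hw
  exact ⟨w, (isRegularAt_iff_of_span hwV (h w hwV)).mpr ⟨j, hw⟩⟩

/-- Over its regularity domain, an invertible subsheaf of `𝒪^{n+1}` defines a morphism to `ℙⁿ`. -/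
lemma IsFlatInvertible.exists_hom {n : ℕ} {L : StalkFamily Z (n + 1)} (hL : IsFlatInvertible p L)
    (s : Z ⟶ Spec (CommRingCat.of k)) :
    ∃ α : (hL.regularLocus : Scheme.{u}) ⟶ (projSpace k n).left,
      α ≫ (projSpace k n).hom = hL.regularLocus.ι ≫ s ∧
      (taut k n).pullback α = L.pullback hL.regularLocus.ι := by
  set R := hL.regularLocus
  refine exists_hom_of_local_generators (R.ι ≫ s) (L.pullback R.ι) fun w => ?_
  obtain ⟨V, f, hzV, h⟩ := hL.exists_generator (R.ι w)
  obtain ⟨j, hj⟩ := (isRegularAt_iff_of_span hzV (h _ hzV)).mp w.2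
  set D := Z.basicOpen (f j)
  have hDV : D ≤ V := Z.basicOpen_le _
  refine ⟨R.ι ⁻¹ᵁ D, fun i => R.ι.app D (Z.presheaf.map (homOfLE hDV).op (f i)), j, hj, ?_, ?_⟩
  · exact (RingedSpace.isUnit_res_basicOpen Z.toRingedSpace (f j)).map _
  · intro z hz
    rw [StalkFamily.pullback_span R.ι L z _ (h (R.ι z) (hDV hz))]
    congr 2
    rw [← stalkVec_germVec R.ι _ z hz]
    congr 1
    ext i
    exact (Z.presheaf.germ_res_apply (homOfLE hDV) (R.ι z) hz (f i)).symm

end Regular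

section Density

variable {Z S : Scheme.{u}} (p : Z ⟶ S) [IsAffine S] [IsLocallyNoetherian S]
  [GeometricallyIntegral p] [Flat p] [UniversallyOpen p]

lemma germ_eval₂ {n : ℕ} (s : Z ⟶ Spec (CommRingCat.of k)) {V : Z.Opens}
    (f : Fin (n + 1) → Γ(Z, V)) (F : MvPolynomial (Fin (n + 1)) k) (z : Z) (hz : z ∈ V) :
    Z.presheaf.germ V z hz (F.eval₂ (sectionScalar s V) f) =
      F.eval₂ (scalar s z) (germVec f z hz) := by
  refine (MvPolynomial.hom_eval₂ F (sectionScalar s V) (Z.presheaf.germ V z hz).hom f).trans ?_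
  rw [germ_sectionScalar]
  rfl

/-- Evaluating `F` on a local generator gives a function vanishing on `U`, hence zero by schematic
density. -/
lemma IsFlatInvertible.landsInClosed_of_surjective {n : ℕ} {L : StalkFamily Z (n + 1)}
    (hL : IsFlatInvertible p L) {U : Z.Opens} (hU : ∀ s, ∃ z ∈ U, p z = s)
    (I : (projSpace k n).left.IdealSheafData) (s : Z ⟶ Spec (CommRingCat.of k))
    (h : LandsInClosed I (U.ι ≫ s) (L.pullback U.ι)) : LandsInClosed I s L := by
  intro d F hF hI z v hv
  obtain ⟨V, f, hzV, hf⟩ := hL.exists_generator z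
  have h0 : F.eval₂ (sectionScalar s V) f = 0 := by
    refine section_eq_zero_of_surjective p hU _ fun w hw hwU => ?_
    rw [germ_eval₂]
    let w' : (U : Scheme.{u}) := ⟨w, hwU⟩
    have : IsIso (U.ι.stalkMap w') := inferInstance
    apply (ConcreteCategory.bijective_of_isIso (U.ι.stalkMap w')).1
    refine Eq.trans ?_ (map_zero (U.ι.stalkMap w').hom).symm
    refine (stalkMap_eval₂ U.ι s w' (germVec f (U.ι w') hw) F).trans ?_
    refine h d F hF hI w' (stalkVec (n + 1) U.ι w' (germVec f w hw))
      (Submodule.subset_span ⟨_, ?_, rfl⟩)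
    change _ ∈ L w
    rw [hf w hw]
    exact Submodule.mem_span_singleton_self _
  rw [hf z hzV, Submodule.mem_span_singleton] at hv
  obtain ⟨a, rfl⟩ := hv
  rw [eval₂_smul_of_isHomogeneous hF, ← germ_eval₂, h0, map_zero, mul_zero]

/-- Agreement of the lines on `U` makes the 2 × 2 minors of two local generators vanish there, hence
everywhere by density. At a point where both generators have an invertible entry, vanishing minors
make each a multiple of the other. -/
lemma GenericallyAgree.of_surjective {m : ℕ} {L L' : StalkFamily Z m}
    (hL : IsFlatInvertible p L) (hL' : IsFlatInvertible p L') {U : Z.Opens}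
    (hU : ∀ s, ∃ z ∈ U, p z = s) (h : ∀ z ∈ U, L z = L' z) : GenericallyAgree L L' := by
  intro z hz hz'
  obtain ⟨V, f, hzV, hf⟩ := hL.exists_generator z
  obtain ⟨V', f', hzV', hf'⟩ := hL'.exists_generator z
  have key : ∀ a b, germVec f z hzV a * germVec f' z hzV' b =
      germVec f z hzV b * germVec f' z hzV' a := by
    intro a b
    let ρ := Z.presheaf.map (homOfLE (inf_le_left : V ⊓ V' ≤ V)).op
    let ρ' := Z.presheaf.map (homOfLE (inf_le_right : V ⊓ V' ≤ V')).op
    have hρ : ∀ w (hw : w ∈ V ⊓ V') c, Z.presheaf.germ _ w hw (ρ (f c)) = germVec f w hw.1 c :=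
      fun w hw c => Z.presheaf.germ_res_apply (homOfLE _) w hw (f c)
    have hρ' : ∀ w (hw : w ∈ V ⊓ V') c, Z.presheaf.germ _ w hw (ρ' (f' c)) = germVec f' w hw.2 c :=
      fun w hw c => Z.presheaf.germ_res_apply (homOfLE _) w hw (f' c)
    have h0 : ρ (f a) * ρ' (f' b) - ρ (f b) * ρ' (f' a) = 0 := by
      refine section_eq_zero_of_surjective p hU _ fun w hw hwU => ?_
      rw [map_sub, map_mul, map_mul, hρ, hρ, hρ', hρ']
      have h1 : germVec f w hw.1 ∈ L' w := by
        rw [← h w hwU, hf w hw.1]; exact Submodule.mem_span_singleton_self _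
      rw [hf' w hw.2, Submodule.mem_span_singleton] at h1
      obtain ⟨c, hc⟩ := h1
      rw [← hc, Pi.smul_apply, Pi.smul_apply, smul_eq_mul, smul_eq_mul]
      ring
    have hzz : z ∈ V ⊓ V' := ⟨hzV, hzV'⟩
    have h1 := congrArg (Z.presheaf.germ (V ⊓ V') z hzz) h0
    rw [map_sub, map_mul, map_mul, hρ, hρ, hρ', hρ', map_zero, sub_eq_zero] at h1
    exact h1
  obtain ⟨j, hj⟩ := (isRegularAt_iff_of_span hzV (hf z hzV)).mp hz
  obtain ⟨l, hl⟩ := (isRegularAt_iff_of_span hzV' (hf' z hzV')).mp hz'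
  have hj' : IsUnit (germVec f z hzV j) := (Scheme.mem_basicOpen _ _ _ hzV).mp hj
  have hl' : IsUnit (germVec f' z hzV' l) := (Scheme.mem_basicOpen _ _ _ hzV').mp hl
  obtain ⟨c, hc⟩ := hj'.exists_right_inv
  obtain ⟨c', hc'⟩ := hl'.exists_right_inv
  rw [hf z hzV, hf' z hzV']
  apply le_antisymm
  · rw [Submodule.span_singleton_le_iff_mem, Submodule.mem_span_singleton]
    refine ⟨germVec f z hzV l * c', funext fun b => ?_⟩
    rw [Pi.smul_apply, smul_eq_mul]
    linear_combination (-c') * key b l + germVec f z hzV b * hc'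
  · rw [Submodule.span_singleton_le_iff_mem, Submodule.mem_span_singleton]
    refine ⟨germVec f' z hzV' j * c, funext fun b => ?_⟩
    rw [Pi.smul_apply, smul_eq_mul]
    linear_combination c * key b j + germVec f' z hzV' b * hc

end Density

/-- On an integral scheme, an invertible subsheaf whose associated rational map to `ℙⁿ` has its
image in a closed subset is a quasi-map to that closed subset. -/
lemma IsFlatInvertible.landsInClosed_vanishingIdeal {Z S : Scheme.{u}} [IsIntegral Z] {p : Z ⟶ S}
    {n : ℕ} {L : StalkFamily Z (n + 1)} (hL : IsFlatInvertible p L)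
    (s : Z ⟶ Spec (CommRingCat.of k)) (B : Closeds (projSpace k n).left) {R : Z.Opens} {z₀ : Z}
    (hz₀ : z₀ ∈ R) (α : (R : Scheme.{u}) ⟶ (projSpace k n).left)
    (hα : α ≫ (projSpace k n).hom = R.ι ≫ s) (e : (taut k n).pullback α = L.pullback R.ι)
    (hB : ∀ w, α w ∈ B) : LandsInClosed (Scheme.IdealSheafData.vanishingIdeal B) s L := by
  intro d F hF hI z v hv
  obtain ⟨V, f, hzV, hf⟩ := hL.exists_generator z
  have h0 : F.eval₂ (sectionScalar s V) f = 0 := by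
    -- If `F` of the generator is nonzero, irreducibility gives a point `y` of `R` where it is
    -- invertible. Then some `F / x_j ^ d` is invertible at the image of `y`, although it vanishes
    -- on `B`.
    by_contra hne
    have hne' : Z.basicOpen (F.eval₂ (sectionScalar s V) f) ≠ ⊥ :=
      fun h0 => hne ((basicOpen_eq_bot_iff _).mp h0)
    obtain ⟨w, hw⟩ := (Opens.ne_bot_iff_nonempty _).mp hne'
    obtain ⟨y, hyR, hy⟩ := nonempty_preirreducible_inter R.2
      (Z.basicOpen (F.eval₂ (sectionScalar s V) f)).2 ⟨z₀, hz₀⟩ ⟨w, hw⟩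
    have hyV : y ∈ V := Z.basicOpen_le _ hy
    let y' : (R : Scheme.{u}) := ⟨y, hyR⟩
    have hu : IsUnit (F.eval₂ (scalar s y) (germVec f y hyV)) := by
      rw [← germ_eval₂]
      exact (Scheme.mem_basicOpen _ _ _ hyV).mp hy
    have hu' : IsUnit (F.eval₂ (scalar (R.ι ≫ s) y') (stalkVec (n + 1) R.ι y' (germVec f y hyV))) := by
      have h1 := hu.map (R.ι.stalkMap y').hom
      have h2 := stalkMap_eval₂ R.ι s y' (germVec f (R.ι y') hyV) F
      exact h2 ▸ h1
    obtain ⟨j, hj⟩ := chart_cover (α y')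
    have hmem : stalkVec (n + 1) R.ι y' (germVec f y hyV) ∈ (taut k n).pullback α y' := by
      rw [e]
      refine Submodule.subset_span ⟨_, ?_, rfl⟩
      change _ ∈ L y
      rw [hf y hyV]
      exact Submodule.mem_span_singleton_self _
    rw [eq_smul_pullbackVec hmem hj, eval₂_smul_of_isHomogeneous hF, ← hα,
      ← stalkMap_germ_ratio hj F hF] at hu'
    have h2 := isUnit_of_map_unit (α.stalkMap y').hom _ (isUnit_of_mul_isUnit_right hu')
    exact (mem_iff_vanishingIdeal B (chart k n j) (α y') hj).mp (hB y') _ (hI j)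
      ((Scheme.mem_basicOpen _ _ _ hj).mpr h2)
  rw [hf z hzV, Submodule.mem_span_singleton] at hv
  obtain ⟨a, rfl⟩ := hv
  rw [eval₂_smul_of_isHomogeneous hF, ← germ_eval₂, h0, map_zero, mul_zero]

end GenericMaps

/-! ### Quasi-maps and the generic maps they present. -/

namespace GenericMaps

variable {k : Type u} [Field k]

lemma isLocallyNoetherian_left (S : Aff k) : IsLocallyNoetherian S.obj.left := by
  have := S.property.2
  exact LocallyOfFiniteType.isLocallyNoetherian S.obj.hom

/-- The closure of a point of `S`, with its reduced structure. -/
lemma exists_integral_hom_specializes (S : Aff k) (s : S.obj.left) :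
    ∃ (T : Aff k) (g : T ⟶ S), IsIntegral T.obj.left ∧ ∀ t, s ⤳ g.hom.left t := by
  have := S.property.1
  have := S.property.2
  let P := (S.obj.left.isoSpec.hom s).asIdeal
  let R' : CommRingCat := .of (Γ(S.obj.left, ⊤) ⧸ P)
  let φ : Γ(S.obj.left, ⊤) ⟶ R' := CommRingCat.ofHom (Ideal.Quotient.mk P)
  let g : Spec R' ⟶ S.obj.left := Spec.map φ ≫ S.obj.left.isoSpec.inv
  have : P.IsPrime := (S.obj.left.isoSpec.hom s).isPrime
  have : IsDomain R' := inferInstanceAs (IsDomain (Γ(S.obj.left, ⊤) ⧸ P))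
  have : IsClosedImmersion (Spec.map φ) :=
    IsClosedImmersion.spec_of_surjective φ Ideal.Quotient.mk_surjective
  let T : Aff k := ⟨Over.mk (g ≫ S.obj.hom), inferInstanceAs (IsAffine (Spec R')),
    inferInstanceAs (LocallyOfFiniteType (g ≫ S.obj.hom))⟩
  refine ⟨T, ⟨Over.homMk g rfl⟩, inferInstanceAs (IsIntegral (Spec R')), fun t => ?_⟩
  change s ⤳ S.obj.left.isoSpec.inv (Spec.map φ t)
  have h1 : s = S.obj.left.isoSpec.inv (S.obj.left.isoSpec.hom s) := by
    rw [← Scheme.Hom.comp_apply, Iso.hom_inv_id]; rfl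
  rw [h1]
  refine Specializes.map ?_ S.obj.left.isoSpec.inv.continuous
  refine (PrimeSpectrum.le_iff_specializes _ _).mp ?_
  intro a ha
  change φ.hom a ∈ t.asIdeal
  rw [show φ.hom a = 0 from Ideal.Quotient.eq_zero_iff_mem.mpr ha]
  exact zero_mem _

lemma isIntegral_prodOver {X : Sch k} [Flat X.hom] [UniversallyOpen X.hom]
    [GeometricallyIntegral X.hom] (T : Aff k) [IsIntegral T.obj.left] :
    IsIntegral (prodOver T.obj X) := by
  have := isLocallyNoetherian_left T
  infer_instance

variable {X : Sch k} {n : ℕ} {Y : Sch k} {i : Y ⟶ projSpace k n}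

lemma Presents.taut_pullback {S : Sch k} {L : StalkFamily (prodOver S X) (n + 1)}
    {φ : GenMap X Y S} (h : Presents i L φ) {W : (prodOver S X).Opens} (hW : W ≤ φ.dom) :
    (taut k n).pullback ((prodOver S X).homOfLE hW ≫ φ.hom ≫ i.left) = L.pullback W.ι := by
  rw [StalkFamily.pullback_comp, h.2, ← StalkFamily.pullback_comp, Scheme.homOfLE_ι]

lemma Presents.pullback {S T : Sch k} {L : StalkFamily (prodOver S X) (n + 1)}
    {φ : GenMap X Y S} (h : Presents i L φ) (g : T ⟶ S) :
    Presents i (L.pullback (prodMap g X)) (φ.pullback g) := by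
  refine ⟨fun z hz => (h.1 _ hz).pullback _, ?_⟩
  rw [← StalkFamily.pullback_comp]
  change (taut k n).pullback ((prodMap g X ∣_ φ.dom ≫ φ.hom) ≫ i.left) =
    L.pullback ((prodMap g X ⁻¹ᵁ φ.dom).ι ≫ prodMap g X)
  rw [← morphismRestrict_ι, Category.assoc, StalkFamily.pullback_comp, h.2,
    ← StalkFamily.pullback_comp]

lemma GenMap.hom_comp_str {S : Sch k} (φ : GenMap X Y S) {W : (prodOver S X).Opens}
    (hW : W ≤ φ.dom) :
    ((prodOver S X).homOfLE hW ≫ φ.hom ≫ i.left) ≫ (projSpace k n).hom = W.ι ≫ prodStr S X := by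
  rw [Category.assoc, Category.assoc, Over.w i, φ.w, Scheme.homOfLE_ι_assoc]

section
variable [Flat X.hom] [UniversallyOpen X.hom] [GeometricallyIntegral X.hom]

/-- Where the two maps agree, both subsheaves pull back to the same tautological line; this open
meets every fibre, and agreement spreads by density. -/
lemma Presents.genericallyAgree_of_equiv {S : Aff k} {L L' : StalkFamily (prodOver S.obj X) (n + 1)}
    (hL : IsFlatInvertible (pullback.fst S.obj.hom X.hom) L)
    (hL' : IsFlatInvertible (pullback.fst S.obj.hom X.hom) L')
    {φ φ' : GenMap X Y S.obj} (h : Presents i L φ) (h' : Presents i L' φ') (e : φ ≈ φ') :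
    GenericallyAgree L L' := by
  have := S.property.1
  have := isLocallyNoetherian_left S
  obtain ⟨W, hW, hW', hdom, e⟩ := e
  refine GenericallyAgree.of_surjective _ hL hL' (isDomainFamily_iff.mp hdom) ?_
  refine StalkFamily.eq_of_pullback_ι_eq W ?_
  rw [← h.taut_pullback hW, ← h'.taut_pullback hW', ← Category.assoc, e, Category.assoc]

end

variable [IsImmersion i.left]

/-- Generically defined maps presented by the same generic sub-bundle agree. -/
lemma Presents.equiv_of_genericallyAgree {S : Sch k} {L L' : StalkFamily (prodOver S X) (n + 1)}
    {φ φ' : GenMap X Y S} (h : Presents i L φ) (h' : Presents i L' φ') (e : GenericallyAgree L L') :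
    φ ≈ φ' := by
  refine ⟨φ.dom ⊓ φ'.dom, inf_le_left, inf_le_right, φ.isDomainFamily.inf φ'.isDomainFamily, ?_⟩
  rw [← cancel_mono i.left, Category.assoc, Category.assoc]
  refine projSpace_hom_ext ?_ ?_
  · rw [φ.hom_comp_str, φ'.hom_comp_str]
  · rw [h.taut_pullback, h'.taut_pullback]
    funext w
    have hw : L ((φ.dom ⊓ φ'.dom).ι w) = L' ((φ.dom ⊓ φ'.dom).ι w) :=
      e _ (h.1 _ w.2.1) (h'.1 _ w.2.2)
    exact le_antisymm (StalkFamily.pullback_mono_at _ _ hw.le)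
      (StalkFamily.pullback_mono_at _ _ hw.ge)

variable [Flat X.hom] [UniversallyOpen X.hom] [GeometricallyIntegral X.hom]

/-- The equations of the closure hold on the domain of `φ`, because `φ` maps to `Y`, and they spread
by density. After any base change to a nonempty `T` some point of the domain remains; its image lies
in `Y`, so a section of the boundary ideal is invertible there. -/
lemma Presents.isQuasiMap {S : Aff k} {L : StalkFamily (prodOver S.obj X) (n + 1)}
    (hL : IsFlatInvertible (pullback.fst S.obj.hom X.hom) L) {φ : GenMap X Y S.obj}
    (h : Presents i L φ) : IsQuasiMap X i S L where
  flatInvertible := hL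
  landsInClosure := by
    have := S.property.1
    have := isLocallyNoetherian_left S
    refine hL.landsInClosed_of_surjective _ (isDomainFamily_iff.mp φ.isDomainFamily) _ _ ?_
    have h1 : (φ.hom ≫ i.left) ≫ (projSpace k n).hom = φ.dom.ι ≫ prodStr S.obj X := by
      rw [Category.assoc, Over.w i, φ.w]
    rw [← h.2, ← h1, landsInClosed_taut_pullback_iff]
    intro w j hw a ha
    have h2 := i.left.ideal_ker_le _ ha
    have h3 : i.left.app (chart k n j) a = 0 := h2
    have h4 : (φ.hom ≫ i.left).app (chart k n j) a = 0 := by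
      rw [Scheme.Hom.comp_app]
      exact (congrArg (φ.hom.app _) h3).trans (map_zero _)
    refine (Scheme.Hom.germ_stalkMap_apply _ _ w hw a).trans ?_
    exact (congrArg _ h4).trans (map_zero _)
  avoidsBoundary T g hT hland := by
    obtain ⟨t⟩ := hT
    have := S.property.1
    have := T.property.1
    have hLT := hL.pullback (prodMap_isPullback g.hom X)
    have hT := h.pullback g.hom
    set L' := L.pullback (prodMap g.hom X)
    set ψ := φ.pullback g.hom
    obtain ⟨z, hz, -⟩ := isDomainFamily_iff.mp ψ.isDomainFamily t
    have h1 : (ψ.hom ≫ i.left) ≫ (projSpace k n).hom = ψ.dom.ι ≫ prodStr T.obj X := by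
      rw [Category.assoc, Over.w i, ψ.w]
    have hland' := hland.pullback hLT ψ.dom.ι
    rw [← hT.2, ← h1, landsInClosed_taut_pullback_iff] at hland'
    let w : (ψ.dom : Scheme.{u}) := ⟨z, hz⟩
    obtain ⟨j, hj⟩ := chart_cover ((ψ.hom ≫ i.left) w)
    have hB : (ψ.hom ≫ i.left) w ∉ boundary i := by
      intro hB
      exact hB (subset_coborder ⟨ψ.hom w, rfl⟩)
    rw [mem_iff_vanishingIdeal _ (chart k n j) _ hj] at hB
    push Not at hB
    obtain ⟨a, ha, haw⟩ := hB
    have h2 := ((Scheme.mem_basicOpen _ _ _ hj).mp haw).map ((ψ.hom ≫ i.left).stalkMap w).hom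
    rw [hland' w j hj a ha] at h2
    exact not_isUnit_zero h2

/-- Every quasi-map presents a generically defined map. -/
lemma IsQuasiMap.exists_presents {S : Aff k} {L : StalkFamily (prodOver S.obj X) (n + 1)}
    (hq : IsQuasiMap X i S L) : ∃ φ : GenMap X Y S.obj, Presents i L φ := by
  have := S.property.1
  have := isLocallyNoetherian_left S
  obtain ⟨R, hR, α, hα, hαL⟩ : ∃ (R : (prodOver S.obj X).Opens) (_ : ∀ z, z ∈ R ↔ IsRegularAt L z)
      (α : (R : Scheme.{u}) ⟶ (projSpace k n).left),
      α ≫ (projSpace k n).hom = R.ι ≫ prodStr S.obj X ∧ (taut k n).pullback α = L.pullback R.ι :=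
    ⟨hq.flatInvertible.regularLocus, fun _ => Iff.rfl, hq.flatInvertible.exists_hom _⟩
  -- The points of the regularity domain not sent to the boundary.
  let U : (prodOver S.obj X).Opens := R.ι ''ᵁ (α ⁻¹ᵁ i.left.coborderRange)
  have hUR : U ≤ R := by
    rintro _ ⟨w, -, rfl⟩
    exact w.2
  have hU : ∀ w, R.ι w ∈ U ↔ α w ∈ i.left.coborderRange := by
    intro w
    constructor
    · rintro ⟨w', hw', e⟩
      rwa [← R.ι.isOpenEmbedding.injective e]
    · intro h
      exact ⟨w, h, rfl⟩
  let β := (prodOver S.obj X).homOfLE hUR ≫ α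
  have hβ : β ≫ (projSpace k n).hom = U.ι ≫ prodStr S.obj X := by
    rw [Category.assoc, hα, Scheme.homOfLE_ι_assoc]
  have hβL : (taut k n).pullback β = L.pullback U.ι := by
    rw [StalkFamily.pullback_comp, hαL, ← StalkFamily.pullback_comp, Scheme.homOfLE_ι]
  obtain ⟨φ, hφ⟩ := exists_lift_of_landsInClosed i β (by
    rw [hβ, hβL]
    exact hq.landsInClosure.pullback hq.flatInvertible U.ι) fun w => by
      refine (hU ((prodOver S.obj X).homOfLE hUR w)).mp ?_
      rw [← Scheme.Hom.comp_apply, Scheme.homOfLE_ι]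
      exact w.2
  have hdom : IsDomainFamily U := by
    rw [isDomainFamily_iff]
    -- Suppose `U` misses the fibre over `s`. Its image in `S` is open, so it contains no
    -- specialization of `s`, and `U` has empty preimage over the reduced closure `T` of `s`. The
    -- map over `T` thus goes to the boundary; as `T × X` is integral, the base change of `L` is a
    -- quasi-map to the boundary.
    by_contra! hs
    obtain ⟨s, hs⟩ := hs
    obtain ⟨T, g, hT, hsg⟩ := exists_integral_hom_specializes S s
    have := T.property.1
    have := isIntegral_prodOver (X := X) T
    have hLT := hq.flatInvertible.pullback (prodMap_isPullback g.hom X)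
    set G := prodMap g.hom X
    set RT := hLT.regularLocus with hRT
    obtain ⟨z₀, hz₀⟩ := hLT.exists_isRegularAt
    have hrange : Set.range (RT.ι ≫ G) ⊆ Set.range R.ι := by
      rw [Scheme.Opens.range_ι]
      rintro _ ⟨w, rfl⟩
      exact (hR _).mpr <| IsRegularAt.of_pullback hq.flatInvertible G (z := RT.ι w) w.2
    let γ : (RT : Scheme.{u}) ⟶ R := IsOpenImmersion.lift R.ι (RT.ι ≫ G) hrange
    have hγ : γ ≫ R.ι = RT.ι ≫ G := IsOpenImmersion.lift_fac _ _ _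
    refine hq.avoidsBoundary T g inferInstance (hLT.landsInClosed_vanishingIdeal (prodStr T.obj X)
      (boundary i) (R := RT) hz₀ (γ ≫ α) ?_ ?_ fun w hw => ?_)
    · rw [Category.assoc, hα, ← Category.assoc, hγ, Category.assoc, prodMap_str]
    · rw [StalkFamily.pullback_comp, hαL, ← StalkFamily.pullback_comp, hγ,
        StalkFamily.pullback_comp]
    · have hzU : R.ι (γ w) ∈ U := (hU _).mpr hw
      have h1 : pullback.fst S.obj.hom X.hom (R.ι (γ w)) =
          g.hom.left (pullback.fst T.obj.hom X.hom (RT.ι w)) := by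
        have h2 : γ ≫ R.ι ≫ pullback.fst S.obj.hom X.hom =
            RT.ι ≫ pullback.fst T.obj.hom X.hom ≫ g.hom.left := by
          rw [← Category.assoc, hγ, Category.assoc, prodMap_fst]
        exact congrArg (fun (f : (RT : Scheme.{u}) ⟶ S.obj.left) => f w) h2
      have hopen := (pullback.fst S.obj.hom X.hom).isOpenMap _ U.2
      obtain ⟨z, hz, hzs⟩ := (hsg (pullback.fst T.obj.hom X.hom (RT.ι w))).mem_open hopen
        ⟨_, hzU, h1⟩
      exact hs z hz hzs
  refine ⟨⟨U, hdom, φ, ?_⟩, fun z hz => (hR z).mp (hUR hz), ?_⟩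
  · rw [← Over.w i, ← Category.assoc, hφ, hβ]
  · change (taut k n).pullback (φ ≫ i.left) = L.pullback U.ι
    rw [hφ, hβL]

end GenericMaps

/-! ### The maps `η` and `Φ`, and sheafification. -/

namespace GenericMaps

variable {k : Type u} [Field k]

lemma IsAssociatedMap.app_eq {X : Sch k} {n : ℕ} {Y : Sch k} {i : Y ⟶ projSpace k n}
    [IsImmersion i.left] {η : QMap X i ⟶ GMap X Y} (h : IsAssociatedMap i η)
    {S : (Aff k)ᵒᵖ} {q : (QMap X i).obj S} {φ : GenMap X Y S.unop.obj} (hφ : Presents i q.1 φ) :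
    η.app S q = Quotient.mk _ φ := by
  obtain ⟨ψ, hψ, e⟩ := h S q
  rw [e]
  exact Quotient.sound (hψ.equiv_of_genericallyAgree hφ fun _ _ _ => rfl)

variable (X : Sch k) [Flat X.hom] [UniversallyOpen X.hom] [GeometricallyIntegral X.hom]
  {n : ℕ} {Y : Sch k} (i : Y ⟶ projSpace k n) [IsImmersion i.left]

lemma equivalence_relE (S : (Aff k)ᵒᵖ) : Equivalence (relE X i S) where
  refl _ _ _ _ := rfl
  symm h z hz hz' := (h z hz' hz).symm
  -- `q₂` need not be regular wherever `q₁` and `q₃` both are, so transitivity is borrowed from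
  -- equality of the generic maps presented.
  trans {q₁ q₂ q₃} h h' := by
    obtain ⟨φ₁, h₁⟩ := q₁.2.exists_presents
    obtain ⟨φ₂, h₂⟩ := q₂.2.exists_presents
    obtain ⟨φ₃, h₃⟩ := q₃.2.exists_presents
    exact h₁.genericallyAgree_of_equiv q₁.2.flatInvertible q₃.2.flatInvertible h₃
      (Setoid.trans (h₁.equiv_of_genericallyAgree h₂ h) (h₂.equiv_of_genericallyAgree h₃ h'))

/-- The generically defined map presented by a quasi-map. -/
def associatedMap : QMap X i ⟶ GMap X Y where
  app S := ↾fun q => Quotient.mk _ q.2.exists_presents.choose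
  naturality S T g := by
    ext q
    refine Quotient.sound ?_
    exact (((QMap X i).map g q).2.exists_presents.choose_spec).equiv_of_genericallyAgree
      (q.2.exists_presents.choose_spec.pullback g.unop.hom) fun _ _ _ => rfl

lemma isAssociatedMap_associatedMap : IsAssociatedMap i (associatedMap X i) :=
  fun _ q => ⟨_, q.2.exists_presents.choose_spec, rfl⟩

variable {X i}

lemma IsAssociatedMap.unique {η η' : QMap X i ⟶ GMap X Y} (h : IsAssociatedMap i η)
    (h' : IsAssociatedMap i η') : η = η' := by
  ext S q
  obtain ⟨φ, hφ⟩ := q.2.exists_presents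
  exact (h.app_eq hφ).trans (h'.app_eq hφ).symm

/-- `ℰ_Y` is the kernel relation of `η`: this makes the induced map well defined and injective over
each base. -/
lemma IsAssociatedMap.app_eq_app_iff {η : QMap X i ⟶ GMap X Y} (h : IsAssociatedMap i η)
    {S : (Aff k)ᵒᵖ} (q q' : (QMap X i).obj S) : η.app S q = η.app S q' ↔ relE X i S q q' := by
  obtain ⟨φ, hφ⟩ := q.2.exists_presents
  obtain ⟨φ', hφ'⟩ := q'.2.exists_presents
  rw [h.app_eq hφ, h.app_eq hφ']
  exact ⟨fun e => hφ.genericallyAgree_of_equiv q.2.flatInvertible q'.2.flatInvertible hφ'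
    (Quotient.exact e), fun e => Quotient.sound (hφ.equiv_of_genericallyAgree hφ' e)⟩

/-- The map induced on the quotient by `ℰ_Y`, over a fixed base. -/
def IsAssociatedMap.descFun {η : QMap X i ⟶ GMap X Y} (h : IsAssociatedMap i η) (S : (Aff k)ᵒᵖ) :
    Quot (relE X i S) → (GMap X Y).obj S :=
  Quot.lift (fun q : (QMap X i).obj S => (η.app S q : (GMap X Y).obj S))
    fun q q' e => (h.app_eq_app_iff q q').mpr e

lemma IsAssociatedMap.descFun_map {η : QMap X i ⟶ GMap X Y} (h : IsAssociatedMap i η)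
    {S T : (Aff k)ᵒᵖ} (g : S ⟶ T) (q : (QMapModE X i).obj S) :
    h.descFun T ((QMapModE X i).map g q) = (GMap X Y).map g (h.descFun S q) := by
  revert q
  refine Quot.ind fun q => ?_
  have e := NatTrans.naturality_apply η g q
  exact e

/-- The map induced on the quotient by `ℰ_Y`. -/
def IsAssociatedMap.desc {η : QMap X i ⟶ GMap X Y} (h : IsAssociatedMap i η) :
    QMapModE X i ⟶ GMap X Y where
  app S := ↾(h.descFun S)
  naturality _ _ g := by
    refine ConcreteCategory.hom_ext _ _ fun q => ?_
    exact h.descFun_map g q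

lemma IsAssociatedMap.toQuotient_desc {η : QMap X i ⟶ GMap X Y} (h : IsAssociatedMap i η) :
    toQuotient X i ≫ h.desc = η := rfl

lemma IsAssociatedMap.desc_injective {η : QMap X i ⟶ GMap X Y} (h : IsAssociatedMap i η)
    (S : (Aff k)ᵒᵖ) : Function.Injective (h.desc.app S) := by
  intro q q' e
  induction q using Quot.inductionOn with | _ q
  induction q' using Quot.inductionOn with | _ q'
  exact Quot.sound ((h.app_eq_app_iff q q').mp e)

/-- Independence of the embedding is claimed for every `Φ` compatible with presentation; this pins
`Φ` down. -/
lemma IsAssociatedMap.eq_desc {η : QMap X i ⟶ GMap X Y} (h : IsAssociatedMap i η)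
    {Φ : QMapModE X i ⟶ GMap X Y} (hΦ : IsAssociatedMap i (toQuotient X i ≫ Φ)) : Φ = h.desc := by
  ext S q
  induction q using Quot.inductionOn with | _ q
  exact ConcreteCategory.congr_hom (NatTrans.congr_app (hΦ.unique h) S) q

/-- Zariski locally on the base, every generically defined map to `Y` is presented by an invertible
subsheaf with flat cokernel. -/
def LocallyPresented (X : Sch k) (i : Y ⟶ projSpace k n) : Prop :=
  ∀ (S : Aff k) (φ : GenMap X Y S.obj) (s : S.obj.left), ∃ (T : Aff k) (g : T ⟶ S),
    IsOpenImmersion g.hom.left ∧ s ∈ Set.range g.hom.left ∧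
    ∃ L : StalkFamily (prodOver T.obj X) (n + 1),
      IsFlatInvertible (pullback.fst T.obj.hom X.hom) L ∧
      ∃ ψ : GenMap X Y T.obj, ψ ≈ φ.pullback g.hom ∧ Presents i L ψ

/-- The induced map is injective over each base and, by `hloc` with `Presents.isQuasiMap`, locally
surjective; such a map is inverted by sheafification. -/
lemma IsAssociatedMap.isIso_sheafification {η : QMap X i ⟶ GMap X Y} (h : IsAssociatedMap i η)
    (hloc : LocallyPresented X i) : IsIso ((zariskiSheafification k).map h.desc) := by
  let f := Functor.whiskerRight h.desc uliftFunctor.{u + 1, u}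
  change IsIso ((presheafToSheaf (zariski k) (Type (u + 1))).map f)
  rw [← GrothendieckTopology.W_iff]
  have hinj : Presheaf.IsLocallyInjective (zariski k) f := by
    refine Presheaf.isLocallyInjective_of_injective _ _ fun S => ?_
    rintro ⟨a⟩ ⟨b⟩ e
    exact congrArg ULift.up (h.desc_injective S (congrArg ULift.down e))
  have hsurj : Presheaf.IsLocallySurjective (zariski k) f := by
    refine ⟨fun {S} x => ?_⟩
    obtain ⟨x⟩ := x
    induction x using Quotient.inductionOn with | _ φ
    intro s
    obtain ⟨T, g, hg, hs, L, hL, ψ, e, hψ⟩ := hloc S φ s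
    refine ⟨T, g, ⟨ULift.up (Quot.mk _ ⟨L, hψ.isQuasiMap hL⟩), ?_⟩, hg, hs⟩
    refine congrArg ULift.up ?_
    exact (h.app_eq (S := op T) (q := ⟨L, hψ.isQuasiMap hL⟩) hψ).trans (Quotient.sound e)
  exact (zariski k).W_of_isLocallyBijective f

end GenericMaps

/-! ### Extension of a generic line to an invertible subsheaf. -/

namespace GenericMaps

variable {k : Type u} [Field k]

/-- One power of `t` clears the denominators of finitely many functions on `D(t)`. -/
lemma exists_pow_mul_extension {Z : Scheme.{u}} {V W : Z.Opens} (hV : IsAffineOpen V) (t : Γ(Z, V))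
    (hW : Z.basicOpen t ≤ W) {ι : Type*} [Finite ι] (a : ι → Γ(Z, W)) :
    ∃ (M : ℕ) (c : ι → Γ(Z, V)), ∀ (z : Z) (hz : z ∈ V) (_ : z ∈ Z.basicOpen t) (hw : z ∈ W) (i : ι),
      Z.presheaf.germ V z hz (c i) =
        Z.presheaf.germ V z hz t ^ M * Z.presheaf.germ W z hw (a i) := by
  have hloc := hV.isLocalization_basicOpen t
  obtain ⟨⟨b, M, hM⟩, hb⟩ := IsLocalization.exist_integer_multiples_of_finite (R := Γ(Z, V))
    (Submonoid.powers t) (S := Γ(Z, Z.basicOpen t))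
    fun i => Z.presheaf.map (homOfLE hW).op (a i)
  choose c hc using hb
  refine ⟨M, c, fun z hz hzt hw i => ?_⟩
  have h1 : Z.presheaf.map (homOfLE (Z.basicOpen_le t)).op (c i) =
      Z.presheaf.map (homOfLE (Z.basicOpen_le t)).op b * Z.presheaf.map (homOfLE hW).op (a i) := hc i
  have h2 := congrArg (Z.presheaf.germ _ z hzt) h1
  rw [map_mul, Z.presheaf.germ_res_apply, Z.presheaf.germ_res_apply, Z.presheaf.germ_res_apply] at h2
  have h3 : t ^ M = b := hM
  rw [h2, ← h3, map_pow]

section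
variable {Z S : Scheme.{u}} (p : Z ⟶ S) [IsAffine S] [IsLocallyNoetherian S]
  [GeometricallyIntegral p] [Flat p] [UniversallyOpen p]

/-- A line in `𝒪^m` over a sufficiently large open subset `U` extends to an invertible subsheaf of
`𝒪_Z^m` with flat cokernel, if `U` is a basic open of a member of an affine open cover that has the
transition functions of an ample line bundle. -/
lemma exists_isFlatInvertible_extension {ι : Type*} [Finite ι] (V : ι → Z.Opens)
    (hV : ∀ l, IsAffineOpen (V l)) (hcov : ∀ z, ∃ l, z ∈ V l) (t : ∀ l, ι → Γ(Z, V l))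
    (ht : ∀ l l', Z.basicOpen (t l l') = V l ⊓ V l')
    (hcoc : ∀ (l l' l'' : ι) (z : Z) (hl : z ∈ V l) (hl' : z ∈ V l'),
      Z.presheaf.germ _ z hl (t l l'') =
        Z.presheaf.germ _ z hl (t l l') * Z.presheaf.germ _ z hl' (t l' l''))
    (o : ι) (h : Γ(Z, V o)) {U : Z.Opens} (hUh : Z.basicOpen h = U)
    (hU : ∀ s, ∃ z ∈ U, p z = s) {m : ℕ} (a : Fin m → Γ(Z, U)) (j : Fin m)
    (ha : ∀ z ∈ U, z ∈ Z.basicOpen (a j)) :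
    ∃ L : StalkFamily Z m, IsFlatInvertible p L ∧
      ∀ (z : Z) (hz : z ∈ U), L z = Submodule.span _ {germVec a z hz} := by
  have hUo : U ≤ V o := hUh ▸ Z.basicOpen_le h
  obtain ⟨M₀, c, hc⟩ := exists_pow_mul_extension (hV o) h hUh.le a
  -- `c` extends a multiple of `a` by a power of `h` to `V o`. To go on to `V l`, multiply by a
  -- power of `t l o`, whose nonvanishing locus is `V l ∩ V o`.
  have hext : ∀ l, ∃ (M : ℕ) (c' : Fin m → Γ(Z, V l)), ∀ (z : Z) (hz : z ∈ V l) (hw : z ∈ V o)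
      (i : Fin m), Z.presheaf.germ _ z hz (c' i) =
        Z.presheaf.germ _ z hz (t l o) ^ M * Z.presheaf.germ _ z hw (c i) := by
    intro l
    obtain ⟨M, c', hc'⟩ := exists_pow_mul_extension (W := V o) (hV l) (t l o)
      ((ht l o).le.trans inf_le_right) c
    exact ⟨M, c', fun z hz hw => hc' z hz (by rw [ht]; exact ⟨hz, hw⟩) hw⟩
  choose M₁ c₁ hc₁ using hext
  cases nonempty_fintype ι
  obtain ⟨M, hM⟩ : ∃ M, ∀ l, M₁ l ≤ M := ⟨∑ l, M₁ l, fun l => Finset.single_le_sum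
    (f := M₁) (fun _ _ => Nat.zero_le _) (Finset.mem_univ l)⟩
  -- With one exponent `M` for all `l`, the vectors `e l` transform by `(t l l') ^ M`: for `t l l' =
  -- x_l' / x_l` they behave like `x_l ^ (-M)` and generate a copy of `𝒪(-M)`.
  obtain ⟨e, he⟩ : ∃ e : ∀ l, Fin m → Γ(Z, V l), ∀ (l : ι) (z : Z) (hz : z ∈ V l) (hw : z ∈ V o)
      (i : Fin m), Z.presheaf.germ _ z hz (e l i) =
        Z.presheaf.germ _ z hz (t l o) ^ M * Z.presheaf.germ _ z hw (c i) := by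
    refine ⟨fun l i => t l o ^ (M - M₁ l) * c₁ l i, fun l z hz hw i => ?_⟩
    rw [map_mul, map_pow, hc₁ l z hz hw i, ← mul_assoc, ← pow_add, Nat.sub_add_cancel (hM l)]
  have hunit : ∀ (l l' : ι) (z : Z) (hl : z ∈ V l) (_ : z ∈ V l'),
      IsUnit (Z.presheaf.germ _ z hl (t l l')) := by
    intro l l' z hl hl'
    rw [← Scheme.mem_basicOpen, ht]
    exact ⟨hl, hl'⟩
  -- Over `U ⊆ V o` this is the cocycle identity; it extends to `V l ∩ V l'` by schematic density.
  have hglue : ∀ (l l' : ι) (z : Z) (hl : z ∈ V l) (hl' : z ∈ V l') (i : Fin m),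
      Z.presheaf.germ _ z hl (e l i) =
        Z.presheaf.germ _ z hl (t l l') ^ M * Z.presheaf.germ _ z hl' (e l' i) := by
    intro l l' z hl hl' i
    have hdiff := section_eq_zero_of_surjective p hU (V := V l ⊓ V l')
      (Z.presheaf.map (homOfLE inf_le_left).op (e l i) -
        Z.presheaf.map (homOfLE inf_le_left).op (t l l') ^ M *
          Z.presheaf.map (homOfLE inf_le_right).op (e l' i)) fun w hw hwU => by
        rw [map_sub, map_mul, map_pow, Z.presheaf.germ_res_apply, Z.presheaf.germ_res_apply,
          Z.presheaf.germ_res_apply, he l w hw.1 (hUo hwU), he l' w hw.2 (hUo hwU),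
          hcoc l l' o w hw.1 hw.2, mul_pow]
        ring
    have hz : z ∈ V l ⊓ V l' := ⟨hl, hl'⟩
    have := congrArg (Z.presheaf.germ (V l ⊓ V l') z hz) hdiff
    rw [map_sub, map_mul, map_pow, Z.presheaf.germ_res_apply, Z.presheaf.germ_res_apply,
      Z.presheaf.germ_res_apply, map_zero] at this
    exact sub_eq_zero.mp this
  let L : StalkFamily Z m := fun z => ⨆ (l : ι) (hl : z ∈ V l), Submodule.span _ {germVec (e l) z hl}
  have hL : ∀ (l : ι) (z : Z) (hl : z ∈ V l), L z = Submodule.span _ {germVec (e l) z hl} := by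
    intro l z hl
    apply le_antisymm
    · refine iSup₂_le fun l' hl' => ?_
      rw [Submodule.span_singleton_le_iff_mem, Submodule.mem_span_singleton]
      exact ⟨_, funext fun i => (hglue l' l z hl' hl i).symm⟩
    · exact le_iSup₂ (f := fun (l : ι) (hl : z ∈ V l) => Submodule.span _ {germVec (e l) z hl}) l hl
  -- Over `U` each `e l` is a unit times `a`. So the new subsheaf restricts to the given line, and
  -- the `j`-th entry of `e l` is invertible on `U`, which yields freeness and flatness.
  have hgerm : ∀ (l : ι) (z : Z) (hl : z ∈ V l) (hz : z ∈ U), ∃ r, IsUnit r ∧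
      ∀ i, Z.presheaf.germ _ z hl (e l i) = r * Z.presheaf.germ _ z hz (a i) := by
    intro l z hl hz
    refine ⟨Z.presheaf.germ _ z hl (t l o) ^ M * Z.presheaf.germ _ z (hUo hz) h ^ M₀,
      ((hunit l o z hl (hUo hz)).pow _).mul (IsUnit.pow _ ?_), fun i => ?_⟩
    · rw [← Scheme.mem_basicOpen, hUh]
      exact hz
    · rw [he l z hl (hUo hz), hc z (hUo hz) (by rw [hUh]; exact hz) hz, mul_assoc]
  refine ⟨L, fun z => ?_, fun z hz => ?_⟩
  · obtain ⟨l, hl⟩ := hcov z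
    refine ⟨V l, e l, hV l, hl, hL l, free_and_flat_of_surjective p hU (hV l) (e l) j ?_⟩
    intro w hw hwU
    obtain ⟨r, hr, hre⟩ := hgerm l w hw hwU
    rw [Scheme.mem_basicOpen _ _ _ hw, hre]
    exact hr.mul ((Scheme.mem_basicOpen _ _ _ hwU).mp (ha w hwU))
  · obtain ⟨r, hr, hre⟩ := hgerm o z (hUo hz) hz
    rw [hL o z (hUo hz)]
    have h1 : germVec (e o) z (hUo hz) = r • germVec a z hz := funext hre
    rw [h1]
    exact Submodule.span_singleton_smul_eq hr _

end

end GenericMaps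

namespace GenericMaps

variable {k : Type u} [Field k]

lemma exists_appLE_ι_eq {Z : Scheme.{u}} (U : Z.Opens) (b : Γ(U, ⊤)) :
    ∃ a : Γ(Z, U), U.ι.appLE U ⊤ (fun w _ => w.2) a = b := by
  refine ⟨U.topIso.hom b, ?_⟩
  have h : U.topIso.hom ≫ U.ι.appLE U ⊤ (fun w _ => w.2) = 𝟙 _ := by
    rw [← U.topIso.hom_inv_id]
    congr 1
    simp only [Scheme.Opens.topIso_inv, Scheme.Hom.appLE, Scheme.Opens.ι_app]
    exact (Z.presheaf.map_comp _ _).symm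
  exact ConcreteCategory.congr_hom h b

variable {X : Sch k} [Flat X.hom] [UniversallyOpen X.hom] [GeometricallyIntegral X.hom]
  {n : ℕ} {Y : Sch k} {i : Y ⟶ projSpace k n} {N : ℕ}

/-- On `U` the map goes to one chart, so it is the vector of functions `x_l / x_j`, with `j`-th
entry `1`. The charts of `ℙᴺ`, pulled back along `β`, provide the affine cover along which this line
is extended. -/
lemma exists_presents_of_surjective_basicOpen {S : Aff k} (φ : GenMap X Y S.obj)
    (β : prodOver S.obj X ⟶ (projSpace k N).left) [IsAffineHom β] (o : Fin (N + 1))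
    (h : Γ(prodOver S.obj X, β ⁻¹ᵁ (chart k N o).1)) {U : (prodOver S.obj X).Opens}
    (hUh : (prodOver S.obj X).basicOpen h = U) (j : Fin (n + 1)) (hdom : U ≤ φ.dom)
    (hj : ∀ w : (φ.dom : Scheme.{u}), φ.dom.ι w ∈ U → (φ.hom ≫ i.left) w ∈ (chart k n j).1)
    (hsurj : ∀ s, ∃ z ∈ U, pullback.fst S.obj.hom X.hom z = s) :
    ∃ L : StalkFamily (prodOver S.obj X) (n + 1),
      IsFlatInvertible (pullback.fst S.obj.hom X.hom) L ∧
      ∃ ψ : GenMap X Y S.obj, ψ ≈ φ ∧ Presents i L ψ := by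
  have := S.property.1
  have := isLocallyNoetherian_left S
  let α : (U : Scheme.{u}) ⟶ (projSpace k n).left :=
    ((prodOver S.obj X).homOfLE hdom ≫ φ.hom) ≫ i.left
  have hα : ∀ w, α w ∈ (chart k n j).1 := fun w => hj ((prodOver S.obj X).homOfLE hdom w) (by
    rw [← Scheme.Hom.comp_apply, Scheme.homOfLE_ι]
    exact w.2)
  choose a ha using fun l => exists_appLE_ι_eq U
    (α.appLE (chart k n j).1 ⊤ (fun w _ => hα w) (chartVec k j l))
  have hvec : ∀ w : (U : Scheme.{u}), stalkVec (n + 1) U.ι w (germVec a (U.ι w) w.2) = pullbackVec α w (hα w) := by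
    intro w
    ext l
    refine (stalkMap_germ_appLE U.ι (U := ⊤) (fun w _ => w.2) w trivial (a l)).trans ?_
    rw [ha]
    exact (stalkMap_germ_appLE α (V := (chart k n j).1) (U := ⊤) (fun w _ => hα w) w trivial
      (chartVec k j l)).symm
  have haj : ∀ z ∈ U, z ∈ (prodOver S.obj X).basicOpen (a j) := by
    intro z hz
    rw [Scheme.mem_basicOpen _ _ _ hz]
    let w : (U : Scheme.{u}) := ⟨z, hz⟩
    have h1 : (U.ι.stalkMap w).hom ((prodOver S.obj X).presheaf.germ U (U.ι w) hz (a j)) = 1 :=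
      (congrFun (hvec w) j).trans (pullbackVec_self α w (hα w))
    exact isUnit_of_map_unit (U.ι.stalkMap w).hom _ (h1 ▸ isUnit_one)
  obtain ⟨L, hL, hLU⟩ := exists_isFlatInvertible_extension (pullback.fst S.obj.hom X.hom)
    (fun l => β ⁻¹ᵁ (chart k N l).1) (fun l => (chart k N l).2.preimage β)
    (fun z => chart_cover (β z)) (fun l l' => β.app _ (chartVec k l l'))
    (fun l l' => by
      rw [← Scheme.preimage_basicOpen]
      exact congrArg (β ⁻¹ᵁ ·) (basicOpen_ratio l l'))
    (fun l l' l'' z hl hl' => by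
      have h1 := congrArg (β.stalkMap z).hom (congrFun (germVec_chartVec l l' (β z) hl hl') l'')
      rw [Pi.smul_apply, smul_eq_mul, map_mul] at h1
      have h2 : ∀ (l l'' : Fin (N + 1)) (hl : β z ∈ (chart k N l).1),
          (β.stalkMap z).hom (germVec (chartVec k l) (β z) hl l'') =
            (prodOver S.obj X).presheaf.germ _ z hl (β.app _ (chartVec k l l'')) :=
        fun l l'' hl => Scheme.Hom.germ_stalkMap_apply β _ z hl _
      exact (h2 _ _ hl).symm.trans (h1.trans (congrArg₂ (· * ·) (h2 _ _ hl) (h2 _ _ hl'))))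
    o h hUh hsurj a j haj
  refine ⟨L, hL, ⟨U, isDomainFamily_iff.mpr hsurj, (prodOver S.obj X).homOfLE hdom ≫ φ.hom, ?_⟩,
    ⟨U, le_rfl, hdom, isDomainFamily_iff.mpr hsurj, ?_⟩, ?_, ?_⟩
  · rw [Category.assoc, φ.w, Scheme.homOfLE_ι_assoc]
  · simp
  · intro z hz
    exact (isRegularAt_iff_of_span hz (hLU z hz)).mpr ⟨j, haj z hz⟩
  · funext w
    rw [StalkFamily.pullback_span U.ι L w _ (hLU (U.ι w) w.2), hvec w]
    exact taut_pullback_eq_span α w (hα w)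

/-- Zariski locally on the base, every generically defined map is presented by a quasi-map. -/
lemma locallyPresented (hX : IsProjective X) (i : Y ⟶ projSpace k n) : LocallyPresented X i := by
  obtain ⟨N, c, hc⟩ := hX
  intro S φ s
  have := S.property.1
  have := S.property.2
  obtain ⟨z, hz, hzs⟩ := isDomainFamily_iff.mp φ.isDomainFamily s
  -- `S × X ⟶ X` is affine because `S` is, and `X ⟶ ℙᴺ` is a closed immersion.
  have hβ : ∀ (S : Aff k), IsAffineHom (pullback.snd S.obj.hom X.hom ≫ c.left) := by
    intro S
    have := S.property.1
    have : IsAffineHom S.obj.hom := inferInstance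
    have : IsAffineHom (pullback.snd S.obj.hom X.hom) :=
      isAffineHom_isStableUnderBaseChange.of_isPullback (IsPullback.of_hasPullback _ _) this
    have : IsAffineHom c.left := inferInstance
    exact inferInstance
  have := hβ S
  let β := pullback.snd S.obj.hom X.hom ≫ c.left
  obtain ⟨o, ho⟩ := chart_cover (β z)
  obtain ⟨j, hj⟩ := chart_cover ((φ.hom ≫ i.left) ⟨z, hz⟩)
  -- `D(h)` is a neighbourhood of `z` inside the part of the domain of `φ` that maps to the chart
  -- `j`.
  obtain ⟨h, hle, hzh⟩ := ((chart k N o).2.preimage β).exists_basicOpen_le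
    (V := φ.dom.ι ''ᵁ ((φ.hom ≫ i.left) ⁻¹ᵁ (chart k n j).1)) ⟨z, ⟨_, hj, rfl⟩⟩ ho
  have hopen := (pullback.fst S.obj.hom X.hom).isOpenMap _ ((prodOver S.obj X).basicOpen h).2
  -- Restricting the base to an affine neighbourhood of `s` inside the open image of `D(h)` makes
  -- `D(h)` meet every fibre.
  obtain ⟨T₀, hT₀, hsT, hTle⟩ := exists_isAffineOpen_mem_and_subset
    (U := (⟨_, hopen⟩ : S.obj.left.Opens)) (x := s) ⟨z, hzh, hzs⟩
  let T : Aff k := ⟨Over.mk (T₀.ι ≫ S.obj.hom), hT₀,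
    inferInstanceAs (LocallyOfFiniteType (T₀.ι ≫ S.obj.hom))⟩
  let g : T ⟶ S := ⟨Over.homMk T₀.ι rfl⟩
  refine ⟨T, g, inferInstanceAs (IsOpenImmersion T₀.ι), ⟨⟨s, hsT⟩, rfl⟩, ?_⟩
  let G := prodMap g.hom X
  have hGβ : G ≫ β = pullback.snd T.obj.hom X.hom ≫ c.left := by
    rw [← Category.assoc, prodMap_snd]
  have : IsAffineHom (G ≫ β) := hGβ ▸ hβ T
  have hG : (prodOver T.obj X).basicOpen (G.app _ h) = G ⁻¹ᵁ (prodOver S.obj X).basicOpen h :=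
    (Scheme.preimage_basicOpen G h).symm
  refine exists_presents_of_surjective_basicOpen (φ.pullback g.hom) (G ≫ β) o (G.app _ h) hG j
    ?_ ?_ ?_
  · intro w hw
    obtain ⟨w', -, e⟩ := hle hw
    change G w ∈ φ.dom
    exact e ▸ w'.2
  · intro w hw
    obtain ⟨w', hw', e⟩ := hle hw
    have h1 : w' = (G ∣_ φ.dom) w := by
      refine φ.dom.ι.isOpenEmbedding.injective (e.trans ?_)
      have := morphismRestrict_ι G φ.dom
      exact (congrArg (fun (f : ((G ⁻¹ᵁ φ.dom : (prodOver T.obj X).Opens) : Scheme.{u}) ⟶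
        prodOver S.obj X) => f w) this).symm
    rw [h1] at hw'
    exact hw'
  · intro t
    obtain ⟨y, hy, hyt⟩ := hTle t.2
    obtain ⟨w, hw, hwt⟩ := Scheme.exists_preimage_of_isPullback (prodMap_isPullback g.hom X) y t hyt
    exact ⟨w, show G w ∈ _ from hw ▸ hy, hwt⟩

end GenericMaps

end

theorem mainTheorem4 {k : Type u} [Field k] [IsAlgClosed k] [CharZero k]
    (X : Sch k) [ConnectedSpace X.left] [SmoothOfRelativeDimension 1 X.hom] (hX : IsProjective X)
    (Y : Sch k) (n : ℕ) (i : Y ⟶ projSpace k n) [IsImmersion i.left] :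
    (∀ S, Equivalence (relE X i S)) ∧
    (∃! η : QMap X i ⟶ GMap X Y, IsAssociatedMap i η) ∧
    (∀ η : QMap X i ⟶ GMap X Y, IsAssociatedMap i η →
      ∃ Φ : QMapModE X i ⟶ GMap X Y, toQuotient X i ≫ Φ = η ∧
        IsIso ((zariskiSheafification k).map Φ)) ∧
    (∀ (n' : ℕ) (i' : Y ⟶ projSpace k n') [IsImmersion i'.left],
      ∃ e : (zariskiSheafification k).obj (QMapModE X i) ≅
          (zariskiSheafification k).obj (QMapModE X i'),
        ∀ (Φ : QMapModE X i ⟶ GMap X Y) (Φ' : QMapModE X i' ⟶ GMap X Y),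
          IsAssociatedMap i (toQuotient X i ≫ Φ) → IsAssociatedMap i' (toQuotient X i' ≫ Φ') →
          e.hom ≫ (zariskiSheafification k).map Φ' = (zariskiSheafification k).map Φ) := by
  have : Smooth X.hom := SmoothOfRelativeDimension.smooth 1 X.hom
  have : IsIntegral X.left := isIntegral_of_smooth_of_connectedSpace X.hom
  have : GeometricallyIntegral X.hom := geometricallyIntegral_of_isAlgClosed X.hom
  have : Flat X.hom := inferInstance
  have : UniversallyOpen X.hom := inferInstance
  have hη := isAssociatedMap_associatedMap X i
  refine ⟨equivalence_relE X i, ⟨_, hη, fun η' h' => h'.unique hη⟩,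
    fun η h => ⟨h.desc, h.toQuotient_desc, h.isIso_sheafification (locallyPresented hX i)⟩, ?_⟩
  intro n' i' _
  have hη' := isAssociatedMap_associatedMap X i'
  have := hη.isIso_sheafification (locallyPresented hX i)
  have := hη'.isIso_sheafification (locallyPresented hX i')
  -- Both quotients sheafify to the sheafification of `GMap X Y`, which does not refer to the
  -- embedding; the isomorphism passes through it.
  refine ⟨asIso ((zariskiSheafification k).map hη.desc) ≪≫
    (asIso ((zariskiSheafification k).map hη'.desc)).symm, fun Φ Φ' hΦ hΦ' => ?_⟩
  rw [hη.eq_desc hΦ, hη'.eq_desc hΦ']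
  simp
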